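/- All finite graphs are simple with at least one vertex. For a finite graph $G$ with $v(G)$ vertices let $m_k(G)$ be the number of $k$-edge matchings of $G$ ($m_0(G)=1$), $\nu(G)$ the largest size of a matching, $p^*(G)=2\nu(G)/v(G)$, and for $t\ge 0$ $$M(G,t)=\sum_{k=0}^{\lfloor v(G)/2\rfloor} m_k(G)t^k,\qquad p(G,t)=\frac{2t\,\frac{d}{dt}M(G,t)}{v(G)\,M(G,t)},\qquad F(G,t)=\frac{\ln M(G,t)}{v(G)}-\frac12\,p(G,t)\ln t ,$$ with the convention $F(G,0)=0$. If $G$ has an edge, then $t\mapsto p(G,t)$ is an increasing bijection $[0,\infty)\to[0,p^*(G))$; let $p\mapsto t(G,p)$ be its inverse. The entropy function of $G$ is $\lambda_G(p)=F(G,t(G,p))$ for $0\le p<p^*(G)$, $\lambda_G(p^*(G))=\lim_{p\nearrow p^*(G)}\lambda_G(p)$, and $\lambda_G(p)=0$ for $p>p^*(G)$. Let $a,b$ be positive integers, let $H(q)=-(q\ln q+(1-q)\ln(1-q))$ for $0\le q\le1$ (with $H(0)=H(1)=0$), and let $$\mathbb{G}_{a,b}(p)=\frac{a}{a+b}H\!\left(\frac{a+b}{2a}p\right)+\frac{b}{a+b}H\!\left(\frac{a+b}{2b}p\right)+\frac12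 p\ln(ab)-\frac{ab}{a+b}H\!\left(\frac{a+b}{2ab}p\right),\qquad 0\le p\le p_0:=\min\!\left(\frac{2a}{a+b},\frac{2b}{a+b}\right).$$ Let $\mathbb{T}_{a,b}$ be the random rooted tree which is the $(a,b)$-biregular tree rooted at a vertex of degree $b$ with probability $\frac{a}{a+b}$, and rooted at a vertex of degree $a$ with probability $\frac{b}{a+b}$. A sequence $(G_i)$ of finite graphs Benjamini--Schramm converges to $\mathbb{T}_{a,b}$ if for every integer $r\ge1$ and every finite rooted graph $\alpha$ the probability that the $r$-ball around a uniformly random vertex of $G_i$ is isomorphic (as a rooted graph) to $\alpha$ converges to the probability that the $r$-ball around the root of $\mathbb{T}_{a,b}$ is isomorphic to $\alpha$. The entropy function $\lambda_{\mathbb{T}_{a,b}}$ on $[0,p_0]$ is defined by $\lambda_{\mathbb{T}_{a,b}}(p)=\lim_{i\to\infty}\lambda_{G_i}(p)$ for $0\le p<p_0$, where $(G_i)$ is any sequence of finite graphs of uniformly bounded degree with $p^*(G_i)\ge p_0$ for all $i$ that Benjamini--Schramm converges to $\mathbb{T}_{a,b}$, and by $\lambda_{\mathbb{T}_{a,b}}(p_0)=\lim_{p\nearrow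 p_0}\lambda_{\mathbb{T}_{a,b}}(p)$. **Theorem.** Let $a,b$ be positive integers. 1. Let $G$ be a finite $(a,b)$-biregular bipartite graph, i.e. its vertex set is the disjoint union of two sets $A$ and $B$, every edge joins $A$ to $B$, every vertex in $A$ has degree $a$ and every vertex in $B$ has degree $b$. Then $$\lambda_G(p)\ge \mathbb{G}_{a,b}(p)\qquad\text{for every } 0\le p\le \min\!\left(\frac{2a}{a+b},\frac{2b}{a+b}\right).$$ 2. The function $\lambda_{\mathbb{T}_{a,b}}$ is well defined on $[0,p_0]$ (sequences $(G_i)$ as above exist, and for all of them the limits exist and agree), and $$\lambda_{\mathbb{T}_{a,b}}(p)=\mathbb{G}_{a,b}(p)\qquad\text{for every } 0\le p\le \min\!\left(\frac{2a}{a+b},\frac{2b}{a+b}\right).$$ -/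

import Mathlib

open Filter Topology MeasureTheory

namespace MonomerDimer

noncomputable section

/-! ### Matchings, density and entropy of a finite graph -/

section FiniteGraphs

universe u

variable {V : Type u} [Fintype V]

/-- The `k`-matchings of `G`: sets of `k` edges of `G`, no two of which share a vertex. -/
def matchings (G : SimpleGraph V) (k : ℕ) : Set (Finset (Sym2 V)) :=
  {M | M.card = k ∧ (∀ e ∈ M, e ∈ G.edgeSet) ∧
    ∀ e ∈ M, ∀ f ∈ M, e ≠ f → ∀ v : V, ¬ (v ∈ e ∧ v ∈ f)}

/-- `m_k(G)`, the number of `k`-matchings. -/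
def matchingCount (G : SimpleGraph V) (k : ℕ) : ℕ := (matchings G k).ncard

/-- The matching generating function `M(G,t) = ∑_k m_k(G) t^k`. -/
def matchingGen (G : SimpleGraph V) (t : ℝ) : ℝ :=
  ∑ k ∈ Finset.range (Fintype.card V / 2 + 1), (matchingCount G k : ℝ) * t ^ k

/-- The density function `p(G,t) = 2 t M'(G,t) / (v(G) M(G,t))`. -/
def density (G : SimpleGraph V) (t : ℝ) : ℝ :=
  2 * t * deriv (matchingGen G) t / (Fintype.card V * matchingGen G t)

/-- `F(G,t) = ln M(G,t) / v(G) - (1/2) p(G,t) ln t`. -/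
def freeEntropy (G : SimpleGraph V) (t : ℝ) : ℝ :=
  Real.log (matchingGen G t) / Fintype.card V - 1 / 2 * density G t * Real.log t

/-- `ν(G)`, the number of edges in a largest matching. -/
def matchingNumber (G : SimpleGraph V) : ℕ := sSup {k | (matchings G k).Nonempty}

/-- `p*(G) = 2 ν(G) / v(G)`. -/
def pStar (G : SimpleGraph V) : ℝ := 2 * (matchingNumber G : ℝ) / Fintype.card V

/-- `t(G,p)`: the inverse of the density function `t ↦ p(G,t)`, `[0,∞) → [0,p*(G))`. -/
def activity (G : SimpleGraph V) (p : ℝ) : ℝ :=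
  Function.invFunOn (density G) (Set.Ici 0) p

/-- The entropy function `λ_G(p)`, for `p ≥ 0`: it is `F(G,t(G,p))` for `p < p*(G)`, the limit of
these values from the left at `p = p*(G)`, and `0` for `p > p*(G)`. -/
def entropy (G : SimpleGraph V) (p : ℝ) : ℝ :=
  open Classical in
  if p < pStar G then freeEntropy G (activity G p)
  else if p = pStar G then limUnder (𝓝[<] p) (fun q => freeEntropy G (activity G q))
  else 0

/-- `G` is an `(a,b)`-biregular bipartite graph: its vertices split into classes `A` and `B`, each
edge joins the two classes, and the vertices of `A` (of `B`) have exactly `a` (exactly `b`)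
neighbours. -/
def IsBiregularBipartite (G : SimpleGraph V) (a b : ℕ) : Prop :=
  ∃ A B : Set V, G.IsBipartiteWith A B ∧ A ∪ B = Set.univ ∧
    (∀ v ∈ A, (G.neighborSet v).ncard = a) ∧ (∀ v ∈ B, (G.neighborSet v).ncard = b)

end FiniteGraphs

/-- The function `𝔾_{a,b}(p)`; `Real.binEntropy q = -(q ln q + (1 - q) ln (1 - q))`. -/
def biregularG (a b : ℕ) (p : ℝ) : ℝ :=
  (a : ℝ) / (a + b) * Real.binEntropy ((a + b) / (2 * a) * p)
    + (b : ℝ) / (a + b) * Real.binEntropy ((a + b) / (2 * b) * p)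
    + 1 / 2 * p * Real.log (a * b)
    - (a : ℝ) * b / (a + b) * Real.binEntropy ((a + b) / (2 * a * b) * p)

/-- The right end `min (2a/(a+b), 2b/(a+b))` of the domain of `𝔾_{a,b}`. -/
def biregularEnd (a b : ℕ) : ℝ := min (2 * (a : ℝ) / (a + b)) (2 * (b : ℝ) / (a + b))

/-! ### Rooted graphs and Benjamini–Schramm convergence -/

/-- A graph with a distinguished vertex. -/
structure RootedGraph where
  V : Type
  graph : SimpleGraph V
  root : V

/-- Isomorphism of rooted graphs. -/
def RootedGraph.IsIso (R S : RootedGraph) : Prop :=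
  ∃ e : R.graph ≃g S.graph, e R.root = S.root

/-- The `r`-ball around the root, rooted at the same vertex. -/
def RootedGraph.ball (R : RootedGraph) (r : ℕ) : RootedGraph where
  V := {w : R.V // R.graph.edist R.root w ≤ r}
  graph := R.graph.comap Subtype.val
  root := ⟨R.root, by simp⟩

/-- A finite graph with at least one vertex. -/
structure FiniteGraph where
  V : Type
  [fintypeV : Fintype V]
  [nonemptyV : Nonempty V]
  graph : SimpleGraph V

attribute [instance] FiniteGraph.fintypeV FiniteGraph.nonemptyV

/-- `ℙ(G,α,r)`: the probability that the `r`-ball around a uniform random vertex of `G` is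
isomorphic to `α`. -/
def FiniteGraph.ballProb (G : FiniteGraph) (α : RootedGraph) (r : ℕ) : ℝ :=
  ({v : G.V | ((RootedGraph.mk G.V G.graph v).ball r).IsIso α}.ncard : ℝ) / Fintype.card G.V

/-- A random rooted graph: a rooted graph depending on a point of a probability space, such that
the isomorphism type of the ball of any radius around the root is an event. -/
structure RandomRootedGraph where
  Ω : Type
  [measurableSpace : MeasurableSpace Ω]
  law : Measure Ω
  [isProbabilityMeasure : IsProbabilityMeasure law]
  sample : Ω → RootedGraph
  measurable_ball : ∀ (α : RootedGraph) (r : ℕ), Finite α.V →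
    MeasurableSet {ω | ((sample ω).ball r).IsIso α}

attribute [instance] RandomRootedGraph.measurableSpace RandomRootedGraph.isProbabilityMeasure

/-- `ℙ(L,α,r)`: the probability that the `r`-ball around the root of `L` is isomorphic to `α`. -/
def RandomRootedGraph.ballProb (L : RandomRootedGraph) (α : RootedGraph) (r : ℕ) : ℝ :=
  L.law.real {ω | ((L.sample ω).ball r).IsIso α}

/-- The finite graphs `G_i` have uniformly bounded degrees. -/
def BoundedDegree (G : ℕ → FiniteGraph) : Prop :=
  ∃ D : ℕ, ∀ i, ∀ v : (G i).V, ((G i).graph.neighborSet v).ncard ≤ D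

/-- `(G_i)` converges to `L` in the sense of Benjamini and Schramm. -/
def BSConverges (G : ℕ → FiniteGraph) (L : RandomRootedGraph) : Prop :=
  ∀ (α : RootedGraph) (r : ℕ), Finite α.V → 0 < r →
    Tendsto (fun i => (G i).ballProb α r) atTop (𝓝 (L.ballProb α r))

/-- The sequences through which the entropy function of `L` is defined on `[0,p₀]`. -/
structure Approximates (G : ℕ → FiniteGraph) (L : RandomRootedGraph) (p₀ : ℝ) : Prop where
  boundedDegree : BoundedDegree G
  bsConverges : BSConverges G L
  le_pStar : ∀ i, p₀ ≤ pStar (G i).graph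

/-- `f` is the entropy function `λ_L` of the random rooted graph `L` on `[0,p₀]`: `L` is the
Benjamini–Schramm limit of some sequence of finite graphs `G_i` of bounded degree with
`p*(G_i) ≥ p₀`; for every such sequence and every `0 ≤ p < p₀` the values `λ_{G_i}(p)` converge to
`f p`; and `f p₀` is the limit of `f p` as `p` tends to `p₀` from the left. -/
structure IsEntropyFunction (L : RandomRootedGraph) (p₀ : ℝ) (f : ℝ → ℝ) : Prop where
  exists_approx : ∃ G : ℕ → FiniteGraph, Approximates G L p₀
  tendsto_entropy : ∀ G : ℕ → FiniteGraph, Approximates G L p₀ → ∀ p : ℝ, 0 ≤ p → p < p₀ →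
    Tendsto (fun i => entropy (G i).graph p) atTop (𝓝 (f p))
  tendsto_end : Tendsto f (𝓝[<] p₀) (𝓝 (f p₀))

/-! ### The biregular tree -/

/-- The number of children of a vertex at distance `n` from the root in the `(a,b)`-biregular tree
whose root has degree `a`. -/
def numChildren (a b n : ℕ) : ℕ := if n = 0 then a else if Even n then a - 1 else b - 1

/-- The words which are the vertices of the `(a,b)`-biregular tree whose root has degree `a`: the
root is the empty word, and the children of a word `l` are the words `c :: l` with
`c < numChildren a b l.length`. -/
def IsTreeWord (a b : ℕ) : List ℕ → Prop
  | [] => True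
  | c :: l => c < numChildren a b l.length ∧ IsTreeWord a b l

/-- The `(a,b)`-biregular tree: every word is adjacent to its children. -/
def biregularTreeGraph (a b : ℕ) : SimpleGraph {l : List ℕ // IsTreeWord a b l} :=
  SimpleGraph.fromRel (fun u v => ∃ c : ℕ, v.val = c :: u.val)

/-- The `(a,b)`-biregular tree, rooted at a vertex of degree `a`. -/
def rootedBiregularTree (a b : ℕ) : RootedGraph where
  V := {l : List ℕ // IsTreeWord a b l}
  graph := biregularTreeGraph a b
  root := ⟨[], trivial⟩

/-- The random rooted tree `𝕋_{a,b}`: the `(a,b)`-biregular tree, where the root has degree `b`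
with probability `a/(a+b)` and degree `a` with probability `b/(a+b)`. -/
def biregularTree (a b : ℕ) : RandomRootedGraph where
  Ω := Bool
  law := ProbabilityTheory.bernoulliMeasure true false
    ⟨(a : ℝ) / (a + b), by positivity, div_le_one_of_le₀ (by simp) (by positivity)⟩
  sample := fun s => if s then rootedBiregularTree b a else rootedBiregularTree a b
  measurable_ball := fun _ _ _ => MeasurableSet.of_discrete

end

end MonomerDimer

/-!
For an activity `t` let `Φ_G(t) = ln M(G,t) / v(G)` be the pressure of `G`. As a function of `ln t`
it lies above its tangent lines, whose slopes are half the densities (`pressure_ge_tangent`). Hence,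
for `0 < p < p*(G)`, `λ_G(p)` is the minimum over `t > 0` of `Φ_G(t) - (p/2) ln t`, and a graph of
larger pressure has larger entropy.

*The limit.* The density is the average over the vertices `v` of the probability that a random
matching covers `v`. The complementary probability satisfies `x_v = 1 / (1 + t ∑ x_u)`, the sum
being over the neighbours `u` of `v` in the graph without `v` (`uncov_eq`). If the ball of radius
`r` around `v` is that of a biregular tree, then `x_v` can be compared with the solution of this
recursion on the tree, with an error decaying exponentially in `r` (`uncov_bounds`). In terms of the
probability `e` of an edge this solution is rational, at the activity
`t(e) = e (1 - e) / ((1 - a e) (1 - b e))`, and so the densities at `t(e)` converge to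
`2 a b e / (a + b)` along a Benjamini–Schramm convergent sequence (`tendsto_density`). Integration
over `e` gives the convergence of the pressures at `t(e)` to
`(a b ln (1 - e) - a ln (1 - b e) - b ln (1 - a e)) / (a + b)` (`tendsto_pressure`), whose Legendre
transform is `𝔾_{a,b}` (`biregularG_eq`, `tendsto_entropy_biregularG`).

*The lower bound.* A two-fold cover `H` of a bipartite graph `G` has `M(H,t) ≤ M(G,t)²`
(`matchingGen_twoLift_le`): the matchings of `H` with a given projection to `G` are the solutions of
an affine system over `𝔽₂`, the signs of the cover enter only into its right-hand side, and for the
trivial cover the system is solvable since the projection is bipartite. So the pressure does not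
increase under two-fold covers. Taking one for each edge of `G`, one gets a cover of `G` in which
closed walks use every edge of `G` an even number of times, which therefore has larger girth
(`exists_cover_noShortCycles`). By iteration `G` has covers of unbounded girth; they converge to the
biregular tree, and their entropies, which are at most that of `G`, converge to `𝔾_{a,b}`. Applied
to a complete bipartite graph the same construction shows that approximating sequences exist.
-/

namespace MonomerDimer

noncomputable section

open scoped Classical

universe u v w

/-! ### Matching sums over vertex subsets -/

section MatchingSums

variable {V : Type u}

/-- `M` is a set of pairwise disjoint edges of `G`, i.e. a matching. -/
def IsEdgeMatching (G : SimpleGraph V) (M : Finset (Sym2 V)) : Prop :=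
  (∀ e ∈ M, e ∈ G.edgeSet) ∧ ∀ e ∈ M, ∀ f ∈ M, e ≠ f → ∀ v : V, ¬ (v ∈ e ∧ v ∈ f)

variable {G : SimpleGraph V}

lemma IsEdgeMatching.subset {M N : Finset (Sym2 V)} (h : IsEdgeMatching G M) (hN : N ⊆ M) :
    IsEdgeMatching G N :=
  ⟨fun e he => h.1 e (hN he), fun e he f hf => h.2 e (hN he) f (hN hf)⟩

lemma IsEdgeMatching.eq_of_mem {M : Finset (Sym2 V)} (h : IsEdgeMatching G M) {e f : Sym2 V}
    (he : e ∈ M) (hf : f ∈ M) {v : V} (hve : v ∈ e) (hvf : v ∈ f) : e = f := by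
  by_contra hne
  exact h.2 e he f hf hne v ⟨hve, hvf⟩

variable [Fintype V]

/-- The matchings of `G` all of whose edges lie inside the vertex set `S`. -/
def matchingsIn (G : SimpleGraph V) (S : Finset V) : Finset (Finset (Sym2 V)) :=
  Finset.univ.filter fun M => IsEdgeMatching G M ∧ ∀ e ∈ M, ∀ v ∈ e, v ∈ S

/-- The matching generating function of the subgraph of `G` induced on `S`. -/
def genIn (G : SimpleGraph V) (S : Finset V) (t : ℝ) : ℝ :=
  ∑ M ∈ matchingsIn G S, t ^ M.card

lemma mem_matchingsIn {S : Finset V} {M : Finset (Sym2 V)} :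
    M ∈ matchingsIn G S ↔ IsEdgeMatching G M ∧ ∀ e ∈ M, ∀ v ∈ e, v ∈ S := by
  simp [matchingsIn]

lemma one_le_genIn (S : Finset V) {t : ℝ} (ht : 0 ≤ t) : 1 ≤ genIn G S t := by
  have h : (∅ : Finset (Sym2 V)) ∈ matchingsIn G S := by simp [mem_matchingsIn, IsEdgeMatching]
  have := Finset.single_le_sum (f := fun M : Finset (Sym2 V) => t ^ M.card)
    (fun M _ => by positivity) h
  simpa [genIn] using this

lemma genIn_pos (S : Finset V) {t : ℝ} (ht : 0 ≤ t) : 0 < genIn G S t :=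
  lt_of_lt_of_le one_pos (one_le_genIn S ht)

lemma matchingsIn_erase (S : Finset V) (v : V) :
    matchingsIn G (S.erase v) = (matchingsIn G S).filter fun M => ∀ e ∈ M, v ∉ e := by
  ext M
  simp only [mem_matchingsIn, Finset.mem_filter, Finset.mem_erase]
  constructor
  · rintro ⟨h, h'⟩
    exact ⟨⟨h, fun e he w hw => (h' e he w hw).2⟩, fun e he hv => (h' e he v hv).1 rfl⟩
  · rintro ⟨⟨h, h'⟩, h''⟩
    refine ⟨h, fun e he w hw => ⟨?_, h' e he w hw⟩⟩
    rintro rfl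
    exact h'' e he hw

/-- Removing the edge `vu` from the matchings containing it. -/
lemma sum_matchingsIn_of_edge {S : Finset V} {v u : V} (hv : v ∈ S) (hu : u ∈ S) (h : G.Adj v u)
    (t : ℝ) :
    ∑ M ∈ (matchingsIn G S).filter (fun M => s(v, u) ∈ M), t ^ M.card
      = t * genIn G ((S.erase v).erase u) t := by
  rw [genIn, Finset.mul_sum]
  refine Finset.sum_bij' (fun M _ => M.erase s(v, u)) (fun M _ => insert s(v, u) M) ?_ ?_ ?_ ?_ ?_
  · intro M hM
    simp only [Finset.mem_filter, mem_matchingsIn] at hM ⊢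
    obtain ⟨⟨hM, hS⟩, hvu⟩ := hM
    refine ⟨hM.subset (Finset.erase_subset _ _), fun e he w hw => ?_⟩
    rw [Finset.mem_erase] at he
    simp only [Finset.mem_erase]
    refine ⟨?_, ?_, hS e he.2 w hw⟩
    · rintro rfl
      exact he.1 (hM.eq_of_mem he.2 hvu hw (Sym2.mem_mk_right _ _))
    · rintro rfl
      exact he.1 (hM.eq_of_mem he.2 hvu hw (Sym2.mem_mk_left _ _))
  · intro M hM
    simp only [Finset.mem_filter, mem_matchingsIn, Finset.mem_erase] at hM ⊢
    obtain ⟨hM, hS⟩ := hM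
    refine ⟨⟨⟨?_, ?_⟩, ?_⟩, Finset.mem_insert_self _ _⟩
    · intro e he
      rcases Finset.mem_insert.1 he with rfl | he
      · exact h
      · exact hM.1 e he
    · intro e he f hf hne w hw
      rcases Finset.mem_insert.1 he with rfl | he' <;>
        rcases Finset.mem_insert.1 hf with rfl | hf'
      · exact hne rfl
      · rcases Sym2.mem_iff.1 hw.1 with rfl | rfl
        · exact (hS f hf' _ hw.2).2.1 rfl
        · exact (hS f hf' _ hw.2).1 rfl
      · rcases Sym2.mem_iff.1 hw.2 with rfl | rfl
        · exact (hS e he' _ hw.1).2.1 rfl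
        · exact (hS e he' _ hw.1).1 rfl
      · exact hM.2 e he' f hf' hne w hw
    · intro e he w hw
      rcases Finset.mem_insert.1 he with rfl | he
      · rcases Sym2.mem_iff.1 hw with rfl | rfl <;> assumption
      · exact (hS e he w hw).2.2
  · intro M hM
    exact Finset.insert_erase (Finset.mem_filter.1 hM).2
  · intro M hM
    refine Finset.erase_insert fun hmem => ?_
    have := (mem_matchingsIn.1 hM).2 _ hmem v (Sym2.mem_mk_left _ _)
    simp at this
  · intro M hM
    have := Finset.card_erase_add_one (Finset.mem_filter.1 hM).2
    rw [← this, pow_succ, mul_comm]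

/-- The recursion of the matching sums: a vertex `v` of `S` is either uncovered or matched to one
of its neighbours in `S`. -/
lemma genIn_eq_erase_add {S : Finset V} {v : V} (hv : v ∈ S) (t : ℝ) :
    genIn G S t = genIn G (S.erase v) t
      + t * ∑ u ∈ S.filter (G.Adj v), genIn G ((S.erase v).erase u) t := by
  have h1 : genIn G S t = ∑ M ∈ (matchingsIn G S).filter (fun M => ∀ e ∈ M, v ∉ e), t ^ M.card
      + ∑ M ∈ (matchingsIn G S).filter (fun M => ¬ ∀ e ∈ M, v ∉ e), t ^ M.card :=
    (Finset.sum_filter_add_sum_filter_not _ _ _).symm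
  rw [h1, ← matchingsIn_erase]
  congr 1
  have h2 : (matchingsIn G S).filter (fun M => ¬ ∀ e ∈ M, v ∉ e)
      = (S.filter (G.Adj v)).biUnion
          (fun u => (matchingsIn G S).filter (fun M => s(v, u) ∈ M)) := by
    ext M
    simp only [Finset.mem_filter, Finset.mem_biUnion, not_forall, not_not]
    constructor
    · rintro ⟨hM, e, he, hve⟩
      obtain ⟨u, rfl⟩ := Sym2.mem_iff_exists.1 hve
      have h := mem_matchingsIn.1 hM
      exact ⟨u, ⟨h.2 _ he _ (Sym2.mem_mk_right _ _), h.1.1 _ he⟩, hM, he⟩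
    · rintro ⟨u, _, hM, he⟩
      exact ⟨hM, _, he, Sym2.mem_mk_left _ _⟩
  rw [h2, Finset.sum_biUnion, Finset.mul_sum]
  · refine Finset.sum_congr rfl fun u hu => ?_
    rw [Finset.mem_filter] at hu
    exact sum_matchingsIn_of_edge hv hu.1 hu.2 t
  · intro u hu w hw hne
    refine Finset.disjoint_left.2 fun M hM hM' => hne ?_
    rw [Finset.mem_filter, mem_matchingsIn] at hM hM'
    have := hM.1.1.eq_of_mem hM.2 hM'.2 (Sym2.mem_mk_left _ _) (Sym2.mem_mk_left _ _)
    exact Sym2.congr_right.1 this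

/-- The probability that `v` is left uncovered by a random matching of `G[S]` with activity `t`. -/
def uncov (G : SimpleGraph V) (S : Finset V) (v : V) (t : ℝ) : ℝ :=
  genIn G (S.erase v) t / genIn G S t

lemma uncov_pos (S : Finset V) (v : V) {t : ℝ} (ht : 0 ≤ t) : 0 < uncov G S v t :=
  div_pos (genIn_pos _ ht) (genIn_pos _ ht)

lemma uncov_eq {S : Finset V} {v : V} (hv : v ∈ S) {t : ℝ} (ht : 0 ≤ t) :
    uncov G S v t
      = 1 / (1 + t * ∑ u ∈ S.filter (G.Adj v), uncov G (S.erase v) u t) := by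
  have h := genIn_pos (G := G) (S.erase v) ht
  unfold uncov
  rw [genIn_eq_erase_add hv, ← Finset.sum_div]
  field_simp

lemma uncov_le_one {S : Finset V} {v : V} (hv : v ∈ S) {t : ℝ} (ht : 0 ≤ t) :
    uncov G S v t ≤ 1 := by
  rw [uncov_eq hv ht]
  have : 0 ≤ ∑ u ∈ S.filter (G.Adj v), uncov G (S.erase v) u t :=
    Finset.sum_nonneg fun u _ => (uncov_pos _ _ ht).le
  exact div_le_one_of_le₀ (by nlinarith [mul_nonneg ht this]) (by positivity)

/-- The number of vertices covered by a matching is twice its size. -/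
lemma IsEdgeMatching.card_covered {M : Finset (Sym2 V)} (h : IsEdgeMatching G M) :
    (Finset.univ.filter fun v => ∃ e ∈ M, v ∈ e).card = 2 * M.card := by
  have h1 : (Finset.univ.filter fun v => ∃ e ∈ M, v ∈ e) = M.biUnion Sym2.toFinset := by
    ext v; simp
  rw [h1, Finset.card_biUnion]
  · rw [Finset.sum_congr rfl (g := fun _ => 2), Finset.sum_const, smul_eq_mul, mul_comm]
    intro e he
    exact Sym2.card_toFinset_of_not_isDiag e (G.not_isDiag_of_mem_edgeSet (h.1 e he))
  · intro e he f hf hne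
    refine Finset.disjoint_left.2 fun v hv hv' => ?_
    exact h.2 e he f hf hne v ⟨by simpa using hv, by simpa using hv'⟩

lemma IsEdgeMatching.two_mul_card_le {M : Finset (Sym2 V)} (h : IsEdgeMatching G M) :
    2 * M.card ≤ Fintype.card V :=
  h.card_covered ▸ Finset.card_le_univ _

lemma matchings_eq (G : SimpleGraph V) (k : ℕ) :
    matchings G k = ↑((matchingsIn G Finset.univ).filter fun M => M.card = k) := by
  ext M
  simp [matchings, mem_matchingsIn, IsEdgeMatching, and_comm]

lemma matchingCount_eq (G : SimpleGraph V) (k : ℕ) :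
    matchingCount G k = ((matchingsIn G Finset.univ).filter fun M => M.card = k).card := by
  rw [matchingCount, matchings_eq, Set.ncard_coe_finset]

/-- Summing over matchings instead of over their sizes, with a weight depending on the size. -/
lemma sum_matchingCount_mul (G : SimpleGraph V) (w : ℕ → ℝ) :
    ∑ k ∈ Finset.range (Fintype.card V / 2 + 1), (matchingCount G k : ℝ) * w k
      = ∑ M ∈ matchingsIn G Finset.univ, w M.card := by
  rw [← Finset.sum_fiberwise_of_maps_to (t := Finset.range (Fintype.card V / 2 + 1))
    (g := Finset.card)]
  · refine Finset.sum_congr rfl fun k _ => ?_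
    rw [matchingCount_eq, ← nsmul_eq_mul, ← Finset.sum_const]
    exact Finset.sum_congr rfl fun M hM => by rw [(Finset.mem_filter.1 hM).2]
  · intro M hM
    have := (mem_matchingsIn.1 hM).1.two_mul_card_le
    rw [Finset.mem_range]
    omega

lemma matchingGen_eq (G : SimpleGraph V) (t : ℝ) :
    matchingGen G t = genIn G Finset.univ t :=
  sum_matchingCount_mul G fun k => t ^ k

lemma matchingGen_pos (G : SimpleGraph V) {t : ℝ} (ht : 0 ≤ t) : 0 < matchingGen G t := by
  rw [matchingGen_eq]; exact genIn_pos _ ht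

lemma hasDerivAt_matchingGen (G : SimpleGraph V) (t : ℝ) :
    HasDerivAt (matchingGen G)
      (∑ k ∈ Finset.range (Fintype.card V / 2 + 1), (matchingCount G k : ℝ) * (k * t ^ (k - 1)))
      t := by
  unfold matchingGen
  exact HasDerivAt.fun_sum fun k _ => (hasDerivAt_pow k t).const_mul _

lemma mul_deriv_matchingGen (G : SimpleGraph V) (t : ℝ) :
    t * deriv (matchingGen G) t = ∑ M ∈ matchingsIn G Finset.univ, (M.card : ℝ) * t ^ M.card := by
  rw [(hasDerivAt_matchingGen G t).deriv, ← sum_matchingCount_mul G fun k => k * t ^ k,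
    Finset.mul_sum]
  refine Finset.sum_congr rfl fun k _ => ?_
  rcases k with _ | k
  · simp
  · simp only [Nat.add_sub_cancel]; ring

lemma density_eq_sum (G : SimpleGraph V) (t : ℝ) :
    density G t = 2 * (∑ M ∈ matchingsIn G Finset.univ, (M.card : ℝ) * t ^ M.card)
      / (Fintype.card V * genIn G Finset.univ t) := by
  rw [density, mul_assoc, mul_deriv_matchingGen, matchingGen_eq]

/-- The density is the average over the vertices of the probability to be covered. -/
lemma density_eq_avg (G : SimpleGraph V) {t : ℝ} (ht : 0 ≤ t) :
    density G t = (∑ v, (1 - uncov G Finset.univ v t)) / Fintype.card V := by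
  have hpos := genIn_pos (G := G) Finset.univ ht
  have key : 2 * (∑ M ∈ matchingsIn G Finset.univ, (M.card : ℝ) * t ^ M.card)
      = ∑ v, (genIn G Finset.univ t - genIn G (Finset.univ.erase v) t) := by
    have h1 : ∀ v, genIn G Finset.univ t - genIn G (Finset.univ.erase v) t
        = ∑ M ∈ matchingsIn G Finset.univ, if ∃ e ∈ M, v ∈ e then t ^ M.card else 0 := by
      intro v
      have h2 := Finset.sum_filter_add_sum_filter_not (matchingsIn G Finset.univ)
        (fun M => ∃ e ∈ M, v ∈ e) (fun M => t ^ M.card)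
      rw [genIn, genIn, matchingsIn_erase, ← h2, Finset.sum_filter]
      simp
    simp_rw [h1]
    rw [Finset.sum_comm, Finset.mul_sum]
    refine Finset.sum_congr rfl fun M hM => ?_
    rw [← Finset.sum_filter, Finset.sum_const, (mem_matchingsIn.1 hM).1.card_covered, nsmul_eq_mul]
    push_cast; ring
  rw [density_eq_sum, key]
  have h3 : ∑ v, (1 - uncov G Finset.univ v t)
      = (∑ v, (genIn G Finset.univ t - genIn G (Finset.univ.erase v) t))
        / genIn G Finset.univ t := by
    rw [Finset.sum_div]
    exact Finset.sum_congr rfl fun v _ => by rw [uncov, sub_div, div_self hpos.ne']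
  rw [h3, div_div, mul_comm (Fintype.card V : ℝ)]

/-- The density at activity `t` is at most `t` times the maximal degree. -/
lemma density_le_mul_degree [Nonempty V] (G : SimpleGraph V) {D : ℕ}
    (hD : ∀ v, (G.neighborSet v).ncard ≤ D) {t : ℝ} (ht : 0 ≤ t) : density G t ≤ D * t := by
  have hV : (0 : ℝ) < Fintype.card V := by exact_mod_cast Fintype.card_pos
  rw [density_eq_avg G ht, div_le_iff₀ hV]
  have h : ∀ v ∈ Finset.univ, 1 - uncov G Finset.univ v t ≤ D * t := by
    intro v hv
    have h0 : 0 ≤ ∑ u ∈ Finset.univ.filter (G.Adj v), uncov G (Finset.univ.erase v) u t :=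
      Finset.sum_nonneg fun u _ => (uncov_pos _ _ ht).le
    have h1 : ∑ u ∈ Finset.univ.filter (G.Adj v), uncov G (Finset.univ.erase v) u t ≤ D := by
      calc _ ≤ ∑ u ∈ Finset.univ.filter (G.Adj v), (1 : ℝ) := by
            refine Finset.sum_le_sum fun u hu => uncov_le_one ?_ ht
            have := (Finset.mem_filter.1 hu).2.ne'
            simpa using this
        _ = ((G.neighborSet v).ncard : ℝ) := by
            rw [Finset.sum_const, nsmul_eq_mul, mul_one, ← Set.ncard_coe_finset]
            congr 2; ext u; simp
        _ ≤ D := by exact_mod_cast hD v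
    set σ := ∑ u ∈ Finset.univ.filter (G.Adj v), uncov G (Finset.univ.erase v) u t
    rw [uncov_eq hv ht]
    have h2 : 0 ≤ t * σ := mul_nonneg ht h0
    have h3 : 1 - 1 / (1 + t * σ) ≤ t * σ := by
      rw [sub_le_iff_le_add, ← sub_le_iff_le_add', le_div_iff₀ (by linarith)]
      nlinarith
    nlinarith
  calc _ ≤ ∑ v : V, (D * t : ℝ) := Finset.sum_le_sum h
    _ = _ := by simp; ring

end MatchingSums

/-! ### The entropy of a finite graph as a Legendre transform -/

section Entropy

variable {V : Type u} [Fintype V]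

/-- The free energy per vertex, `ln M(G,t) / v(G)`. -/
def pressure (G : SimpleGraph V) (t : ℝ) : ℝ :=
  Real.log (matchingGen G t) / Fintype.card V

lemma freeEntropy_eq (G : SimpleGraph V) (t : ℝ) :
    freeEntropy G t = pressure G t - 1 / 2 * density G t * Real.log t := rfl

lemma pressure_zero (G : SimpleGraph V) : pressure G 0 = 0 := by
  have h : matchingGen G 0 = 1 := by
    rw [matchingGen, Finset.sum_eq_single_of_mem 0 (by simp)]
    · have : matchings G 0 = {∅} := by
        ext M
        simp only [matchings, Set.mem_ofPred_eq, Finset.card_eq_zero, Set.mem_singleton_iff]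
        constructor
        · exact fun h => h.1
        · rintro rfl; simp
      simp [matchingCount, this]
    · intro k _ hk; simp [hk]
  simp [pressure, h]

lemma density_zero (G : SimpleGraph V) : density G 0 = 0 := by simp [density]

lemma density_nonneg (G : SimpleGraph V) {t : ℝ} (ht : 0 ≤ t) : 0 ≤ density G t := by
  rw [density_eq_sum]
  have := genIn_pos (G := G) Finset.univ ht
  positivity

lemma matchingGen_mono (G : SimpleGraph V) {s t : ℝ} (hs : 0 ≤ s) (hst : s ≤ t) :
    matchingGen G s ≤ matchingGen G t := by
  unfold matchingGen
  gcongr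

lemma pressure_mono (G : SimpleGraph V) {s t : ℝ} (hs : 0 ≤ s) (hst : s ≤ t) :
    pressure G s ≤ pressure G t := by
  unfold pressure
  have := matchingGen_pos G hs
  gcongr
  exact matchingGen_mono G hs hst

lemma continuousOn_density (G : SimpleGraph V) [Nonempty V] :
    ContinuousOn (density G) (Set.Ici 0) := by
  have h : density G = fun t => 2 * (∑ M ∈ matchingsIn G Finset.univ, (M.card : ℝ) * t ^ M.card)
      / (Fintype.card V * genIn G Finset.univ t) := funext fun t => density_eq_sum G t
  rw [h]
  have hV : (Fintype.card V : ℝ) ≠ 0 := by exact_mod_cast Fintype.card_ne_zero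
  refine ContinuousOn.div (by fun_prop) ?_ fun t ht => ?_
  · unfold genIn; fun_prop
  · exact mul_ne_zero hV (genIn_pos _ ht).ne'

/-- Gibbs' variational inequality: as a function of `ln t`, the pressure lies above its tangent
lines, whose slopes are the densities. -/
lemma pressure_ge_tangent [Nonempty V] (G : SimpleGraph V) {s t : ℝ} (hs : 0 < s) (ht : 0 < t) :
    pressure G s + 1 / 2 * density G s * (Real.log t - Real.log s) ≤ pressure G t := by
  have hV : (0 : ℝ) < Fintype.card V := by exact_mod_cast Fintype.card_pos
  have hM := genIn_pos (G := G) Finset.univ hs.le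
  set h := Real.log t - Real.log s with hh
  set m := (∑ M ∈ matchingsIn G Finset.univ, (M.card : ℝ) * s ^ M.card) / genIn G Finset.univ s
    with hm
  have hts : t = s * Real.exp h := by
    rw [hh, Real.exp_sub, Real.exp_log ht, Real.exp_log hs]; field_simp
  have key : genIn G Finset.univ s * Real.exp (m * h) ≤ genIn G Finset.univ t := by
    -- the termwise bound `exp x ≥ 1 + x`; the linear parts cancel since `m` is the mean size
    have h1 : ∀ M ∈ matchingsIn G Finset.univ,
        Real.exp (m * h) * (s ^ M.card + h * ((M.card : ℝ) * s ^ M.card) - h * m * s ^ M.card)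
          ≤ t ^ M.card := by
      intro M _
      have h2 : t ^ M.card = s ^ M.card * (Real.exp (m * h) * Real.exp ((M.card - m) * h)) := by
        rw [← Real.exp_add, hts, mul_pow, ← Real.exp_nat_mul]
        congr 2; ring
      have h3 := Real.add_one_le_exp ((M.card - m) * h)
      rw [h2]
      calc _ = s ^ M.card * (Real.exp (m * h) * ((M.card - m) * h + 1)) := by ring
        _ ≤ _ := by gcongr
    have h4 := Finset.sum_le_sum h1
    rw [← Finset.mul_sum, Finset.sum_sub_distrib, Finset.sum_add_distrib, ← Finset.mul_sum,
      ← Finset.mul_sum] at h4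
    have h5 : ∑ M ∈ matchingsIn G Finset.univ, (M.card : ℝ) * s ^ M.card
        = m * genIn G Finset.univ s := by rw [hm, div_mul_cancel₀ _ hM.ne']
    rw [h5] at h4
    change Real.exp (m * h) * (genIn G Finset.univ s + _ - h * m * genIn G Finset.univ s)
      ≤ genIn G Finset.univ t at h4
    calc _ = _ := by ring
      _ ≤ _ := h4
  have h6 := Real.log_le_log (mul_pos hM (Real.exp_pos _)) key
  rw [Real.log_mul hM.ne' (Real.exp_pos _).ne', Real.log_exp] at h6
  have h7 : density G s = 2 * m / Fintype.card V := by
    rw [density_eq_sum, hm, mul_div_assoc', div_div, mul_comm (genIn G Finset.univ s)]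
  unfold pressure
  rw [h7, matchingGen_eq, matchingGen_eq]
  calc _ = (Real.log (genIn G Finset.univ s) + m * h) / Fintype.card V := by field_simp
    _ ≤ _ := by gcongr

lemma density_mono [Nonempty V] (G : SimpleGraph V) {s t : ℝ} (hs : 0 ≤ s) (hst : s ≤ t) :
    density G s ≤ density G t := by
  rcases hs.eq_or_lt with rfl | hs
  · rw [density_zero]; exact density_nonneg G hst
  rcases hst.eq_or_lt with rfl | hst
  · exact le_rfl
  have ht := hs.trans hst
  have h1 := pressure_ge_tangent G hs ht
  have h2 := pressure_ge_tangent G ht hs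
  have h3 := Real.log_lt_log hs hst
  by_contra! hlt
  nlinarith

lemma exists_card_eq_matchingNumber (G : SimpleGraph V) :
    ∃ M ∈ matchingsIn G Finset.univ, M.card = matchingNumber G := by
  have h : matchingNumber G ∈ {k | (matchings G k).Nonempty} := by
    refine Nat.sSup_mem ⟨0, ∅, by simp [matchings]⟩ ⟨Fintype.card V, ?_⟩
    rintro k ⟨M, hM⟩
    rw [matchings_eq] at hM
    simp only [Finset.coe_filter, Set.mem_ofPred_eq, mem_matchingsIn] at hM
    have := hM.1.1.two_mul_card_le
    omega
  obtain ⟨M, hM⟩ := h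
  rw [matchings_eq] at hM
  exact ⟨M, by simpa using hM⟩

lemma card_le_matchingNumber (G : SimpleGraph V) {M : Finset (Sym2 V)} (hM : IsEdgeMatching G M) :
    M.card ≤ matchingNumber G := by
  refine le_csSup ⟨Fintype.card V, ?_⟩ ⟨M, ?_⟩
  · rintro k ⟨M, hM⟩
    rw [matchings_eq] at hM
    simp only [Finset.coe_filter, Set.mem_ofPred_eq, mem_matchingsIn] at hM
    have := hM.1.1.two_mul_card_le
    omega
  · simp [matchings_eq, mem_matchingsIn, hM]

lemma density_pos [Nonempty V] (G : SimpleGraph V) (hG : 0 < pStar G) {t : ℝ} (ht : 0 < t) :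
    0 < density G t := by
  have hV : (0 : ℝ) < Fintype.card V := by exact_mod_cast Fintype.card_pos
  have hM := genIn_pos (G := G) Finset.univ ht.le
  obtain ⟨M, hM, hc⟩ := exists_card_eq_matchingNumber G
  have hν : 0 < (matchingNumber G : ℝ) := by
    unfold pStar at hG
    by_contra! h
    have : 2 * (matchingNumber G : ℝ) / Fintype.card V ≤ 0 :=
      div_nonpos_of_nonpos_of_nonneg (by linarith) hV.le
    linarith
  rw [density_eq_sum]
  have : 0 < ∑ M ∈ matchingsIn G Finset.univ, (M.card : ℝ) * t ^ M.card :=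
    Finset.sum_pos' (fun M _ => by positivity) ⟨M, hM, by rw [hc]; positivity⟩
  positivity

/-- Every value below `p*(G)` is reached by the density, since the largest matchings dominate for
large activity. -/
lemma exists_density_eq [Nonempty V] (G : SimpleGraph V) {p : ℝ} (hp : 0 ≤ p) (hp' : p < pStar G) :
    ∃ t, 0 ≤ t ∧ density G t = p := by
  have hV : (0 : ℝ) < Fintype.card V := by exact_mod_cast Fintype.card_pos
  set c := p * Fintype.card V / 2 with hc
  have hc0 : 0 ≤ c := by positivity
  have hcν : c < matchingNumber G := by
    rw [pStar, lt_div_iff₀ hV] at hp'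
    rw [hc]; linarith
  obtain ⟨M₀, hM₀, hcard⟩ := exists_card_eq_matchingNumber G
  set ν := matchingNumber G with hν
  obtain ⟨n, hn⟩ : ∃ n, ν = n + 1 := by
    refine Nat.exists_eq_succ_of_ne_zero fun h => ?_
    rw [h] at hcν
    simp at hcν
    linarith
  -- for this activity the term of `M₀` outweighs the negative terms of `∑ (|M| - c) t ^ |M|`
  set N : ℝ := ((matchingsIn G Finset.univ).card : ℝ) with hN
  set t : ℝ := max 1 (c * N / (ν - c)) with ht
  have ht1 : 1 ≤ t := le_max_left _ _
  have ht2 : c * N ≤ (ν - c) * t := by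
    have : c * N / (ν - c) ≤ t := le_max_right _ _
    rw [div_le_iff₀ (by linarith)] at this
    linarith
  have hM := genIn_pos (G := G) Finset.univ (zero_le_one.trans ht1)
  have hlarge : p ≤ density G t := by
    have h1 : 0 ≤ ∑ M ∈ matchingsIn G Finset.univ, ((M.card : ℝ) - c) * t ^ M.card := by
      have h2 : ∀ M ∈ matchingsIn G Finset.univ, (if M = M₀ then (ν - c) * t ^ ν else 0)
          - c * t ^ n ≤ ((M.card : ℝ) - c) * t ^ M.card := by
        intro M hM
        have hle := card_le_matchingNumber G (mem_matchingsIn.1 hM).1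
        rw [← hν] at hle
        have htn : (0 : ℝ) ≤ c * t ^ n := by positivity
        split_ifs with h
        · rw [h, hcard]; linarith
        · rcases hle.eq_or_lt with h3 | h3
          · rw [h3]
            have : 0 ≤ (ν - c) * t ^ ν := mul_nonneg (by linarith) (by positivity)
            linarith
          · have h4 : t ^ M.card ≤ t ^ n := pow_le_pow_right₀ ht1 (by omega)
            have h5 : 0 ≤ (M.card : ℝ) * t ^ M.card := by positivity
            nlinarith
      have h6 := Finset.sum_le_sum h2
      rw [Finset.sum_sub_distrib, Finset.sum_ite_eq' _ _ _, if_pos hM₀, Finset.sum_const,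
        nsmul_eq_mul, ← hN] at h6
      refine le_trans ?_ h6
      have : (ν - c) * t ^ ν - N * (c * t ^ n) = t ^ n * ((ν - c) * t - c * N) := by
        rw [hn, pow_succ]; push_cast; ring
      rw [this]
      exact mul_nonneg (by positivity) (by linarith)
    rw [density_eq_sum, le_div_iff₀ (by positivity)]
    simp_rw [sub_mul] at h1
    rw [Finset.sum_sub_distrib, ← Finset.mul_sum] at h1
    change 0 ≤ _ - c * genIn G Finset.univ t at h1
    have : p * (Fintype.card V * genIn G Finset.univ t) = 2 * (c * genIn G Finset.univ t) := by
      rw [hc]; ring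
    linarith
  have hivt := intermediate_value_Icc (zero_le_one.trans ht1)
    ((continuousOn_density G).mono Set.Icc_subset_Ici_self)
  obtain ⟨s, hs, hs'⟩ := hivt ⟨by rw [density_zero]; exact hp, hlarge⟩
  exact ⟨s, hs.1, hs'⟩

lemma activity_spec [Nonempty V] (G : SimpleGraph V) {p : ℝ} (hp : 0 ≤ p) (hp' : p < pStar G) :
    0 ≤ activity G p ∧ density G (activity G p) = p := by
  have h : ∃ t ∈ Set.Ici (0 : ℝ), density G t = p := exists_density_eq G hp hp'
  exact ⟨Function.invFunOn_mem h, Function.invFunOn_eq h⟩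

lemma activity_pos [Nonempty V] (G : SimpleGraph V) {p : ℝ} (hp : 0 < p) (hp' : p < pStar G) :
    0 < activity G p := by
  obtain ⟨h1, h2⟩ := activity_spec G hp.le hp'
  refine h1.lt_of_ne fun h => ?_
  rw [← h, density_zero] at h2
  exact hp.ne h2

lemma freeEntropy_activity [Nonempty V] (G : SimpleGraph V) {p : ℝ} (hp : 0 ≤ p)
    (hp' : p < pStar G) : freeEntropy G (activity G p)
      = pressure G (activity G p) - 1 / 2 * p * Real.log (activity G p) := by
  rw [freeEntropy_eq, (activity_spec G hp hp').2]

lemma entropy_of_lt (G : SimpleGraph V) {p : ℝ} (hp' : p < pStar G) :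
    entropy G p = freeEntropy G (activity G p) := by
  rw [entropy, if_pos hp']

lemma entropy_zero [Nonempty V] (G : SimpleGraph V) (hG : 0 < pStar G) : entropy G 0 = 0 := by
  have h : activity G 0 = 0 := by
    obtain ⟨h1, h2⟩ := activity_spec G le_rfl hG
    by_contra hne
    exact (density_pos G hG (h1.lt_of_ne' hne)).ne' h2
  rw [entropy_of_lt G hG, freeEntropy_eq, h, pressure_zero]
  simp

/-- Below `p*(G)` the entropy is at most every value `ln M(G,t) / v(G) - (p / 2) ln t` (with
equality at `t = t(G,p)`). -/
lemma freeEntropy_activity_le [Nonempty V] (G : SimpleGraph V) {p : ℝ} (hp : 0 < p)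
    (hp' : p < pStar G) {t : ℝ} (ht : 0 < t) :
    freeEntropy G (activity G p) ≤ pressure G t - 1 / 2 * p * Real.log t := by
  rw [freeEntropy_activity G hp.le hp']
  have := pressure_ge_tangent G (activity_pos G hp hp') ht
  rw [(activity_spec G hp.le hp').2] at this
  linarith

lemma pressure_hasDerivAt (G : SimpleGraph V) {t : ℝ} (ht : 0 ≤ t) :
    HasDerivAt (pressure G) (deriv (matchingGen G) t / matchingGen G t / Fintype.card V) t :=
  (((hasDerivAt_matchingGen G t).differentiableAt.hasDerivAt).log
    (matchingGen_pos G ht).ne').div_const _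

lemma pressure_deriv_eq (G : SimpleGraph V) {t : ℝ} (ht : 0 < t) :
    deriv (matchingGen G) t / matchingGen G t / Fintype.card V = density G t / (2 * t) := by
  have := (matchingGen_pos G ht.le).ne'
  unfold density
  rw [div_div, div_div, mul_comm (matchingGen G t)]
  rw [show 2 * t * deriv (matchingGen G) t = deriv (matchingGen G) t * (2 * t) by ring,
    mul_div_mul_right _ _ (by positivity)]

end Entropy

/-! ### Decay of correlations on tree-like neighbourhoods -/

section LocalTree

variable {V : Type u}

/-- `φ` identifies the words of length at most `r` of the `(a,b)`-biregular tree with vertices of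
`G`, such that around words of length less than `r` all edges of `G` are tree edges. -/
structure IsLocalTree (G : SimpleGraph V) (a b r : ℕ) (φ : List ℕ → V) : Prop where
  inj : ∀ l l', IsTreeWord a b l → l.length ≤ r → IsTreeWord a b l' → l'.length ≤ r →
    φ l = φ l' → l = l'
  adj_iff : ∀ l, IsTreeWord a b l → l.length < r → ∀ u, G.Adj (φ l) u ↔
    (∃ c < numChildren a b l.length, u = φ (c :: l)) ∨ ∃ c l', l = c :: l' ∧ u = φ l'

lemma IsTreeWord.of_suffix {a b : ℕ} {l w : List ℕ} (hw : IsTreeWord a b w) (h : l <:+ w) :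
    IsTreeWord a b l := by
  induction w with
  | nil => rw [List.suffix_nil.1 h]; trivial
  | cons c w ih =>
    rcases List.suffix_cons_iff.1 h with rfl | h
    · exact hw
    · exact ih hw.2 h

variable [Fintype V]

/-- `S` contains the part of the local tree below `l` and not the parent of `l`. -/
def IsBelow (a b r : ℕ) (φ : List ℕ → V) (S : Finset V) (l : List ℕ) : Prop :=
  (∀ w, IsTreeWord a b w → w.length ≤ r → l <:+ w → φ w ∈ S) ∧
    ∀ c l', l = c :: l' → φ l' ∉ S

variable {G : SimpleGraph V} {a b r : ℕ} {φ : List ℕ → V}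

omit [Fintype V] in
lemma IsBelow.child (hφ : IsLocalTree G a b r φ) {S : Finset V} {l : List ℕ}
    (hS : IsBelow a b r φ S l) (hl : IsTreeWord a b l) (hr : l.length < r) (c : ℕ) :
    IsBelow a b r φ (S.erase (φ l)) (c :: l) := by
  constructor
  · intro w hw hwr hlw
    have hl' : l <:+ w := (List.suffix_cons c l).trans hlw
    refine Finset.mem_erase.2 ⟨fun h => ?_, hS.1 w hw hwr hl'⟩
    have := hφ.inj w l hw hwr hl hr.le h
    rw [this] at hlw
    have := hlw.length_le
    simp at this
  · intro c' l' h
    rw [← (List.cons.inj h).2]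
    exact Finset.notMem_erase _ _

omit [Fintype V] in
/-- The neighbours in `S` of a vertex of the local tree are its children. -/
lemma sum_adj_eq_sum_children (hφ : IsLocalTree G a b r φ) {S : Finset V} {l : List ℕ}
    (hS : IsBelow a b r φ S l) (hl : IsTreeWord a b l) (hr : l.length < r) (f : V → ℝ) :
    ∑ u ∈ S.filter (G.Adj (φ l)), f u
      = ∑ c ∈ Finset.range (numChildren a b l.length), f (φ (c :: l)) := by
  symm
  refine Finset.sum_bij (fun c _ => φ (c :: l)) ?_ ?_ ?_ ?_
  · intro c hc
    rw [Finset.mem_range] at hc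
    rw [Finset.mem_filter]
    exact ⟨hS.1 _ ⟨hc, hl⟩ hr (List.suffix_cons _ _), (hφ.adj_iff l hl hr _).2 (.inl ⟨c, hc, rfl⟩)⟩
  · intro c hc c' hc' h
    rw [Finset.mem_range] at hc hc'
    exact (List.cons.inj (hφ.inj _ _ ⟨hc, hl⟩ hr ⟨hc', hl⟩ hr h)).1
  · intro u hu
    rw [Finset.mem_filter] at hu
    rcases (hφ.adj_iff l hl hr u).1 hu.2 with ⟨c, hc, rfl⟩ | ⟨c, l', h, rfl⟩
    · exact ⟨c, Finset.mem_range.2 hc, rfl⟩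
    · exact absurd hu.1 (hS.2 c l' h)
  · intros; rfl

/-- One step of the recursion `x = 1 / (1 + Σ)` contracts multiplicative errors: if `y` approximates
`s` up to a factor `R`, then `1 / (1 + y)` approximates `1 / (1 + s)` up to a factor
`1 + (R - 1) K / (1 + K)`, where `s ≤ K`. -/
lemma ratio_contraction {s y R K : ℝ} (hs : 0 ≤ s) (hsK : s ≤ K) (hR : 1 ≤ R)
    (h1 : s / R ≤ y) (h2 : y ≤ s * R) :
    1 / (1 + s) / (1 + (R - 1) * (K / (1 + K))) ≤ 1 / (1 + y) ∧
      1 / (1 + y) ≤ 1 / (1 + s) * (1 + (R - 1) * (K / (1 + K))) := by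
  have hK : 0 ≤ K := hs.trans hsK
  have hR0 : 0 < R := by linarith
  have hy : 0 ≤ y := le_trans (by positivity) h1
  set R' := 1 + (R - 1) * (K / (1 + K)) with hR'
  have hR1 : 1 ≤ R' := by
    have : 0 ≤ (R - 1) * (K / (1 + K)) := mul_nonneg (by linarith) (by positivity)
    linarith
  have hsk : s / (1 + s) ≤ K / (1 + K) := by
    rw [div_le_div_iff₀ (by linarith) (by linarith)]; nlinarith
  have hmain : 1 + s * R ≤ (1 + s) * R' := by
    have h3 : (R - 1) * (s / (1 + s)) ≤ (R - 1) * (K / (1 + K)) :=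
      mul_le_mul_of_nonneg_left hsk (by linarith)
    have h4 : (1 + s) * (1 + (R - 1) * (s / (1 + s))) = 1 + s * R := by field_simp; ring
    rw [← h4]
    exact mul_le_mul_of_nonneg_left (by linarith) (by linarith)
  constructor
  · rw [div_div, div_le_div_iff₀ (by positivity) (by linarith)]
    linarith
  · rw [div_mul_eq_mul_div, one_mul, div_le_div_iff₀ (by linarith) (by linarith)]
    -- after multiplication by `R` this is `R (1 + s) ≤ R' (R + s)`
    have h5 : s ≤ y * R := by rwa [div_le_iff₀ hR0] at h1
    have h6 : R * (1 + s) ≤ R' * (R + s) := by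
      nlinarith [mul_nonneg (sub_nonneg.2 hR1) (sub_nonneg.2 hR)]
    have h7 : R' * (R + s) ≤ R' * (R * (1 + y)) :=
      mul_le_mul_of_nonneg_left (by linarith) (by linarith)
    have h8 : R * (1 * (1 + s)) ≤ R * (R' * (1 + y)) := by
      calc R * (1 * (1 + s)) = R * (1 + s) := by ring
        _ ≤ _ := h6
        _ ≤ _ := h7
        _ = _ := by ring
    exact le_of_mul_le_mul_left h8 hR0

/-- On a local tree the probability that a vertex is uncovered agrees with the solution `X` of the
tree recursion, up to an error decaying exponentially with the distance to the boundary. -/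
lemma uncov_bounds (hφ : IsLocalTree G a b r φ) {t K : ℝ} (ht : 0 ≤ t) {X : ℕ → ℝ}
    (hX0 : ∀ n, 0 < X n) (hX1 : ∀ n, X n ≤ 1)
    (hX : ∀ n, X n = 1 / (1 + t * numChildren a b n * X (n + 1)))
    (hK : ∀ n, t * numChildren a b n ≤ K) (d : ℕ) :
    ∀ l S, IsTreeWord a b l → l.length + d + 1 ≤ r → IsBelow a b r φ S l →
      X l.length / (1 + K * (K / (1 + K)) ^ d) ≤ uncov G S (φ l) t ∧
        uncov G S (φ l) t ≤ X l.length * (1 + K * (K / (1 + K)) ^ d) := by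
  have hK0 : 0 ≤ K := le_trans (by positivity) (hK 0)
  induction d with
  | zero =>
    intro l S hl hr hS
    have hmem : φ l ∈ S := hS.1 l hl (by omega) (List.suffix_refl l)
    set n := l.length with hn
    have h1 := uncov_le_one (G := G) hmem ht
    have h0 := uncov_pos (G := G) S (φ l) ht
    have hx : 1 / (1 + K) ≤ X n := by
      rw [hX n]
      have h3 : t * numChildren a b n * X (n + 1) ≤ K := by
        have : 0 ≤ t * numChildren a b n := by positivity
        nlinarith [hK n, hX1 (n + 1), hX0 (n + 1)]
      have h4 : 0 ≤ t * numChildren a b n * X (n + 1) :=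
        mul_nonneg (by positivity) (hX0 _).le
      exact one_div_le_one_div_of_le (by linarith) (by linarith)
    have hu : 1 / (1 + K) ≤ uncov G S (φ l) t := by
      rw [uncov_eq hmem ht, sum_adj_eq_sum_children hφ hS hl (by omega)]
      have h3 : ∑ c ∈ Finset.range (numChildren a b n), uncov G (S.erase (φ l)) (φ (c :: l)) t
          ≤ numChildren a b n := by
        calc _ ≤ ∑ c ∈ Finset.range (numChildren a b n), (1 : ℝ) := by
              refine Finset.sum_le_sum fun c hc => uncov_le_one ?_ ht
              rw [Finset.mem_range] at hc
              exact (hS.child hφ hl (by omega) c).1 _ ⟨hc, hl⟩ (by simp; omega)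
                (List.suffix_refl _)
          _ = _ := by simp
      have h4 : 0 ≤ ∑ c ∈ Finset.range (numChildren a b n),
          uncov G (S.erase (φ l)) (φ (c :: l)) t :=
        Finset.sum_nonneg fun c _ => (uncov_pos _ _ ht).le
      have h5 := mul_le_mul_of_nonneg_left h3 ht
      have h6 := hK n
      refine one_div_le_one_div_of_le ?_ ?_
      · nlinarith
      · linarith
    rw [div_le_iff₀ (by linarith)] at hx hu
    simp only [pow_zero, mul_one]
    constructor
    · rw [div_le_iff₀ (by linarith)]
      linarith [hX1 n]
    · linarith
  | succ d ih =>
    intro l S hl hr hS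
    have hmem : φ l ∈ S := hS.1 l hl (by omega) (List.suffix_refl l)
    set n := l.length with hn
    set R := 1 + K * (K / (1 + K)) ^ d with hR
    have hR1 : 1 ≤ R := by
      have : 0 ≤ K * (K / (1 + K)) ^ d := by positivity
      linarith
    have hR' : 1 + K * (K / (1 + K)) ^ (d + 1) = 1 + (R - 1) * (K / (1 + K)) := by
      rw [hR, pow_succ]; ring
    have hchild : ∀ c ∈ Finset.range (numChildren a b n),
        X (n + 1) / R ≤ uncov G (S.erase (φ l)) (φ (c :: l)) t ∧
          uncov G (S.erase (φ l)) (φ (c :: l)) t ≤ X (n + 1) * R := by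
      intro c hc
      rw [Finset.mem_range] at hc
      exact ih (c :: l) (S.erase (φ l)) ⟨hc, hl⟩ (by simp; omega)
        (hS.child hφ hl (by omega) c)
    rw [uncov_eq hmem ht, sum_adj_eq_sum_children hφ hS hl (by omega), hX n, hR']
    have hkt : 0 ≤ t * numChildren a b n := by positivity
    refine ratio_contraction (mul_nonneg hkt (hX0 _).le) ?_ hR1 ?_ ?_
    · nlinarith [hK n, hX1 (n + 1), hX0 (n + 1)]
    · calc t * numChildren a b n * X (n + 1) / R
          = t * ∑ c ∈ Finset.range (numChildren a b n), X (n + 1) / R := by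
            simp; ring
        _ ≤ _ := by
            gcongr with c hc
            exact (hchild c hc).1
    · calc _ ≤ t * ∑ c ∈ Finset.range (numChildren a b n), X (n + 1) * R := by
            gcongr with c hc
            exact (hchild c hc).2
        _ = _ := by simp; ring

end LocalTree

/-! ### Balls isomorphic to balls of the biregular tree -/

lemma edist_le_succ_iff {V : Type u} {G : SimpleGraph V} {u w : V} {n : ℕ} :
    G.edist u w ≤ (n + 1 : ℕ) ↔
      G.edist u w ≤ n ∨ ∃ w', G.edist u w' ≤ n ∧ G.Adj w' w := by
  constructor
  · intro h
    obtain ⟨p, hp⟩ := SimpleGraph.exists_walk_of_edist_ne_top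
      (ne_top_of_le_ne_top (ENat.natCast_ne_top _) h)
    rw [← hp] at h ⊢
    rcases Nat.lt_or_ge n p.length with hlt | hge
    · right
      have hnil : ¬ p.Nil := by
        rw [← SimpleGraph.Walk.length_eq_zero_iff]; omega
      refine ⟨p.penultimate, ?_, p.adj_penultimate hnil⟩
      refine (SimpleGraph.edist_le p.dropLast).trans ?_
      have h' : p.length ≤ n + 1 := by exact_mod_cast h
      have : p.dropLast.length ≤ n := by
        have := SimpleGraph.Walk.length_dropLast_add_one hnil
        omega
      exact_mod_cast this
    · left; exact_mod_cast hge
  · rintro (h | ⟨w', h, hadj⟩)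
    · exact h.trans (by exact_mod_cast Nat.le_succ n)
    · calc G.edist u w ≤ G.edist u w' + G.edist w' w := SimpleGraph.edist_triangle
        _ ≤ n + 1 := add_le_add h (SimpleGraph.edist_eq_one_iff_adj.2 hadj).le
        _ = _ := by push_cast; rfl

lemma edist_le_zero_iff {V : Type u} {G : SimpleGraph V} {u w : V} :
    G.edist u w ≤ (0 : ℕ) ↔ u = w := by simp

lemma biregularTreeGraph_adj {a b : ℕ} {u v : {l : List ℕ // IsTreeWord a b l}} :
    (biregularTreeGraph a b).Adj u v ↔ (∃ c, v.val = c :: u.val) ∨ ∃ c, u.val = c :: v.val := by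
  rw [biregularTreeGraph, SimpleGraph.fromRel_adj, and_iff_right_iff_imp]
  rintro (⟨c, h⟩ | ⟨c, h⟩) rfl <;> simp at h

/-- The distance of a word from the root is its length. -/
lemma edist_tree_le_iff {a b r : ℕ} (l : {l : List ℕ // IsTreeWord a b l}) :
    (biregularTreeGraph a b).edist ⟨[], trivial⟩ l ≤ r ↔ l.val.length ≤ r := by
  induction r generalizing l with
  | zero =>
    rw [edist_le_zero_iff, Nat.le_zero, List.length_eq_zero_iff, Subtype.ext_iff]
    exact eq_comm
  | succ r ih =>
    rw [edist_le_succ_iff, ih]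
    constructor
    · rintro (h | ⟨w, hw, hadj⟩)
      · omega
      · rw [ih] at hw
        rcases biregularTreeGraph_adj.1 hadj with ⟨c, h⟩ | ⟨c, h⟩
        · rw [h, List.length_cons]; omega
        · rw [h, List.length_cons] at hw; omega
    · intro h
      rcases Nat.lt_or_ge r l.val.length with hlt | hge
      · right
        obtain ⟨_ | ⟨c, l⟩, hl⟩ := l
        · simp at hlt
        · refine ⟨⟨l, hl.2⟩, ?_, biregularTreeGraph_adj.2 (.inl ⟨c, rfl⟩)⟩
          rw [ih]
          simpa using h
      · exact .inl hge

/-- A ball isomorphic to a ball of the biregular tree is a local tree. -/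
lemma exists_isLocalTree {V : Type} {G : SimpleGraph V} {v : V} {a b r : ℕ}
    (h : ((RootedGraph.mk V G v).ball r).IsIso ((rootedBiregularTree a b).ball r)) :
    ∃ φ, φ [] = v ∧ IsLocalTree G a b r φ := by
  obtain ⟨e, he⟩ := h
  have hT : ∀ l : {l : List ℕ // IsTreeWord a b l}, l.val.length ≤ r →
      (rootedBiregularTree a b).graph.edist (rootedBiregularTree a b).root l ≤ r :=
    fun l hl => (edist_tree_le_iff l).2 hl
  let ψ : ∀ l, IsTreeWord a b l → l.length ≤ r → ((rootedBiregularTree a b).ball r).V :=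
    fun l hl hr => ⟨⟨l, hl⟩, hT _ hr⟩
  let φ : List ℕ → V := fun l =>
    if h : IsTreeWord a b l ∧ l.length ≤ r then (e.symm (ψ l h.1 h.2)).1 else v
  have hφ : ∀ l hl hr, φ l = (e.symm (ψ l hl hr)).1 := fun l hl hr => by
    simp only [φ, dif_pos (And.intro hl hr)]
  have hroot : φ [] = v := by
    rw [hφ [] trivial (Nat.zero_le _)]
    have h1 : ψ [] trivial (Nat.zero_le _) = ((rootedBiregularTree a b).ball r).root := rfl
    rw [h1, ← he, RelIso.symm_apply_apply]
    rfl
  have hadj : ∀ x y : ((rootedBiregularTree a b).ball r).V,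
      G.Adj (e.symm x).1 (e.symm y).1 ↔ (biregularTreeGraph a b).Adj x.1 y.1 := by
    intro x y
    exact e.symm.map_adj_iff
  have hdist : ∀ l, IsTreeWord a b l → l.length ≤ r → G.edist v (φ l) ≤ l.length := by
    intro l
    induction l with
    | nil => intro _ _; rw [hroot]; simp
    | cons c l ih =>
      intro hl hr
      have hr' : l.length ≤ r := by simp at hr; omega
      rw [List.length_cons, edist_le_succ_iff]
      refine .inr ⟨φ l, ih hl.2 hr', ?_⟩
      rw [hφ l hl.2 hr', hφ _ hl hr, hadj]
      exact biregularTreeGraph_adj.2 (.inl ⟨c, rfl⟩)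
  refine ⟨φ, hroot, ?_, ?_⟩
  · intro l l' hl hr hl' hr' h
    rw [hφ l hl hr, hφ l' hl' hr'] at h
    have := e.symm.injective (Subtype.ext h)
    exact congrArg (fun x => x.1.1) this
  · intro l hl hr u
    constructor
    · intro hu
      have hball : G.edist v u ≤ r := by
        have : G.edist v u ≤ (l.length + 1 : ℕ) :=
          edist_le_succ_iff.2 (.inr ⟨_, hdist l hl hr.le, hu⟩)
        exact this.trans (by exact_mod_cast hr)
      obtain ⟨x, hx⟩ := e.symm.surjective ⟨u, hball⟩
      have hxu : u = (e.symm x).1 := by rw [hx]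
      obtain ⟨⟨w, hw⟩, hwr⟩ := x
      have hwr' : w.length ≤ r := (edist_tree_le_iff _).1 hwr
      have hxφ : u = φ w := by rw [hφ w hw hwr', hxu]
      rw [hφ l hl hr.le, hxu] at hu
      replace hu := (hadj _ _).1 hu
      rcases biregularTreeGraph_adj.1 hu with ⟨c, h⟩ | ⟨c, h⟩
      · left
        change w = c :: l at h
        subst h
        exact ⟨c, hw.1, hxφ⟩
      · right
        exact ⟨c, w, h, hxφ⟩
    · rintro (⟨c, hc, rfl⟩ | ⟨c, l', rfl, rfl⟩)
      · rw [hφ l hl hr.le, hφ (c :: l) ⟨hc, hl⟩ hr, hadj]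
        exact biregularTreeGraph_adj.2 (.inl ⟨c, rfl⟩)
      · have hr' : l'.length ≤ r := by simp at hr; omega
        rw [hφ l' hl.2 hr', hφ (c :: l') hl hr.le, hadj]
        exact biregularTreeGraph_adj.2 (.inr ⟨c, rfl⟩)

/-! ### Convergence of the densities -/

lemma RootedGraph.IsIso.refl (R : RootedGraph) : R.IsIso R := ⟨RelIso.refl _, rfl⟩

lemma RootedGraph.IsIso.symm {R S : RootedGraph} : R.IsIso S → S.IsIso R := fun ⟨e, he⟩ =>
  ⟨e.symm, by rw [← he, RelIso.symm_apply_apply]⟩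

lemma RootedGraph.IsIso.trans {R S T : RootedGraph} : R.IsIso S → S.IsIso T → R.IsIso T :=
  fun ⟨e, he⟩ ⟨f, hf⟩ => ⟨e.trans f, by rw [RelIso.trans_apply, he, hf]⟩

lemma numChildren_le (a b n : ℕ) : numChildren a b n ≤ a + b := by
  unfold numChildren
  split_ifs <;> omega

lemma finite_treeWords (a b r : ℕ) : {l : List ℕ | IsTreeWord a b l ∧ l.length ≤ r}.Finite := by
  induction r with
  | zero =>
    refine (Set.finite_singleton []).subset ?_
    rintro l ⟨_, h⟩
    exact List.length_eq_zero_iff.1 (Nat.le_zero.1 h)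
  | succ r ih =>
    refine ((Set.finite_singleton []).union
      ((Set.finite_Iio (a + b)).image2 List.cons ih)).subset ?_
    rintro (_ | ⟨c, l⟩) ⟨h, hr⟩
    · simp
    · right
      exact ⟨c, h.1.trans_le (numChildren_le _ _ _), l, ⟨h.2, by simpa using hr⟩, rfl⟩

lemma finite_treeBall (a b r : ℕ) : Finite ((rootedBiregularTree a b).ball r).V := by
  have := (finite_treeWords a b r).to_subtype
  refine Finite.of_injective
    (β := {l : List ℕ | IsTreeWord a b l ∧ l.length ≤ r})
    (fun x => ⟨x.1.1, x.1.2, (edist_tree_le_iff x.1).1 x.2⟩) ?_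
  intro x y h
  exact Subtype.ext (Subtype.ext (congrArg (fun z => z.1) h))

lemma IsLocalTree.ncard_neighborSet_root {V : Type u} {G : SimpleGraph V} {a b r : ℕ}
    {φ : List ℕ → V} (h : IsLocalTree G a b r φ) (hr : 0 < r) :
    (G.neighborSet (φ [])).ncard = a := by
  have h1 : G.neighborSet (φ []) = (fun c => φ [c]) '' (Finset.range a : Set ℕ) := by
    ext u
    rw [SimpleGraph.mem_neighborSet, h.adj_iff [] trivial hr]
    simp [numChildren, eq_comm]
  have h2 : ∀ c, c < a → IsTreeWord a b [c] := fun c hc =>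
    ⟨by simpa [numChildren] using hc, trivial⟩
  have h3 : Set.InjOn (fun c => φ [c]) (Finset.range a : Set ℕ) := by
    intro c hc c' hc' heq
    have := h.inj [c] [c'] (h2 c (by simpa using hc)) hr (h2 c' (by simpa using hc')) hr heq
    simpa using this
  rw [h1, h3.ncard_image, Set.ncard_coe_finset, Finset.card_range]

/-- The two types of balls of the biregular tree are different when `a ≠ b`. -/
lemma eq_of_treeBall_isIso {a b r : ℕ} (hr : 0 < r)
    (h : ((rootedBiregularTree b a).ball r).IsIso ((rootedBiregularTree a b).ball r)) :
    b = a := by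
  obtain ⟨φ, hφ, h1⟩ := exists_isLocalTree h
  obtain ⟨ψ, hψ, h2⟩ := exists_isLocalTree
    (RootedGraph.IsIso.refl ((rootedBiregularTree b a).ball r))
  have h3 := h1.ncard_neighborSet_root hr
  rw [hφ, ← hψ] at h3
  exact (h2.ncard_neighborSet_root hr).symm.trans h3

lemma biregularTree_ballProb (a b : ℕ) (ha : 0 < a) (α : RootedGraph) (r : ℕ) :
    (biregularTree a b).ballProb α r
      = (if ((rootedBiregularTree b a).ball r).IsIso α then (a : ℝ) / (a + b) else 0)
        + if ((rootedBiregularTree a b).ball r).IsIso α then (b : ℝ) / (a + b) else 0 := by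
  have hab : (a : ℝ) + b ≠ 0 := by positivity
  have h1 : 1 - (a : ℝ) / (a + b) = b / (a + b) := by field_simp; ring
  unfold RandomRootedGraph.ballProb biregularTree
  rw [ProbabilityTheory.bernoulliMeasure_real_apply _ (MeasurableSet.of_discrete)]
  by_cases hA : ((rootedBiregularTree b a).ball r).IsIso α <;>
    by_cases hB : ((rootedBiregularTree a b).ball r).IsIso α <;> simp [hA, hB, h1]
  field_simp

/-- The activity at which an edge of the `(a,b)`-biregular tree is in a random matching with
probability `e`. -/
def treeActivity (a b e : ℝ) : ℝ := e * (1 - e) / ((1 - a * e) * (1 - b * e))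

lemma treeActivity_comm (a b e : ℝ) : treeActivity b a e = treeActivity a b e := by
  unfold treeActivity; rw [mul_comm (1 - b * e)]

section Fixed

/-- The probability that a vertex of depth `n` of the `(a,b)`-biregular tree is uncovered by the
random matching of the subtree below it, when edges have probability `e`. -/
def treeUncov (a b e : ℝ) (n : ℕ) : ℝ :=
  if n = 0 then 1 - a * e else if Even n then (1 - a * e) / (1 - e) else (1 - b * e) / (1 - e)

variable {a b : ℕ} {e : ℝ}

lemma treeUncov_pos (ha : 0 < a) (h1 : a * e < 1) (h2 : b * e < 1) (n : ℕ) :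
    0 < treeUncov a b e n := by
  have : (1 : ℝ) ≤ a := by exact_mod_cast ha
  have h3 : e < 1 := by nlinarith
  unfold treeUncov
  split_ifs
  · linarith
  · exact div_pos (by linarith) (by linarith)
  · exact div_pos (by linarith) (by linarith)

lemma treeUncov_le_one (ha : 0 < a) (hb : 0 < b) (he : 0 ≤ e) (h1 : a * e < 1) (n : ℕ) :
    treeUncov a b e n ≤ 1 := by
  have h4 : (1 : ℝ) ≤ a := by exact_mod_cast ha
  have h5 : (1 : ℝ) ≤ b := by exact_mod_cast hb
  have h3 : e < 1 := by nlinarith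
  unfold treeUncov
  split_ifs
  · nlinarith
  · rw [div_le_one (by linarith)]; nlinarith
  · rw [div_le_one (by linarith)]; nlinarith

lemma treeActivity_nonneg (ha : 0 < a) (he : 0 ≤ e) (h1 : a * e < 1) (h2 : b * e < 1) :
    0 ≤ treeActivity a b e := by
  have : (1 : ℝ) ≤ a := by exact_mod_cast ha
  have h3 : e < 1 := by nlinarith
  exact div_nonneg (mul_nonneg he (by linarith)) (mul_nonneg (by linarith) (by linarith))

lemma one_add_div_mul {A B C k : ℝ} (e : ℝ) (hA : A ≠ 0) (hB : B ≠ 0) (hC : C ≠ 0) :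
    1 + e * C / (A * B) * k * (B / C) = (A + k * e) / A := by
  field_simp

lemma treeUncov_rec (ha : 0 < a) (hb : 0 < b) (h1 : a * e < 1) (h2 : b * e < 1)
    (n : ℕ) : treeUncov a b e n
      = 1 / (1 + treeActivity a b e * numChildren a b n * treeUncov a b e (n + 1)) := by
  have h4 : (1 : ℝ) ≤ a := by exact_mod_cast ha
  have h3 : e < 1 := by nlinarith
  have h5 : (1 : ℝ) - a * e ≠ 0 := by linarith
  have h6 : (1 : ℝ) - b * e ≠ 0 := by linarith
  have h7 : 1 - e ≠ 0 := by linarith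
  rcases Nat.eq_zero_or_pos n with rfl | hn
  · have : (1 : ℝ) + treeActivity a b e * a * ((1 - b * e) / (1 - e)) = 1 / (1 - a * e) := by
      rw [treeActivity, one_add_div_mul e h5 h6 h7]; ring
    simp only [treeUncov, numChildren, if_true, zero_add, one_ne_zero, if_false, Nat.not_even_one]
    rw [this, one_div_one_div]
  · by_cases hev : Even n
    · have hodd : ¬ Even (n + 1) := by rw [Nat.even_add_one]; simpa using hev
      simp only [treeUncov, numChildren, hn.ne', hev, hodd, if_true, if_false,
        Nat.add_eq_zero_iff, one_ne_zero, and_false, Nat.cast_sub ha, Nat.cast_one]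
      have : (1 : ℝ) + treeActivity a b e * (a - 1) * ((1 - b * e) / (1 - e))
          = (1 - e) / (1 - a * e) := by
        rw [treeActivity, one_add_div_mul e h5 h6 h7]; ring
      rw [this, one_div_div]
    · have hodd : Even (n + 1) := by rw [Nat.even_add_one]; exact hev
      simp only [treeUncov, numChildren, hn.ne', hev, hodd, if_true, if_false,
        Nat.add_eq_zero_iff, one_ne_zero, and_false, Nat.cast_sub hb, Nat.cast_one]
      have : (1 : ℝ) + treeActivity a b e * (b - 1) * ((1 - a * e) / (1 - e))
          = (1 - e) / (1 - b * e) := by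
        rw [← treeActivity_comm, treeActivity, one_add_div_mul e h6 h5 h7]; ring
      rw [this, one_div_div]

end Fixed

/-- The multiplicative error of the tree recursion at depth `d`, at activity `t`. -/
def treeError (a b : ℕ) (t : ℝ) (d : ℕ) : ℝ :=
  1 + t * (a + b) * (t * (a + b) / (1 + t * (a + b))) ^ d

lemma treeError_tendsto (a b : ℕ) {t : ℝ} (ht : 0 ≤ t) :
    Tendsto (treeError a b t) atTop (𝓝 1) := by
  unfold treeError
  have h0 : 0 ≤ t * (a + b) := by positivity
  have h : Tendsto (fun d : ℕ => (t * (a + b) / (1 + t * (a + b))) ^ d) atTop (𝓝 0) := by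
    refine tendsto_pow_atTop_nhds_zero_of_lt_one (by positivity) ?_
    rw [div_lt_one (by linarith)]; linarith
  simpa using (h.const_mul (t * (a + b))).const_add 1

/-- A vertex with a tree-like neighbourhood is uncovered with nearly the same probability as the
root of the tree. -/
lemma uncov_bounds_of_ball {V : Type} [Fintype V] {G : SimpleGraph V} {v : V} {a b : ℕ} {e : ℝ}
    (ha : 0 < a) (hb : 0 < b) (he : 0 ≤ e) (h1 : a * e < 1) (h2 : b * e < 1) {d : ℕ}
    (h : ((RootedGraph.mk V G v).ball (d + 1)).IsIso ((rootedBiregularTree a b).ball (d + 1))) :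
    (1 - a * e) / treeError a b (treeActivity a b e) d
        ≤ uncov G Finset.univ v (treeActivity a b e) ∧
      uncov G Finset.univ v (treeActivity a b e)
        ≤ (1 - a * e) * treeError a b (treeActivity a b e) d := by
  obtain ⟨φ, rfl, hφ⟩ := exists_isLocalTree h
  have ht := treeActivity_nonneg (b := b) ha he h1 h2
  have := uncov_bounds hφ ht (treeUncov_pos (b := b) ha h1 h2)
    (treeUncov_le_one ha hb he h1) (treeUncov_rec ha hb h1 h2)
    (K := treeActivity a b e * (a + b)) (fun n => by
      gcongr
      exact_mod_cast numChildren_le a b n) d [] Finset.univ trivial (by simp)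
      ⟨fun _ _ _ _ => Finset.mem_univ _, fun c l h => by simp at h⟩
  simpa [treeUncov, treeError] using this

/-- If `x` lies between sequences converging to `L d` and `U d`, for every `d`, and `L`, `U` both
converge to `x₀`, then `x` converges to `x₀`. -/
lemma tendsto_of_bounds {x : ℕ → ℝ} {x₀ : ℝ} {L U : ℕ → ℝ} {l u : ℕ → ℕ → ℝ}
    (hl : ∀ d, Tendsto (l d) atTop (𝓝 (L d))) (hu : ∀ d, Tendsto (u d) atTop (𝓝 (U d)))
    (hL : Tendsto L atTop (𝓝 x₀)) (hU : Tendsto U atTop (𝓝 x₀))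
    (h1 : ∀ d i, l d i ≤ x i) (h2 : ∀ d i, x i ≤ u d i) : Tendsto x atTop (𝓝 x₀) := by
  refine tendsto_order.2 ⟨fun c hc => ?_, fun c hc => ?_⟩
  · obtain ⟨d, hd⟩ := (hL.eventually_const_lt hc).exists
    filter_upwards [(hl d).eventually_const_lt hd] with i hi using hi.trans_le (h1 d i)
  · obtain ⟨d, hd⟩ := (hU.eventually_lt_const hc).exists
    filter_upwards [(hu d).eventually_lt_const hd] with i hi using (h2 d i).trans_lt hi

/-- The average of a function that is squeezed on two disjoint sets `A`, `B` and lies in `[0,1]`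
everywhere. -/
lemma avg_bounds {V : Type u} [Fintype V] [Nonempty V] (A B : Set V) (hAB : Disjoint A B)
    (f : V → ℝ) (h0 : ∀ v, 0 ≤ f v) (h1 : ∀ v, f v ≤ 1) {lA uA lB uB : ℝ}
    (hA : ∀ v ∈ A, lA ≤ f v ∧ f v ≤ uA) (hB : ∀ v ∈ B, lB ≤ f v ∧ f v ≤ uB) :
    (A.ncard : ℝ) / Fintype.card V * lA + (B.ncard : ℝ) / Fintype.card V * lB
        ≤ (∑ v, f v) / Fintype.card V ∧
      (∑ v, f v) / Fintype.card V
        ≤ (A.ncard : ℝ) / Fintype.card V * uA + (B.ncard : ℝ) / Fintype.card V * uB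
          + (1 - (A.ncard : ℝ) / Fintype.card V - (B.ncard : ℝ) / Fintype.card V) := by
  have hV : (0 : ℝ) < Fintype.card V := by exact_mod_cast Fintype.card_pos
  have hsum : ∀ (S : Set V) (c : ℝ), ∑ v, (if v ∈ S then c else 0) = S.ncard * c := by
    intro S c
    rw [← Finset.sum_filter, Finset.sum_const, nsmul_eq_mul, ← Set.ncard_coe_finset]
    congr 3; ext v; simp
  have hd : ∀ v, v ∈ A → v ∉ B := fun v hv hv' => Set.disjoint_left.1 hAB hv hv'
  constructor
  · have : ∑ v, ((if v ∈ A then lA else 0) + if v ∈ B then lB else 0) ≤ ∑ v, f v := by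
      refine Finset.sum_le_sum fun v _ => ?_
      by_cases hvA : v ∈ A
      · simp only [hvA, hd v hvA, if_true, if_false, add_zero]; exact (hA v hvA).1
      · by_cases hvB : v ∈ B
        · simp only [hvA, hvB, if_true, if_false, zero_add]; exact (hB v hvB).1
        · simp only [hvA, hvB, if_false, zero_add]; exact h0 v
    rw [Finset.sum_add_distrib, hsum, hsum] at this
    calc _ = (A.ncard * lA + B.ncard * lB) / Fintype.card V := by ring
      _ ≤ _ := by gcongr
  · have : ∑ v, f v ≤ ∑ v, (((if v ∈ A then uA - 1 else 0) + if v ∈ B then uB - 1 else 0) + 1) := by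
      refine Finset.sum_le_sum fun v _ => ?_
      by_cases hvA : v ∈ A
      · simp only [hvA, hd v hvA, if_true, if_false, add_zero]; linarith [(hA v hvA).2]
      · by_cases hvB : v ∈ B
        · simp only [hvA, hvB, if_true, if_false, zero_add]; linarith [(hB v hvB).2]
        · simp only [hvA, hvB, if_false, zero_add]; exact h1 v
    rw [Finset.sum_add_distrib, Finset.sum_add_distrib, hsum, hsum] at this
    simp only [Finset.sum_const, Finset.card_univ, nsmul_eq_mul, mul_one] at this
    calc _ ≤ (A.ncard * (uA - 1) + B.ncard * (uB - 1) + Fintype.card V) / Fintype.card V := by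
          gcongr
      _ = _ := by field_simp; ring

/-- The vertices of `G` whose `r`-ball looks like that of the `(a,b)`-biregular tree rooted at a
vertex of degree `a`. -/
def treeLike (G : FiniteGraph) (a b r : ℕ) : Set G.V :=
  {v | ((RootedGraph.mk G.V G.graph v).ball r).IsIso ((rootedBiregularTree a b).ball r)}

/-- Along a Benjamini–Schramm convergent sequence nearly all vertices are tree-like, of the two
types in the right proportion; for `a = b` the two types coincide. -/
lemma exists_treeLike_proportions {a b : ℕ} (ha : 0 < a) (hb : 0 < b) {G : ℕ → FiniteGraph}
    (hG : BSConverges G (biregularTree a b)) (e : ℝ) {r : ℕ} (hr : 0 < r) :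
    ∃ (B : ∀ i, Set (G i).V) (q : ℝ), (∀ i, B i ⊆ treeLike (G i) b a r) ∧
      (∀ i, Disjoint (treeLike (G i) a b r) (B i)) ∧
      Tendsto (fun i => ((treeLike (G i) a b r).ncard : ℝ) / Fintype.card (G i).V) atTop (𝓝 q) ∧
      Tendsto (fun i => ((B i).ncard : ℝ) / Fintype.card (G i).V) atTop (𝓝 (1 - q)) ∧
      q * (1 - a * e) + (1 - q) * (1 - b * e) = 1 - 2 * a * b * e / (a + b) := by
  have ha' : (0 : ℝ) < a := by exact_mod_cast ha
  have hb' : (0 : ℝ) < b := by exact_mod_cast hb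
  have hA := hG ((rootedBiregularTree a b).ball r) r (finite_treeBall a b r) hr
  have hB := hG ((rootedBiregularTree b a).ball r) r (finite_treeBall b a r) hr
  rw [biregularTree_ballProb a b ha, if_pos (RootedGraph.IsIso.refl _)] at hA hB
  by_cases hab : a = b
  · subst hab
    refine ⟨fun _ => ∅, 1, fun _ => Set.empty_subset _, fun _ => Set.disjoint_empty _, ?_, ?_, ?_⟩
    · rw [if_pos (RootedGraph.IsIso.refl _)] at hA
      have h1 : (a : ℝ) / (a + a) + a / (a + a) = 1 := by field_simp
      rw [h1] at hA
      exact hA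
    · simp
    · field_simp; ring
  · refine ⟨fun i => treeLike (G i) b a r, b / (a + b), fun _ => subset_rfl, fun i => ?_,
      ?_, ?_, ?_⟩
    · refine Set.disjoint_left.2 fun v hv hv' => hab ?_
      exact (eq_of_treeBall_isIso hr (RootedGraph.IsIso.trans (RootedGraph.IsIso.symm hv') hv)).symm
    · rw [if_neg fun h => hab (eq_of_treeBall_isIso hr h).symm, zero_add] at hA
      exact hA
    · rw [if_neg fun h => hab (eq_of_treeBall_isIso hr h), add_zero] at hB
      have h1 : 1 - (b : ℝ) / (a + b) = a / (a + b) := by field_simp; ring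
      rw [h1]
      exact hB
    · field_simp; ring

/-- The densities at the activity `treeActivity a b e` converge to the probability that the root of
the random biregular tree is covered, when edges have probability `e`. -/
theorem tendsto_density {a b : ℕ} (ha : 0 < a) (hb : 0 < b) {G : ℕ → FiniteGraph}
    (hG : BSConverges G (biregularTree a b)) {e : ℝ} (he : 0 ≤ e) (h1 : a * e < 1)
    (h2 : b * e < 1) :
    Tendsto (fun i => density (G i).graph (treeActivity a b e)) atTop
      (𝓝 (2 * a * b * e / (a + b))) := by
  set t := treeActivity a b e with ht
  have ht0 : 0 ≤ t := treeActivity_nonneg ha he h1 h2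
  set R := treeError a b t with hR
  choose B q hB hdisj hqA hqB hq using fun d : ℕ =>
    exists_treeLike_proportions ha hb hG e (Nat.succ_pos d)
  have hR' : ∀ d, treeError b a t d = R d := fun d => by
    rw [hR]; unfold treeError; rw [add_comm (b : ℝ)]
  have hbounds : ∀ d i, _ := fun d i => avg_bounds (treeLike (G i) a b (d + 1)) (B d i) (hdisj d i)
    (fun v => uncov (G i).graph Finset.univ v t) (fun v => (uncov_pos _ _ ht0).le)
    (fun v => uncov_le_one (Finset.mem_univ _) ht0)
    (lA := (1 - a * e) / R d) (uA := (1 - a * e) * R d)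
    (lB := (1 - b * e) / R d) (uB := (1 - b * e) * R d)
    (fun v hv => uncov_bounds_of_ball ha hb he h1 h2 hv)
    (fun v hv => by
      have := uncov_bounds_of_ball hb ha he h2 h1 (hB d i hv)
      rwa [treeActivity_comm, ← ht, hR'] at this)
  have hRlim : Tendsto R atTop (𝓝 1) := treeError_tendsto a b ht0
  have key : Tendsto (fun i => (∑ v, uncov (G i).graph Finset.univ v t) / Fintype.card (G i).V)
      atTop (𝓝 (1 - 2 * a * b * e / (a + b))) := by
    refine tendsto_of_bounds (L := fun d => (1 - 2 * a * b * e / (a + b)) / R d)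
      (U := fun d => (1 - 2 * a * b * e / (a + b)) * R d) (fun d => ?_) (fun d => ?_) ?_ ?_
      (fun d i => (hbounds d i).1) (fun d i => (hbounds d i).2)
    · have := ((hqA d).mul_const ((1 - a * e) / R d)).add ((hqB d).mul_const ((1 - b * e) / R d))
      rw [← hq d]
      convert this using 2
      ring
    · have := (((hqA d).mul_const ((1 - a * e) * R d)).add
        ((hqB d).mul_const ((1 - b * e) * R d))).add (((hqA d).const_sub 1).sub (hqB d))
      rw [← hq d]
      convert this using 2
      ring
    · have := (tendsto_const_nhds (x := 1 - 2 * a * b * e / (a + b))).div hRlim one_ne_zero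
      rw [div_one] at this
      exact this
    · simpa using hRlim.const_mul (1 - 2 * a * b * e / (a + b))
  have h3 : ∀ i, density (G i).graph t
      = 1 - (∑ v, uncov (G i).graph Finset.univ v t) / Fintype.card (G i).V := by
    intro i
    have hV : (Fintype.card (G i).V : ℝ) ≠ 0 := by exact_mod_cast Fintype.card_ne_zero
    rw [density_eq_avg _ ht0, Finset.sum_sub_distrib, sub_div]
    simp [hV]
  simp_rw [h3]
  simpa using key.const_sub 1

/-! ### Convergence of the pressures and of the entropies -/

/-- The free energy per vertex of the random biregular tree, when edges have probability `e`. -/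
def treePressure (a b e : ℝ) : ℝ :=
  (a * b * Real.log (1 - e) - a * Real.log (1 - b * e) - b * Real.log (1 - a * e)) / (a + b)

/-- The derivative of `treeActivity a b`. -/
def treeActivityDeriv (a b e : ℝ) : ℝ :=
  (1 - e) / ((1 - a * e) * (1 - b * e))
    * (1 + e * (-1 / (1 - e) + a / (1 - a * e) + b / (1 - b * e)))

section Analysis

variable {a b e : ℝ}

lemma treeActivity_hasDerivAt (h1 : 1 - a * e ≠ 0) (h2 : 1 - b * e ≠ 0) (h3 : 1 - e ≠ 0) :
    HasDerivAt (treeActivity a b) (treeActivityDeriv a b e) e := by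
  have hid := hasDerivAt_id' e
  have hA : HasDerivAt (fun x => 1 - a * x) (-a) e := by
    simpa using (hid.const_mul a).const_sub 1
  have hB : HasDerivAt (fun x => 1 - b * x) (-b) e := by
    simpa using (hid.const_mul b).const_sub 1
  have hC : HasDerivAt (fun x : ℝ => 1 - x) (-1) e := by simpa using hid.const_sub 1
  have h := (hid.mul hC).div (hA.mul hB) (mul_ne_zero h1 h2)
  refine HasDerivAt.congr_deriv h ?_
  unfold treeActivityDeriv
  simp only [Pi.mul_apply]
  generalize 1 - a * e = A at *
  generalize 1 - b * e = B at *
  generalize 1 - e = C at *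
  field_simp
  ring

/-- The identity `L' = p/2 (ln t)'` between the derivatives of the pressure and the activity of the
biregular tree. -/
lemma treePressure_hasDerivAt (hab : a + b ≠ 0) (he : e ≠ 0) (h1 : 1 - a * e ≠ 0)
    (h2 : 1 - b * e ≠ 0) (h3 : 1 - e ≠ 0) :
    HasDerivAt (treePressure a b)
      (2 * a * b * e / (a + b) / (2 * treeActivity a b e) * treeActivityDeriv a b e) e := by
  have hid := hasDerivAt_id' e
  have hA : HasDerivAt (fun x => 1 - a * x) (-a) e := by
    simpa using (hid.const_mul a).const_sub 1
  have hB : HasDerivAt (fun x => 1 - b * x) (-b) e := by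
    simpa using (hid.const_mul b).const_sub 1
  have hC : HasDerivAt (fun x : ℝ => 1 - x) (-1) e := by simpa using hid.const_sub 1
  have h := ((((hC.log h3).const_mul (a * b)).sub ((hB.log h2).const_mul a)).sub
    ((hA.log h1).const_mul b)).div_const (a + b)
  refine HasDerivAt.congr_deriv h ?_
  unfold treeActivityDeriv treeActivity
  have hA' : a * e = 1 - (1 - a * e) := by ring
  have hB' : b * e = 1 - (1 - b * e) := by ring
  have hC' : e = 1 - (1 - e) := by ring
  have e1 : a / (1 - a * e) * e = 1 / (1 - a * e) - 1 := by
    rw [div_mul_eq_mul_div]; nth_rewrite 1 [hA']; rw [sub_div, div_self h1]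
  have e2 : b / (1 - b * e) * e = 1 / (1 - b * e) - 1 := by
    rw [div_mul_eq_mul_div]; nth_rewrite 1 [hB']; rw [sub_div, div_self h2]
  have e3 : 1 / (1 - e) * e = 1 / (1 - e) - 1 := by
    field_simp; ring
  have e4 : 1 + e * (-1 / (1 - e) + a / (1 - a * e) + b / (1 - b * e))
      = 1 / (1 - a * e) + 1 / (1 - b * e) - 1 / (1 - e) := by
    linear_combination e1 + e2 - e3
  rw [e4]
  generalize 1 - a * e = A at *
  generalize 1 - b * e = B at *
  generalize 1 - e = C at *
  field_simp
  ring

lemma treeActivityDeriv_continuousAt (h1 : 1 - a * e ≠ 0) (h2 : 1 - b * e ≠ 0) (h3 : 1 - e ≠ 0) :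
    ContinuousAt (treeActivityDeriv a b) e := by
  unfold treeActivityDeriv
  have := mul_ne_zero h1 h2
  fun_prop (disch := assumption)

lemma treePressure_continuousAt (h1 : 1 - a * e ≠ 0) (h2 : 1 - b * e ≠ 0) (h3 : 1 - e ≠ 0) :
    ContinuousAt (treePressure a b) e := by
  unfold treePressure
  refine ContinuousAt.div_const ?_ _
  fun_prop (disch := assumption)

end Analysis

/-- The explicit formula for the entropy, in terms of the edge probability `e`. -/
lemma biregularG_eq {a b : ℕ} {e : ℝ} (ha : 0 < a) (hb : 0 < b) (he : 0 < e) (h1 : a * e < 1)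
    (h2 : b * e < 1) :
    biregularG a b (2 * a * b * e / (a + b)) = treePressure a b e
      - 1 / 2 * (2 * a * b * e / (a + b)) * Real.log (treeActivity a b e) := by
  have ha' : (0 : ℝ) < a := by exact_mod_cast ha
  have hb' : (0 : ℝ) < b := by exact_mod_cast hb
  have h4 : (1 : ℝ) ≤ a := by exact_mod_cast ha
  have h3 : 0 < 1 - e := by nlinarith
  have hA : (0 : ℝ) < 1 - a * e := by linarith
  have hB : (0 : ℝ) < 1 - b * e := by linarith
  have e1 : ((a : ℝ) + b) / (2 * a) * (2 * a * b * e / (a + b)) = b * e := by field_simp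
  have e2 : ((a : ℝ) + b) / (2 * b) * (2 * a * b * e / (a + b)) = a * e := by field_simp
  have e3 : ((a : ℝ) + b) / (2 * a * b) * (2 * a * b * e / (a + b)) = e := by field_simp
  unfold biregularG
  rw [e1, e2, e3, Real.binEntropy, Real.binEntropy, Real.binEntropy, treeActivity, treePressure,
    Real.log_div (by positivity) (by positivity), Real.log_mul he.ne' h3.ne',
    Real.log_mul hA.ne' hB.ne', Real.log_inv, Real.log_inv, Real.log_inv, Real.log_inv,
    Real.log_inv, Real.log_inv, Real.log_mul ha'.ne' he.ne', Real.log_mul hb'.ne' he.ne',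
    Real.log_mul ha'.ne' hb'.ne']
  generalize Real.log (1 - a * e) = lA
  generalize Real.log (1 - b * e) = lB
  generalize Real.log (1 - e) = lC
  field_simp
  ring

lemma continuous_biregularG (a b : ℕ) : Continuous (biregularG a b) := by
  unfold biregularG
  fun_prop

/-- Integrating the convergence of the densities: `ln M(G_i,t) / v(G_i)` converges to the free
energy of the tree. -/
theorem tendsto_pressure {a b : ℕ} (ha : 0 < a) (hb : 0 < b) {G : ℕ → FiniteGraph}
    (hG : BSConverges G (biregularTree a b)) (hD : BoundedDegree G) {e : ℝ} (he : 0 ≤ e)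
    (h1 : a * e < 1) (h2 : b * e < 1) :
    Tendsto (fun i => pressure (G i).graph (treeActivity a b e)) atTop
      (𝓝 (treePressure a b e)) := by
  obtain ⟨D, hD⟩ := hD
  have ha' : (0 : ℝ) < a := by exact_mod_cast ha
  have hb' : (0 : ℝ) < b := by exact_mod_cast hb
  have h4 : (1 : ℝ) ≤ a := by exact_mod_cast ha
  -- everything below happens for edge probabilities `x` in `[0, e]`
  have hdom : ∀ x ∈ Set.uIcc 0 e, 0 ≤ x ∧ a * x < 1 ∧ b * x < 1 ∧ x < 1 := by
    intro x hx
    rw [Set.uIcc_of_le he] at hx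
    refine ⟨hx.1, ?_, ?_, ?_⟩ <;> nlinarith [hx.1, hx.2]
  have hne : ∀ x ∈ Set.uIcc 0 e, 1 - a * x ≠ 0 ∧ 1 - b * x ≠ 0 ∧ 1 - x ≠ 0 := by
    intro x hx
    obtain ⟨_, h, h', h''⟩ := hdom x hx
    exact ⟨by linarith, by linarith, by linarith⟩
  have hact : ∀ x ∈ Set.uIcc 0 e, HasDerivAt (treeActivity a b) (treeActivityDeriv a b x) x :=
    fun x hx => treeActivity_hasDerivAt (hne x hx).1 (hne x hx).2.1 (hne x hx).2.2
  have hact0 : ∀ x ∈ Set.uIcc 0 e, 0 ≤ treeActivity a b x := fun x hx =>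
    treeActivity_nonneg ha (hdom x hx).1 (hdom x hx).2.1 (hdom x hx).2.2.1
  have hactpos : ∀ x ∈ Set.uIcc 0 e, 0 < x → 0 < treeActivity a b x := by
    intro x hx hx0
    obtain ⟨_, h, h', h''⟩ := hdom x hx
    exact div_pos (mul_pos hx0 (by linarith)) (mul_pos (by linarith) (by linarith))
  have hdcont : ContinuousOn (treeActivityDeriv a b) (Set.uIcc 0 e) := fun x hx =>
    (treeActivityDeriv_continuousAt (hne x hx).1 (hne x hx).2.1
      (hne x hx).2.2).continuousWithinAt
  let g : ℕ → ℝ → ℝ := fun i t =>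
    deriv (matchingGen (G i).graph) t / matchingGen (G i).graph t / Fintype.card (G i).V
  have hgcont : ∀ i, ContinuousOn (fun x => g i (treeActivity a b x) * treeActivityDeriv a b x)
      (Set.uIcc 0 e) := by
    intro i
    refine ContinuousOn.mul ?_ hdcont
    have hc : ContinuousOn (treeActivity a b) (Set.uIcc 0 e) := fun x hx =>
      (hact x hx).continuousAt.continuousWithinAt
    have hder : Continuous (deriv (matchingGen (G i).graph)) := by
      rw [show deriv (matchingGen (G i).graph) = _ from
        funext fun t => (hasDerivAt_matchingGen (G i).graph t).deriv]
      fun_prop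
    have hmg : Continuous (matchingGen (G i).graph) :=
      continuous_iff_continuousAt.2 fun t => (hasDerivAt_matchingGen _ t).continuousAt
    refine ContinuousOn.div_const ((hder.comp_continuousOn hc).div (hmg.comp_continuousOn hc) ?_) _
    exact fun x hx => (matchingGen_pos _ (hact0 x hx)).ne'
  have hint : ∀ i, ∫ x in (0 : ℝ)..e, g i (treeActivity a b x) * treeActivityDeriv a b x
      = pressure (G i).graph (treeActivity a b e) := by
    intro i
    rw [intervalIntegral.integral_eq_sub_of_hasDerivAt
      (f := fun x => pressure (G i).graph (treeActivity a b x))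
      (fun x hx => (pressure_hasDerivAt _ (hact0 x hx)).comp x (hact x hx))
      (hgcont i).intervalIntegrable]
    have : treeActivity a b 0 = 0 := by simp [treeActivity]
    rw [this, pressure_zero, sub_zero]
  let h : ℝ → ℝ := fun x =>
    (-(a * b) / (1 - x) + a * b / (1 - b * x) + a * b / (1 - a * x)) / (a + b)
  have htree : ∀ x ∈ Set.uIcc 0 e, HasDerivAt (treePressure a b) (h x) x := by
    intro x hx
    obtain ⟨hA, hB, hC⟩ := hne x hx
    have hid := hasDerivAt_id' x
    have hA' : HasDerivAt (fun x : ℝ => 1 - a * x) (-a) x := by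
      simpa using (hid.const_mul (a : ℝ)).const_sub 1
    have hB' : HasDerivAt (fun x : ℝ => 1 - b * x) (-b) x := by
      simpa using (hid.const_mul (b : ℝ)).const_sub 1
    have hC' : HasDerivAt (fun x : ℝ => 1 - x) (-1) x := by simpa using hid.const_sub 1
    refine ((((hC'.log hC).const_mul ((a : ℝ) * b)).sub ((hB'.log hB).const_mul (a : ℝ))).sub
      ((hA'.log hA).const_mul (b : ℝ))).div_const ((a : ℝ) + b) |>.congr_deriv ?_
    simp only [h]
    congr 1
    ring
  have hhcont : ContinuousOn h (Set.uIcc 0 e) := by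
    intro x hx
    obtain ⟨hA, hB, hC⟩ := hne x hx
    refine ContinuousAt.continuousWithinAt ?_
    refine ContinuousAt.div_const ?_ _
    fun_prop (disch := assumption)
  have hinth : ∫ x in (0 : ℝ)..e, h x = treePressure a b e := by
    rw [intervalIntegral.integral_eq_sub_of_hasDerivAt htree hhcont.intervalIntegrable]
    simp [treePressure]
  rw [← hinth]
  simp_rw [← hint]
  refine intervalIntegral.tendsto_integral_filter_of_dominated_convergence
    (fun x => D / 2 * |treeActivityDeriv a b x|) ?_ ?_ ?_ ?_
  · refine Eventually.of_forall fun i => ?_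
    exact ((hgcont i).mono Set.uIoc_subset_uIcc).aestronglyMeasurable measurableSet_uIoc
  · refine Eventually.of_forall fun i => Eventually.of_forall fun x hx => ?_
    have hx' := Set.uIoc_subset_uIcc hx
    have hx0 : 0 < x := by rw [Set.uIoc_of_le he] at hx; exact hx.1
    have ht := hactpos x hx' hx0
    rw [norm_mul, Real.norm_eq_abs, Real.norm_eq_abs]
    refine mul_le_mul_of_nonneg_right ?_ (abs_nonneg _)
    simp only [g]
    rw [pressure_deriv_eq _ ht, abs_of_nonneg (div_nonneg (density_nonneg _ ht.le) (by positivity)),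
      div_le_div_iff₀ (by positivity) (by positivity)]
    have := density_le_mul_degree (G i).graph (hD i) ht.le
    linarith
  · exact (hdcont.abs.const_smul ((D : ℝ) / 2)).intervalIntegrable
  · refine Eventually.of_forall fun x hx => ?_
    have hx' := Set.uIoc_subset_uIcc hx
    have hx0 : 0 < x := by rw [Set.uIoc_of_le he] at hx; exact hx.1
    have ht := hactpos x hx' hx0
    obtain ⟨hA, hB, hC⟩ := hne x hx'
    have hlim : h x = 2 * a * b * x / (a + b) / (2 * treeActivity a b x)
        * treeActivityDeriv a b x :=
      (htree x hx').unique (treePressure_hasDerivAt (by positivity) hx0.ne' hA hB hC)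
    rw [hlim]
    refine Tendsto.mul_const _ ?_
    simp only [g]
    simp_rw [pressure_deriv_eq _ ht]
    exact (tendsto_density ha hb hG (hdom x hx').1 (hdom x hx').2.1 (hdom x hx').2.2.1).div_const _

/-- The entropies of a Benjamini–Schramm convergent sequence converge: from above by testing the
Legendre transform at the activity of the tree, from below since the activities of the graphs
converge to that of the tree. -/
theorem tendsto_entropy_biregularG {a b : ℕ} (ha : 0 < a) (hb : 0 < b) {G : ℕ → FiniteGraph}
    (hG : Approximates G (biregularTree a b) (biregularEnd a b)) {p : ℝ} (hp : 0 ≤ p)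
    (hp' : p < biregularEnd a b) :
    Tendsto (fun i => entropy (G i).graph p) atTop (𝓝 (biregularG a b p)) := by
  have ha' : (0 : ℝ) < a := by exact_mod_cast ha
  have hb' : (0 : ℝ) < b := by exact_mod_cast hb
  have h4 : (1 : ℝ) ≤ a := by exact_mod_cast ha
  have hps : ∀ i, p < pStar (G i).graph := fun i => hp'.trans_le (hG.le_pStar i)
  rcases hp.eq_or_lt with rfl | hp
  · have h0 : biregularG a b 0 = 0 := by simp [biregularG]
    rw [h0]
    refine tendsto_const_nhds.congr fun i => (entropy_zero _ (hps i)).symm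
  simp_rw [entropy_of_lt _ (hps _)]
  obtain ⟨e, he⟩ : ∃ e : ℝ, e = (a + b) / (2 * a * b) * p := ⟨_, rfl⟩
  have hpe : p = 2 * a * b * e / (a + b) := by rw [he]; field_simp
  have he0 : 0 < e := by rw [he]; positivity
  have h1 : a * e < 1 := by
    have h := hp'.trans_le (min_le_right _ _)
    rw [lt_div_iff₀ (by positivity)] at h
    have : a * e = p * (a + b) / (2 * b) := by rw [he]; field_simp
    rw [this, div_lt_one (by positivity)]; exact h
  have h2 : b * e < 1 := by
    have h := hp'.trans_le (min_le_left _ _)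
    rw [lt_div_iff₀ (by positivity)] at h
    have : b * e = p * (a + b) / (2 * a) := by rw [he]; field_simp
    rw [this, div_lt_one (by positivity)]; exact h
  have hpos : ∀ x : ℝ, 0 < x → a * x < 1 → b * x < 1 → 0 < treeActivity a b x := fun x hx hA hB =>
    div_pos (mul_pos hx (by nlinarith)) (mul_pos (by linarith) (by linarith))
  have hgoal : biregularG a b p
      = treePressure a b e - 1 / 2 * p * Real.log (treeActivity a b e) := by
    have := biregularG_eq ha hb he0 h1 h2
    rwa [← hpe] at this
  rw [hgoal]
  refine tendsto_order.2 ⟨fun c hc => ?_, fun c hc => ?_⟩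
  · have hAne : (1 : ℝ) - a * e ≠ 0 := by linarith
    have hBne : (1 : ℝ) - b * e ≠ 0 := by linarith
    have hCne : (1 : ℝ) - e ≠ 0 := by nlinarith
    have hminus : Tendsto (fun δ : ℝ => e - δ) (𝓝 0) (𝓝 e) := by
      exact Continuous.tendsto' (by fun_prop) _ _ (sub_zero e)
    have hplus : Tendsto (fun δ : ℝ => e + δ) (𝓝 0) (𝓝 e) := by
      exact Continuous.tendsto' (by fun_prop) _ _ (add_zero e)
    have hlow : Tendsto (fun δ : ℝ => treePressure a b (e - δ)
        - 1 / 2 * p * Real.log (treeActivity a b (e + δ))) (𝓝 0)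
        (𝓝 (treePressure a b e - 1 / 2 * p * Real.log (treeActivity a b e))) := by
      refine ((treePressure_continuousAt hAne hBne hCne).tendsto.comp hminus).sub
        (Tendsto.const_mul _ ?_)
      exact (((treeActivity_hasDerivAt hAne hBne hCne).continuousAt.tendsto.comp hplus).log
        (hpos e he0 h1 h2).ne')
    have hev : ∀ᶠ δ in 𝓝[>] (0 : ℝ), 0 < δ ∧ 0 < e - δ ∧ a * (e + δ) < 1 ∧ b * (e + δ) < 1 ∧
        c < treePressure a b (e - δ) - 1 / 2 * p * Real.log (treeActivity a b (e + δ)) := by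
      have h0 : ∀ᶠ δ in 𝓝 (0 : ℝ), 0 < e - δ := hminus.eventually_const_lt he0
      have hA : ∀ᶠ δ in 𝓝 (0 : ℝ), a * (e + δ) < 1 :=
        (hplus.const_mul (a : ℝ)).eventually_lt_const h1
      have hB : ∀ᶠ δ in 𝓝 (0 : ℝ), b * (e + δ) < 1 :=
        (hplus.const_mul (b : ℝ)).eventually_lt_const h2
      filter_upwards [self_mem_nhdsWithin, nhdsWithin_le_nhds h0, nhdsWithin_le_nhds hA,
        nhdsWithin_le_nhds hB, nhdsWithin_le_nhds (hlow.eventually_const_lt hc)]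
        with δ hδ hδ0 hδA hδB hδc using ⟨hδ, hδ0, hδA, hδB, hδc⟩
    -- the activities of the graphs are eventually between those for `e - δ` and `e + δ`
    obtain ⟨δ, hδ, hm0, hpA, hpB, hcδ⟩ := hev.exists
    have hmA : a * (e - δ) < 1 := by nlinarith
    have hmB : b * (e - δ) < 1 := by nlinarith
    have hp0 : 0 < e + δ := by linarith
    have hdm := tendsto_density ha hb hG.bsConverges hm0.le hmA hmB
    have hdp := tendsto_density ha hb hG.bsConverges hp0.le hpA hpB
    have hpm := tendsto_pressure ha hb hG.bsConverges hG.boundedDegree hm0.le hmA hmB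
    have hlt1 : 2 * a * b * (e - δ) / (a + b) < p := by rw [hpe]; gcongr; linarith
    have hlt2 : p < 2 * a * b * (e + δ) / (a + b) := by rw [hpe]; gcongr; linarith
    filter_upwards [hdm.eventually_lt_const hlt1, hdp.eventually_const_lt hlt2,
      (hpm.sub_const (1 / 2 * p * Real.log (treeActivity a b (e + δ)))).eventually_const_lt hcδ]
      with i hi1 hi2 hi3
    refine hi3.trans_le ?_
    obtain ⟨hs0, hs⟩ := activity_spec (G i).graph hp.le (hps i)
    have hspos := activity_pos (G i).graph hp (hps i)
    rw [freeEntropy_activity _ hp.le (hps i)]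
    set s := activity (G i).graph p
    have hA1 : treeActivity a b (e - δ) ≤ s := by
      by_contra! hlt
      have := density_mono (G i).graph hs0 hlt.le
      linarith
    have hA2 : s ≤ treeActivity a b (e + δ) := by
      by_contra! hlt
      have := density_mono (G i).graph (hpos _ hp0 hpA hpB).le hlt.le
      linarith
    have hB1 := pressure_mono (G i).graph (hpos _ hm0 hmA hmB).le hA1
    have hB2 := Real.log_le_log hspos hA2
    have : 1 / 2 * p * Real.log s ≤ 1 / 2 * p * Real.log (treeActivity a b (e + δ)) := by gcongr
    linarith
  · have ht := hpos e he0 h1 h2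
    have := (tendsto_pressure ha hb hG.bsConverges hG.boundedDegree he0.le h1 h2).sub_const
      (1 / 2 * p * Real.log (treeActivity a b e))
    filter_upwards [this.eventually_lt_const hc] with i hi
    exact (freeEntropy_activity_le _ hp (hps i) ht).trans_lt hi

/-! ### Matchings of two-fold covers -/

section Coloring

lemma zmodTwo_add_one_ne (i : ZMod 2) : i + 1 ≠ i := by revert i; decide

lemma zmodTwo_not_three {i j k : ZMod 2} (h1 : i ≠ j) (h2 : i ≠ k) : j = k := by
  revert i j k; decide

/-- The union of two partial matchings `P`, `Q` of a finite set is bipartite. A `P`-pair `x, y` is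
removed by joining the `Q`-partners of `x` and `y` to each other. -/
lemma exists_two_coloring {X : Type u} (S : Finset X) (P Q : X → X → Prop)
    (hPs : ∀ x y, P x y → P y x) (hQs : ∀ x y, Q x y → Q y x)
    (hPi : ∀ x, ¬ P x x) (hQi : ∀ x ∈ S, ¬ Q x x)
    (hP : ∀ x ∈ S, ∀ y ∈ S, ∀ z ∈ S, P x y → P x z → y = z)
    (hQ : ∀ x ∈ S, ∀ y ∈ S, ∀ z ∈ S, Q x y → Q x z → y = z) :
    ∃ g : X → ZMod 2, ∀ x ∈ S, ∀ y ∈ S, P x y ∨ Q x y → g x ≠ g y := by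
  induction S using Finset.strongInduction generalizing Q with
  | H S ih =>
    rcases S.eq_empty_or_nonempty with rfl | ⟨x, hx⟩
    · exact ⟨fun _ => 0, by simp⟩
    by_cases hxP : ∃ y ∈ S, P x y
    · obtain ⟨y, hy, hxy⟩ := hxP
      have hne : x ≠ y := by rintro rfl; exact hPi _ hxy
      set S' := (S.erase x).erase y with hS'
      have hS : ∀ w ∈ S', w ∈ S := fun w hw => Finset.mem_of_mem_erase (Finset.mem_of_mem_erase hw)
      have hSx : ∀ w ∈ S', w ≠ x := by
        intro w hw; exact Finset.ne_of_mem_erase (Finset.mem_of_mem_erase hw)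
      have hSy : ∀ w ∈ S', w ≠ y := fun w hw => Finset.ne_of_mem_erase hw
      have hSS : ∀ w ∈ S, w = x ∨ w = y ∨ w ∈ S' := by
        intro w hw
        simp only [hS', Finset.mem_erase]
        tauto
      have hss : S' ⊂ S := (Finset.erase_subset _ _).trans_ssubset (Finset.erase_ssubset hx)
      obtain ⟨g, hg⟩ := ih S' hss (fun u v => Q u v ∨ (Q x u ∧ Q y v) ∨ (Q y u ∧ Q x v))
        (by intro u v h; rcases h with h | h | h
            · exact .inl (hQs _ _ h)
            · exact .inr (.inr ⟨h.2, h.1⟩)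
            · exact .inr (.inl ⟨h.2, h.1⟩))
        (by
          rintro u hu (h | h | h)
          · exact hQi u (hS u hu) h
          · exact hne (hQ u (hS u hu) x hx y hy (hQs _ _ h.1) (hQs _ _ h.2))
          · exact hne (hQ u (hS u hu) x hx y hy (hQs _ _ h.2) (hQs _ _ h.1)))
        (fun u hu v hv w hw => hP u (hS u hu) v (hS v hv) w (hS w hw))
        (by
          intro u hu v hv w hw h1 h2
          have hxu : ∀ z ∈ S', Q x u → Q u z → False := fun z hz h h' =>
            hSx z hz (hQ u (hS u hu) z (hS z hz) x hx h' (hQs _ _ h))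
          have hyu : ∀ z ∈ S', Q y u → Q u z → False := fun z hz h h' =>
            hSy z hz (hQ u (hS u hu) z (hS z hz) y hy h' (hQs _ _ h))
          have hxy : Q x u → Q y u → False := fun h h' =>
            hne (hQ u (hS u hu) x hx y hy (hQs _ _ h) (hQs _ _ h'))
          rcases h1 with h1 | h1 | h1 <;> rcases h2 with h2 | h2 | h2
          · exact hQ u (hS u hu) v (hS v hv) w (hS w hw) h1 h2
          · exact (hxu v hv h2.1 h1).elim
          · exact (hyu v hv h2.1 h1).elim
          · exact (hxu w hw h1.1 h2).elim
          · exact hQ y hy v (hS v hv) w (hS w hw) h1.2 h2.2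
          · exact (hxy h1.1 h2.1).elim
          · exact (hyu w hw h1.1 h2).elim
          · exact (hxy h2.1 h1.1).elim
          · exact hQ x hx v (hS v hv) w (hS w hw) h1.2 h2.2)
      obtain ⟨c, hcx, hcy⟩ : ∃ c : ZMod 2, (∀ w ∈ S', Q x w → g w ≠ c) ∧
          ∀ w ∈ S', Q y w → g w ≠ c + 1 := by
        by_cases h1 : ∃ w ∈ S', Q x w
        · obtain ⟨w, hw, hxw⟩ := h1
          refine ⟨g w + 1, fun z hz hxz => ?_, fun z hz hyz => ?_⟩
          · rw [hQ x hx z (hS z hz) w (hS w hw) hxz hxw]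
            exact (zmodTwo_add_one_ne _).symm
          · have := hg z hz w hw (.inr (.inr (.inr ⟨hyz, hxw⟩)))
            rwa [add_assoc, CharTwo.add_self_eq_zero, add_zero]
        · by_cases h2 : ∃ w ∈ S', Q y w
          · obtain ⟨w, hw, hyw⟩ := h2
            refine ⟨g w, fun z hz hxz => (h1 ⟨z, hz, hxz⟩).elim, fun z hz hyz => ?_⟩
            rw [hQ y hy z (hS z hz) w (hS w hw) hyz hyw]
            exact (zmodTwo_add_one_ne _).symm
          · exact ⟨0, fun z hz h => (h1 ⟨z, hz, h⟩).elim, fun z hz h => (h2 ⟨z, hz, h⟩).elim⟩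
      refine ⟨fun w => if w = x then c else if w = y then c + 1 else g w, ?_⟩
      have hmain : ∀ u ∈ S, ∀ w ∈ S, P u w ∨ Q u w → u = x ∨ (u = y ∧ w ≠ x) ∨
          (u ∈ S' ∧ w ∈ S') → (if u = x then c else if u = y then c + 1 else g u) ≠
            (if w = x then c else if w = y then c + 1 else g w) := by
        intro u hu w hw huw h
        rcases h with rfl | ⟨rfl, hwx⟩ | ⟨huS, hwS⟩
        · rcases hSS w hw with rfl | rfl | hwS
          · exact (huw.elim (hPi _) (hQi _ hw)).elim
          · simp [hne.symm]
          · have h1 := hSx w hwS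
            have h2 := hSy w hwS
            rcases huw with huw | huw
            · exact (h2 (hP u hu w hw y hy huw hxy)).elim
            · simpa [h1, h2] using (hcx w hwS huw).symm
        · rcases hSS w hw with rfl | rfl | hwS
          · exact (hwx rfl).elim
          · exact (huw.elim (hPi _) (hQi _ hw)).elim
          · have h2 := hSy w hwS
            rcases huw with huw | huw
            · exact (hwx (hP u hu w hw x hx huw (hPs _ _ hxy))).elim
            · simpa [hwx, h2, hne.symm] using (hcy w hwS huw).symm
        · simp only [hSx u huS, hSy u huS, hSx w hwS, hSy w hwS, if_false]
          exact hg u huS w hwS (huw.imp id Or.inl)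
      intro u hu w hw huw
      have hwu : P w u ∨ Q w u := huw.imp (hPs _ _) (hQs _ _)
      rcases hSS u hu with h | h | h
      · exact hmain u hu w hw huw (.inl h)
      · by_cases hwx : w = x
        · exact (hmain w hw u hu hwu (.inl hwx)).symm
        · exact hmain u hu w hw huw (.inr (.inl ⟨h, hwx⟩))
      · rcases hSS w hw with h' | h' | h'
        · exact (hmain w hw u hu hwu (.inl h')).symm
        · exact (hmain w hw u hu hwu (.inr (.inl ⟨h', hSx u h⟩))).symm
        · exact hmain u hu w hw huw (.inr (.inr ⟨h, h'⟩))
    · have hss := Finset.erase_ssubset hx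
      have hS : ∀ w ∈ S.erase x, w ∈ S := fun w hw => Finset.mem_of_mem_erase hw
      obtain ⟨g, hg⟩ := ih (S.erase x) hss Q hQs (fun u hu => hQi u (hS u hu))
        (fun u hu v hv w hw => hP u (hS u hu) v (hS v hv) w (hS w hw))
        (fun u hu v hv w hw => hQ u (hS u hu) v (hS v hv) w (hS w hw))
      obtain ⟨c, hc⟩ : ∃ c : ZMod 2, ∀ w ∈ S, Q x w → g w ≠ c := by
        by_cases h1 : ∃ w ∈ S, Q x w
        · obtain ⟨w, hw, hxw⟩ := h1
          refine ⟨g w + 1, fun z hz hxz => ?_⟩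
          rw [hQ x hx z hz w hw hxz hxw]
          exact (zmodTwo_add_one_ne _).symm
        · exact ⟨0, fun z hz h => (h1 ⟨z, hz, h⟩).elim⟩
      refine ⟨fun w => if w = x then c else g w, fun u hu w hw huw => ?_⟩
      by_cases hux : u = x <;> by_cases hwx : w = x
      · subst hux; subst hwx
        exact (huw.elim (hPi _) (hQi _ hw)).elim
      · subst hux
        rcases huw with h | h
        · exact (hxP ⟨w, hw, h⟩).elim
        · simpa [hwx] using (hc w hw h).symm
      · subst hwx
        rcases huw with h | h
        · exact (hxP ⟨u, hu, hPs _ _ h⟩).elim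
        · simpa [hux] using hc u hu (hQs _ _ h)
      · simpa [hux, hwx] using
          hg u (Finset.mem_erase.2 ⟨hux, hu⟩) w (Finset.mem_erase.2 ⟨hwx, hw⟩) huw

end Coloring

section Bipartite

variable {V : Type u}

/-- Every edge of `G` joins `A` to its complement. -/
def IsBipartition (G : SimpleGraph V) (A : Set V) : Prop :=
  ∀ u v, G.Adj u v → (u ∈ A ↔ v ∉ A)

variable [Fintype V]

/-- The matchings of a bipartite graph, with edges written as pairs whose first entry is in `A`. -/
def orientedMatchings (G : SimpleGraph V) (A : Set V) : Finset (Finset (V × V)) :=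
  Finset.univ.filter fun P => (∀ p ∈ P, p.1 ∈ A ∧ G.Adj p.1 p.2) ∧
    ∀ p ∈ P, ∀ q ∈ P, p ≠ q → p.1 ≠ q.1 ∧ p.2 ≠ q.2

lemma mem_orientedMatchings {G : SimpleGraph V} {A : Set V} {P : Finset (V × V)} :
    P ∈ orientedMatchings G A ↔ (∀ p ∈ P, p.1 ∈ A ∧ G.Adj p.1 p.2) ∧
      ∀ p ∈ P, ∀ q ∈ P, p ≠ q → p.1 ≠ q.1 ∧ p.2 ≠ q.2 := by
  simp [orientedMatchings]

omit [Fintype V] in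
lemma IsBipartition.mk_inj {G : SimpleGraph V} {A : Set V} (hA : IsBipartition G A)
    {p q : V × V} (hp : p.1 ∈ A ∧ G.Adj p.1 p.2) (hq : q.1 ∈ A ∧ G.Adj q.1 q.2)
    (h : s(p.1, p.2) = s(q.1, q.2)) : p = q := by
  rcases Sym2.eq_iff.1 h with h | h
  · exact Prod.ext h.1 h.2
  · exact absurd hp.1 (h.1 ▸ (hA _ _ hq.2).1 hq.1)

lemma matchingGen_eq_oriented {G : SimpleGraph V} {A : Set V} (hA : IsBipartition G A) (t : ℝ) :
    matchingGen G t = ∑ P ∈ orientedMatchings G A, t ^ P.card := by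
  rw [matchingGen_eq, genIn]
  symm
  have hinj : ∀ P ∈ orientedMatchings G A, Set.InjOn (fun p : V × V => s(p.1, p.2)) P := by
    intro P hP p hp q hq h
    have hP := (mem_orientedMatchings.1 hP).1
    exact hA.mk_inj (hP p hp) (hP q hq) h
  refine Finset.sum_bij (fun P _ => P.image fun p => s(p.1, p.2)) ?_ ?_ ?_ ?_
  · intro P hP
    have hP' := mem_orientedMatchings.1 hP
    refine mem_matchingsIn.2 ⟨⟨?_, ?_⟩, fun _ _ _ _ => Finset.mem_univ _⟩
    · intro e he
      obtain ⟨p, hp, rfl⟩ := Finset.mem_image.1 he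
      exact (hP'.1 p hp).2
    · intro e he f hf hne v hv
      obtain ⟨p, hp, rfl⟩ := Finset.mem_image.1 he
      obtain ⟨q, hq, rfl⟩ := Finset.mem_image.1 hf
      have hpq : p ≠ q := by rintro rfl; exact hne rfl
      have h1 := hP'.2 p hp q hq hpq
      have hp1 := hP'.1 p hp
      have hq1 := hP'.1 q hq
      have hp2 := (hA _ _ hp1.2).1 hp1.1
      have hq2 := (hA _ _ hq1.2).1 hq1.1
      rcases Sym2.mem_iff.1 hv.1 with h | h <;> rcases Sym2.mem_iff.1 hv.2 with h' | h'
      · exact h1.1 (h.symm.trans h')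
      · exact hq2 (h' ▸ h ▸ hp1.1)
      · exact hp2 (h ▸ h' ▸ hq1.1)
      · exact h1.2 (h.symm.trans h')
  · intro P hP P' hP' h
    have key : ∀ P ∈ orientedMatchings G A, ∀ P' ∈ orientedMatchings G A,
        P.image (fun p => s(p.1, p.2)) = P'.image (fun p => s(p.1, p.2)) → P ⊆ P' := by
      intro P hP P' hP' h p hp
      have : s(p.1, p.2) ∈ P'.image (fun p => s(p.1, p.2)) := by
        rw [← h]; exact Finset.mem_image_of_mem _ hp
      obtain ⟨q, hq, hqp⟩ := Finset.mem_image.1 this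
      rwa [hA.mk_inj ((mem_orientedMatchings.1 hP).1 p hp) ((mem_orientedMatchings.1 hP').1 q hq)
        hqp.symm]
    exact (key P hP P' hP' h).antisymm (key P' hP' P hP h.symm)
  · intro M hM
    obtain ⟨⟨hE, hM⟩, _⟩ := mem_matchingsIn.1 hM
    refine ⟨Finset.univ.filter fun p => p.1 ∈ A ∧ s(p.1, p.2) ∈ M, ?_, ?_⟩
    · refine mem_orientedMatchings.2 ⟨?_, ?_⟩
      · intro p hp
        have hp := (Finset.mem_filter.1 hp).2
        exact ⟨hp.1, hE _ hp.2⟩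
      · intro p hp q hq hne
        have hp := (Finset.mem_filter.1 hp).2
        have hq := (Finset.mem_filter.1 hq).2
        have hne' : s(p.1, p.2) ≠ s(q.1, q.2) := fun h =>
          hne (hA.mk_inj ⟨hp.1, hE _ hp.2⟩ ⟨hq.1, hE _ hq.2⟩ h)
        have h1 := hM _ hp.2 _ hq.2 hne'
        refine ⟨fun h => h1 p.1 ⟨Sym2.mem_mk_left _ _, ?_⟩, fun h => h1 p.2
          ⟨Sym2.mem_mk_right _ _, ?_⟩⟩
        · rw [h]; exact Sym2.mem_mk_left _ _
        · rw [h]; exact Sym2.mem_mk_right _ _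
    · ext e
      simp only [Finset.mem_image, Finset.mem_filter, Finset.mem_univ, true_and, Prod.exists]
      constructor
      · rintro ⟨x, y, ⟨_, h⟩, rfl⟩; exact h
      · intro he
        induction e using Sym2.ind with
        | _ x y =>
          by_cases hx : x ∈ A
          · exact ⟨x, y, ⟨hx, he⟩, rfl⟩
          · have hy : y ∈ A := by
              by_contra hy
              exact hx ((hA x y (hE _ he)).2 hy)
            exact ⟨y, x, ⟨hy, Sym2.eq_swap ▸ he⟩, Sym2.eq_swap⟩
  · intro P hP
    rw [Finset.card_image_of_injOn (hinj P hP)]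

end Bipartite

section TwoLift

variable {V : Type u}

/-- The two-fold cover of `G` with signs `s`: an edge with sign `1` switches the two sheets. -/
def twoLift (G : SimpleGraph V) (s : Sym2 V → ZMod 2) : SimpleGraph (V × ZMod 2) where
  Adj x y := G.Adj x.1 y.1 ∧ y.2 = x.2 + s s(x.1, y.1)
  symm := ⟨fun x y ⟨h, h'⟩ => ⟨h.symm, by
    rw [h', add_assoc, Sym2.eq_swap, CharTwo.add_self_eq_zero, add_zero]⟩⟩
  loopless := ⟨fun x h => G.loopless.irrefl _ h.1⟩

variable [Fintype V]

/-- The matchings of `twoLift G s`, written as sets of pairs `(p, i)`: an oriented edge `p` of `G`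
and the sheet `i` of the lift of its first vertex. -/
def liftedMatchings (G : SimpleGraph V) (A : Set V) (s : V × V → ZMod 2) :
    Finset (Finset ((V × V) × ZMod 2)) :=
  Finset.univ.filter fun N => (∀ x ∈ N, x.1.1 ∈ A ∧ G.Adj x.1.1 x.1.2) ∧
    ∀ x ∈ N, ∀ y ∈ N, x.1 ≠ y.1 → (x.1.1 = y.1.1 → x.2 ≠ y.2) ∧
      (x.1.2 = y.1.2 → x.2 + s x.1 ≠ y.2 + s y.1)

lemma mem_liftedMatchings {G : SimpleGraph V} {A : Set V} {s : V × V → ZMod 2}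
    {N : Finset ((V × V) × ZMod 2)} : N ∈ liftedMatchings G A s ↔
      (∀ x ∈ N, x.1.1 ∈ A ∧ G.Adj x.1.1 x.1.2) ∧
        ∀ x ∈ N, ∀ y ∈ N, x.1 ≠ y.1 → (x.1.1 = y.1.1 → x.2 ≠ y.2) ∧
          (x.1.2 = y.1.2 → x.2 + s x.1 ≠ y.2 + s y.1) := by
  simp [liftedMatchings]

omit [Fintype V] in
lemma IsBipartition.twoLift {G : SimpleGraph V} {A : Set V} (hA : IsBipartition G A)
    (s : Sym2 V → ZMod 2) : IsBipartition (twoLift G s) (Prod.fst ⁻¹' A) :=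
  fun _ _ h => hA _ _ h.1

lemma matchingGen_twoLift {G : SimpleGraph V} {A : Set V} (hA : IsBipartition G A)
    (s : Sym2 V → ZMod 2) (t : ℝ) : matchingGen (twoLift G s) t
      = ∑ N ∈ liftedMatchings G A (fun p => s s(p.1, p.2)), t ^ N.card := by
  rw [matchingGen_eq_oriented (hA.twoLift s)]
  let up : (V × V) × ZMod 2 → (V × ZMod 2) × (V × ZMod 2) := fun x =>
    ((x.1.1, x.2), (x.1.2, x.2 + s s(x.1.1, x.1.2)))
  have hup : Function.Injective up := by
    rintro ⟨⟨x, y⟩, i⟩ ⟨⟨x', y'⟩, i'⟩ h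
    simp only [up, Prod.mk.injEq] at h
    ext <;> simp [h]
  symm
  refine Finset.sum_bij (fun N _ => N.image up) ?_ ?_ ?_ ?_
  · intro N hN
    obtain ⟨hE, hN⟩ := mem_liftedMatchings.1 hN
    refine mem_orientedMatchings.2 ⟨?_, ?_⟩
    · intro p hp
      obtain ⟨x, hx, rfl⟩ := Finset.mem_image.1 hp
      exact ⟨(hE x hx).1, (hE x hx).2, rfl⟩
    · intro p hp q hq hne
      obtain ⟨x, hx, rfl⟩ := Finset.mem_image.1 hp
      obtain ⟨y, hy, rfl⟩ := Finset.mem_image.1 hq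
      have hxy : x ≠ y := by rintro rfl; exact hne rfl
      by_cases h : x.1 = y.1
      · have h2 : x.2 ≠ y.2 := fun h2 => hxy (Prod.ext h h2)
        simp only [up, h, ne_eq, Prod.mk.injEq, not_and, add_left_inj]
        exact ⟨fun _ => h2, fun _ => h2⟩
      · have := hN x hx y hy h
        simp only [up, ne_eq, Prod.mk.injEq, not_and]
        exact this
  · intro N _ N' _ h
    exact Finset.image_injective hup h
  · intro P hP
    obtain ⟨hE, hP⟩ := mem_orientedMatchings.1 hP
    have himg : ∀ p ∈ P, up ((p.1.1, p.2.1), p.1.2) = p := by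
      intro p hp
      have h := (hE p hp).2.2
      ext <;> simp [up, h]
    refine ⟨P.image fun p => ((p.1.1, p.2.1), p.1.2), ?_, ?_⟩
    · refine mem_liftedMatchings.2 ⟨?_, ?_⟩
      · intro x hx
        obtain ⟨p, hp, rfl⟩ := Finset.mem_image.1 hx
        exact ⟨(hE p hp).1, (hE p hp).2.1⟩
      · intro x hx y hy hne
        obtain ⟨p, hp, rfl⟩ := Finset.mem_image.1 hx
        obtain ⟨q, hq, rfl⟩ := Finset.mem_image.1 hy
        have hpq : p ≠ q := by rintro rfl; exact hne rfl
        obtain ⟨h1, h2⟩ := hP p hp q hq hpq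
        refine ⟨fun h h' => h1 (Prod.ext h h'), fun h h' => h2 (Prod.ext h ?_)⟩
        rw [(hE p hp).2.2, (hE q hq).2.2]
        exact h'
    · rw [Finset.image_image]
      exact (Finset.image_congr fun p hp => himg p hp).trans Finset.image_id
  · intro N _
    rw [Finset.card_image_of_injective _ hup]

lemma matchingGen_sq {G : SimpleGraph V} {A : Set V} (hA : IsBipartition G A) (t : ℝ) :
    ∑ N ∈ liftedMatchings G A 0, t ^ N.card = matchingGen G t ^ 2 := by
  rw [matchingGen_eq_oriented hA, sq, Finset.sum_mul_sum, ← Finset.sum_product']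
  let sheet : Finset ((V × V) × ZMod 2) → ZMod 2 → Finset (V × V) := fun N i =>
    Finset.univ.filter fun p => (p, i) ∈ N
  have hcover : ∀ i : ZMod 2, i = 0 ∨ i = 1 := by decide
  have h01 : (0 : ZMod 2) ≠ 1 := by decide
  refine Finset.sum_bij' (fun N _ => (sheet N 0, sheet N 1))
    (fun P _ => P.1.image (fun p => (p, 0)) ∪ P.2.image (fun p => (p, 1))) ?_ ?_ ?_ ?_ ?_
  · intro N hN
    obtain ⟨hE, hN⟩ := mem_liftedMatchings.1 hN
    have : ∀ i, sheet N i ∈ orientedMatchings G A := by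
      intro i
      refine mem_orientedMatchings.2 ⟨fun p hp => hE (p, i) (by simpa [sheet] using hp), ?_⟩
      intro p hp q hq hne
      have h := hN (p, i) (by simpa [sheet] using hp) (q, i) (by simpa [sheet] using hq) hne
      exact ⟨fun h' => h.1 h' rfl, fun h' => h.2 h' rfl⟩
    exact Finset.mem_product.2 ⟨this 0, this 1⟩
  · intro P hP
    obtain ⟨h0, h1⟩ := Finset.mem_product.1 hP
    obtain ⟨hE0, h0⟩ := mem_orientedMatchings.1 h0
    obtain ⟨hE1, h1⟩ := mem_orientedMatchings.1 h1
    refine mem_liftedMatchings.2 ⟨?_, ?_⟩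
    · intro x hx
      rcases Finset.mem_union.1 hx with hx | hx <;> obtain ⟨p, hp, rfl⟩ := Finset.mem_image.1 hx
      · exact hE0 p hp
      · exact hE1 p hp
    · intro x hx y hy hne
      rcases Finset.mem_union.1 hx with hx | hx <;> obtain ⟨p, hp, rfl⟩ := Finset.mem_image.1 hx <;>
        rcases Finset.mem_union.1 hy with hy | hy <;> obtain ⟨q, hq, rfl⟩ := Finset.mem_image.1 hy
      · have := h0 p hp q hq hne
        exact ⟨fun h => absurd h this.1, fun h => absurd h this.2⟩
      · simp
      · simp
      · have := h1 p hp q hq hne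
        exact ⟨fun h => absurd h this.1, fun h => absurd h this.2⟩
  · intro N _
    ext ⟨p, i⟩
    rcases hcover i with rfl | rfl <;> simp [sheet, h01, h01.symm]
  · intro P _
    ext p <;> simp [sheet]
  · intro N _
    rw [← pow_add]
    congr 1
    have hN : N = (sheet N 0).image (fun p => (p, (0 : ZMod 2)))
        ∪ (sheet N 1).image (fun p => (p, (1 : ZMod 2))) := by
      ext ⟨p, i⟩
      rcases hcover i with rfl | rfl <;> simp [sheet, h01, h01.symm]
    conv_lhs => rw [hN]
    rw [Finset.card_union_of_disjoint, Finset.card_image_of_injective,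
      Finset.card_image_of_injective]
    · intro p q h; simpa using h
    · intro p q h; simpa using h
    · refine Finset.disjoint_left.2 fun x hx hx' => ?_
      obtain ⟨p, _, rfl⟩ := Finset.mem_image.1 hx
      obtain ⟨q, _, h⟩ := Finset.mem_image.1 hx'
      simp at h

/-- Switching the sheets of the edges in a set of lifted edges according to `h`. -/
def sheetShift (h : V × V → ZMod 2) (N : Finset ((V × V) × ZMod 2)) :
    Finset ((V × V) × ZMod 2) :=
  N.image fun x => (x.1, x.2 + h x.1)

omit [Fintype V] in
lemma sheetShift_map_injective (h : V × V → ZMod 2) :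
    Function.Injective fun x : (V × V) × ZMod 2 => (x.1, x.2 + h x.1) := by
  rintro ⟨p, i⟩ ⟨q, j⟩ hxy
  simp only [Prod.mk.injEq] at hxy
  obtain ⟨rfl, h2⟩ := hxy
  simpa using h2

omit [Fintype V] in
lemma sheetShift_image_fst (h : V × V → ZMod 2) (N : Finset ((V × V) × ZMod 2)) :
    (sheetShift h N).image Prod.fst = N.image Prod.fst := by
  rw [sheetShift, Finset.image_image]
  rfl

/-- A matching of the cover can be turned into one of the trivial cover by switching sheets: its
projection to `G` has no three edges at a vertex, and is bipartite as `G` is. -/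
lemma exists_sheetShift_mem {G : SimpleGraph V} {A : Set V} {s : V × V → ZMod 2}
    {N : Finset ((V × V) × ZMod 2)} (hN : N ∈ liftedMatchings G A s) :
    ∃ h, sheetShift h N ∈ liftedMatchings G A 0 := by
  obtain ⟨hE, hN⟩ := mem_liftedMatchings.1 hN
  have hdet1 : ∀ p q i j k, (p, i) ∈ N → (p, j) ∈ N → (q, k) ∈ N → p ≠ q → p.1 = q.1 → i = j :=
    fun p q i j k hi hj hk hne h => zmodTwo_not_three
      ((hN _ hi _ hk hne).1 h).symm ((hN _ hj _ hk hne).1 h).symm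
  have hdet2 : ∀ p q i j k, (p, i) ∈ N → (p, j) ∈ N → (q, k) ∈ N → p ≠ q → p.2 = q.2 → i = j :=
    fun p q i j k hi hj hk hne h => add_right_cancel (zmodTwo_not_three
      ((hN _ hi _ hk hne).2 h).symm ((hN _ hj _ hk hne).2 h).symm)
  obtain ⟨g, hg⟩ := exists_two_coloring (N.image Prod.fst) (fun p q => p ≠ q ∧ p.1 = q.1)
    (fun p q => p ≠ q ∧ p.2 = q.2) (fun _ _ h => ⟨h.1.symm, h.2.symm⟩)
    (fun _ _ h => ⟨h.1.symm, h.2.symm⟩) (fun _ h => h.1 rfl) (fun _ _ h => h.1 rfl)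
    (by
      intro p hp q hq r hr hpq hpr
      obtain ⟨⟨p, i⟩, hp', rfl⟩ := Finset.mem_image.1 hp
      obtain ⟨⟨q, j⟩, hq', rfl⟩ := Finset.mem_image.1 hq
      obtain ⟨⟨r, k⟩, hr', rfl⟩ := Finset.mem_image.1 hr
      by_contra hqr
      have h1 := (hN _ hp' _ hq' hpq.1).1 hpq.2
      have h2 := (hN _ hp' _ hr' hpr.1).1 hpr.2
      exact (hN _ hq' _ hr' hqr).1 (hpq.2.symm.trans hpr.2) (zmodTwo_not_three h1 h2))
    (by
      intro p hp q hq r hr hpq hpr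
      obtain ⟨⟨p, i⟩, hp', rfl⟩ := Finset.mem_image.1 hp
      obtain ⟨⟨q, j⟩, hq', rfl⟩ := Finset.mem_image.1 hq
      obtain ⟨⟨r, k⟩, hr', rfl⟩ := Finset.mem_image.1 hr
      by_contra hqr
      have h1 := (hN _ hp' _ hq' hpq.1).2 hpq.2
      have h2 := (hN _ hp' _ hr' hpr.1).2 hpr.2
      exact (hN _ hq' _ hr' hqr).2 (hpq.2.symm.trans hpr.2) (zmodTwo_not_three h1 h2))
  -- the sheet of an edge of the projection; it is unique when the edge meets another one
  let sh : V × V → ZMod 2 := fun p => if hp : ∃ i, (p, i) ∈ N then hp.choose else 0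
  have hsh : ∀ p i, (p, i) ∈ N → (p, sh p) ∈ N := by
    intro p i hp
    have : ∃ i, (p, i) ∈ N := ⟨i, hp⟩
    simp only [sh, dif_pos this]
    exact this.choose_spec
  refine ⟨fun p => g p + sh p, mem_liftedMatchings.2 ⟨?_, ?_⟩⟩
  · intro x hx
    obtain ⟨y, hy, rfl⟩ := Finset.mem_image.1 hx
    exact hE y hy
  · intro x hx y hy hne
    obtain ⟨⟨p, i⟩, hp, rfl⟩ := Finset.mem_image.1 hx
    obtain ⟨⟨q, j⟩, hq, rfl⟩ := Finset.mem_image.1 hy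
    have hpi := Finset.mem_image_of_mem Prod.fst hp
    have hqi := Finset.mem_image_of_mem Prod.fst hq
    have hcancel : ∀ x y : ZMod 2, x + (y + x) = y := by decide
    constructor
    · intro h
      have e1 := hdet1 p q i (sh p) j hp (hsh p i hp) hq hne h
      have e2 := hdet1 q p j (sh q) i hq (hsh q j hq) hp (Ne.symm hne) h.symm
      simp only [← e1, ← e2, hcancel]
      exact hg p hpi q hqi (.inl ⟨hne, h⟩)
    · intro h
      have e1 := hdet2 p q i (sh p) j hp (hsh p i hp) hq hne h
      have e2 := hdet2 q p j (sh q) i hq (hsh q j hq) hp (Ne.symm hne) h.symm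
      simp only [← e1, ← e2, hcancel, Pi.zero_apply, add_zero]
      exact hg p hpi q hqi (.inr ⟨hne, h⟩)

/-- Given the projection to `G`, the matchings of a cover are the solutions of an affine system over
`𝔽₂` whose homogeneous part does not depend on the signs. So a shift that moves one solution to a
solution for the trivial cover moves all of them. -/
lemma sheetShift_mem_of_image_eq {G : SimpleGraph V} {A : Set V} {s h : V × V → ZMod 2}
    {N N' : Finset ((V × V) × ZMod 2)} (hN : N ∈ liftedMatchings G A s)
    (hN' : N' ∈ liftedMatchings G A s) (hNN' : N.image Prod.fst = N'.image Prod.fst)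
    (hsh : sheetShift h N' ∈ liftedMatchings G A 0) :
    sheetShift h N ∈ liftedMatchings G A 0 := by
  obtain ⟨hE, hN⟩ := mem_liftedMatchings.1 hN
  obtain ⟨_, hN'⟩ := mem_liftedMatchings.1 hN'
  obtain ⟨_, hsh⟩ := mem_liftedMatchings.1 hsh
  have hex : ∀ p i, (p, i) ∈ N → ∃ k, (p, k) ∈ N' := by
    intro p i hp
    have hp := Finset.mem_image_of_mem Prod.fst hp
    rw [hNN'] at hp
    obtain ⟨⟨q, k⟩, hq, rfl⟩ := Finset.mem_image.1 hp
    exact ⟨k, hq⟩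
  refine mem_liftedMatchings.2 ⟨?_, ?_⟩
  · intro x hx
    obtain ⟨y, hy, rfl⟩ := Finset.mem_image.1 hx
    exact hE y hy
  · intro x hx y hy hne
    obtain ⟨⟨p, i⟩, hp, rfl⟩ := Finset.mem_image.1 hx
    obtain ⟨⟨q, j⟩, hq, rfl⟩ := Finset.mem_image.1 hy
    obtain ⟨i', hp'⟩ := hex p i hp
    obtain ⟨j', hq'⟩ := hex q j hq
    have h1 := hN _ hp _ hq hne
    have h2 := hN' _ hp' _ hq' hne
    have h3 := hsh _ (Finset.mem_image_of_mem _ hp') _ (Finset.mem_image_of_mem _ hq') hne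
    simp only [Pi.zero_apply, add_zero] at h3 ⊢
    have hlin1 : ∀ i j i' j' a b : ZMod 2, i ≠ j → i' ≠ j' → i' + a ≠ j' + b → i + a ≠ j + b := by
      decide
    have hlin2 : ∀ i j i' j' a b c d : ZMod 2, i + c ≠ j + d → i' + c ≠ j' + d →
        i' + a ≠ j' + b → i + a ≠ j + b := by
      decide
    exact ⟨fun h => hlin1 _ _ _ _ _ _ (h1.1 h) (h2.1 h) (h3.1 h),
      fun h => hlin2 _ _ _ _ _ _ _ _ (h1.2 h) (h2.2 h) (h3.2 h)⟩

/-- A two-fold cover of a bipartite graph has at most as many matchings as the trivial one. -/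
theorem matchingGen_twoLift_le {G : SimpleGraph V} {A : Set V} (hA : IsBipartition G A)
    (s : Sym2 V → ZMod 2) {t : ℝ} (ht : 0 ≤ t) :
    matchingGen (twoLift G s) t ≤ matchingGen G t ^ 2 := by
  rw [matchingGen_twoLift hA, ← matchingGen_sq hA]
  set s' : V × V → ZMod 2 := fun p => s s(p.1, p.2)
  have hex : ∀ K : Finset (V × V), ∃ h : V × V → ZMod 2, ∀ N ∈ liftedMatchings G A s',
      N.image Prod.fst = K → sheetShift h N ∈ liftedMatchings G A 0 := by
    intro K
    by_cases hK : ∃ N ∈ liftedMatchings G A s', N.image Prod.fst = K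
    · obtain ⟨N', hN', rfl⟩ := hK
      obtain ⟨h, hh⟩ := exists_sheetShift_mem hN'
      exact ⟨h, fun N hN hNN' => sheetShift_mem_of_image_eq hN hN' hNN' hh⟩
    · exact ⟨0, fun N hN h => (hK ⟨N, hN, h⟩).elim⟩
  choose h hh using hex
  set T : Finset ((V × V) × ZMod 2) → Finset ((V × V) × ZMod 2) := fun N =>
    sheetShift (h (N.image Prod.fst)) N with hT
  have hinj : Set.InjOn T (liftedMatchings G A s') := by
    intro N _ N' _ hNN'
    have h1 : N.image Prod.fst = N'.image Prod.fst := by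
      have := congrArg (Finset.image Prod.fst) hNN'
      simpa only [hT, sheetShift_image_fst] using this
    simp only [hT, h1] at hNN'
    exact Finset.image_injective (sheetShift_map_injective _) hNN'
  have hcard : ∀ N, (T N).card = N.card := fun N =>
    Finset.card_image_of_injective _ (sheetShift_map_injective _)
  calc ∑ N ∈ liftedMatchings G A s', t ^ N.card
      = ∑ N ∈ (liftedMatchings G A s').image T, t ^ N.card := by
        rw [Finset.sum_image hinj]
        exact Finset.sum_congr rfl fun N _ => by rw [hcard]
    _ ≤ _ := by
        refine Finset.sum_le_sum_of_subset_of_nonneg ?_ fun N _ _ => by positivity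
        intro N hN
        obtain ⟨N, hN', rfl⟩ := Finset.mem_image.1 hN
        exact hh _ N hN' rfl

end TwoLift

/-! ### Covers without short cycles -/

section Girth

variable {V : Type u} {W : Type v}

/-- `f 0, …, f n` is a walk of `G` that never turns back immediately. -/
def IsNonBacktracking (G : SimpleGraph V) (f : ℕ → V) (n : ℕ) : Prop :=
  (∀ i < n, G.Adj (f i) (f (i + 1))) ∧ ∀ i, i + 2 ≤ n → f i ≠ f (i + 2)

/-- `G` has no closed non-backtracking walk of length between `1` and `g`. The walk may turn back at
its end point, but a shortest such walk is a cycle, so that this says that the girth exceeds `g`. -/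
def NoShortCycles (G : SimpleGraph V) (g : ℕ) : Prop :=
  ∀ (f : ℕ → V) (n : ℕ), 0 < n → n ≤ g → IsNonBacktracking G f n → f 0 ≠ f n

lemma NoShortCycles.mono {G : SimpleGraph V} {g h : ℕ} (hG : NoShortCycles G h) (hgh : g ≤ h) :
    NoShortCycles G g :=
  fun f n h0 hn => hG f n h0 (hn.trans hgh)

lemma IsNonBacktracking.shift {G : SimpleGraph V} {f : ℕ → V} {n : ℕ}
    (hf : IsNonBacktracking G f n) {k m : ℕ} (h : k + m ≤ n) :
    IsNonBacktracking G (fun i => f (k + i)) m :=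
  ⟨fun i hi => hf.1 (k + i) (by omega), fun i hi => hf.2 (k + i) (by omega)⟩

lemma NoShortCycles.ne {G : SimpleGraph V} {g : ℕ} (hG : NoShortCycles G g) {f : ℕ → V} {n : ℕ}
    (hf : IsNonBacktracking G f n) {i j : ℕ} (hij : i < j) (hj : j ≤ n) (hg : j - i ≤ g) :
    f i ≠ f j := by
  have := hG _ (j - i) (by omega) hg (hf.shift (k := i) (by omega))
  simpa [Nat.add_sub_cancel' hij.le] using this

/-- In a graph without short cycles, short non-backtracking walks are determined by their end
points. -/
lemma NoShortCycles.walk_unique {G : SimpleGraph V} {g : ℕ} (hG : NoShortCycles G g)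
    {f f' : ℕ → V} (h0 : f 0 = f' 0) {n m : ℕ} (hf : IsNonBacktracking G f n)
    (hf' : IsNonBacktracking G f' m) (hend : f n = f' m) (hnm : n + m ≤ g) :
    n = m ∧ ∀ k ≤ n, f k = f' k := by
  induction n generalizing m with
  | zero =>
    rcases Nat.eq_zero_or_pos m with rfl | hm
    · exact ⟨rfl, fun k hk => by rw [Nat.le_zero.1 hk, h0]⟩
    · exact absurd (h0.symm.trans hend) (hG f' m hm (by omega) hf')
  | succ n ih =>
    rcases m with _ | m
    · exact absurd (h0.trans hend.symm) (hG f (n + 1) (by omega) (by omega) hf)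
    by_cases hpen : f n = f' m
    · obtain ⟨rfl, h⟩ := ih ⟨fun i hi => hf.1 i (by omega), fun i hi => hf.2 i (by omega)⟩
        ⟨fun i hi => hf'.1 i (by omega), fun i hi => hf'.2 i (by omega)⟩ hpen (by omega)
      refine ⟨rfl, fun k hk => ?_⟩
      rcases hk.eq_or_lt with rfl | hk
      · exact hend
      · exact h k (by omega)
    · -- `f` followed by the reverse of `f'` is closed and does not turn back where they meet
      exfalso
      set w : ℕ → V := fun k => if k ≤ n then f k else f' (n + m + 2 - k) with hw
      have hw1 : ∀ k, k ≤ n + 1 → w k = f k := by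
        intro k hk
        rcases hk.eq_or_lt with rfl | hk
        · simp only [hw, Nat.not_succ_le_self, if_false]
          rw [hend]; congr 1; omega
        · simp only [hw, if_pos (Nat.lt_succ_iff.1 hk)]
      have hw2 : ∀ k, n + 1 ≤ k → w k = f' (n + m + 2 - k) := by
        intro k hk
        simp only [hw, if_neg (by omega : ¬ k ≤ n)]
      refine hG w (n + m + 2) (by omega) (by omega) ⟨?_, ?_⟩ ?_
      · intro i hi
        rcases Nat.lt_or_ge i (n + 1) with h | h
        · rw [hw1 i h.le, hw1 (i + 1) h]; exact hf.1 i h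
        · rw [hw2 i h, hw2 (i + 1) (by omega)]
          have := hf'.1 (n + m + 2 - (i + 1)) (by omega)
          rw [show n + m + 2 - (i + 1) + 1 = n + m + 2 - i by omega] at this
          exact this.symm
      · intro i hi
        rcases Nat.lt_or_ge n i with h | h
        · rw [hw2 i h, hw2 (i + 2) (by omega)]
          have := hf'.2 (n + m + 2 - (i + 2)) (by omega)
          rw [show n + m + 2 - (i + 2) + 2 = n + m + 2 - i by omega] at this
          exact this.symm
        · rcases h.eq_or_lt with rfl | h
          · rw [hw1 i (by omega), hw2 (i + 2) (by omega), show i + m + 2 - (i + 2) = m by omega]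
            exact hpen
          · rw [hw1 i (by omega), hw1 (i + 2) (by omega)]
            exact hf.2 i (by omega)
      · rw [hw1 0 (by omega), hw2 _ (by omega), Nat.sub_self, h0]

/-- `π` is a covering map of graphs: it maps the neighbours of `x` bijectively to those of `π x`. -/
def IsCovering (H : SimpleGraph W) (G : SimpleGraph V) (π : W → V) : Prop :=
  (∀ x y, H.Adj x y → G.Adj (π x) (π y)) ∧ ∀ x v, G.Adj (π x) v → ∃! y, H.Adj x y ∧ π y = v

lemma IsCovering.comp {X : Type w} {K : SimpleGraph X} {H : SimpleGraph W} {G : SimpleGraph V}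
    {π : W → V} {ρ : X → W} (hπ : IsCovering H G π) (hρ : IsCovering K H ρ) :
    IsCovering K G (π ∘ ρ) := by
  refine ⟨fun x y h => hπ.1 _ _ (hρ.1 _ _ h), fun x v h => ?_⟩
  obtain ⟨y, ⟨hy, rfl⟩, hy'⟩ := hπ.2 _ _ h
  obtain ⟨z, ⟨hz, rfl⟩, hz'⟩ := hρ.2 _ _ hy
  refine ⟨z, ⟨hz, rfl⟩, fun z' h' => hz' z' ⟨h'.1, hy' _ ⟨hρ.1 _ _ h'.1, h'.2⟩⟩⟩

lemma IsCovering.id (G : SimpleGraph V) : IsCovering G G _root_.id :=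
  ⟨fun _ _ h => h, fun _ v h => ⟨v, ⟨h, rfl⟩, fun _ h' => h'.2⟩⟩

lemma isCovering_twoLift (G : SimpleGraph V) (s : Sym2 V → ZMod 2) :
    IsCovering (twoLift G s) G Prod.fst := by
  refine ⟨fun x y h => h.1, fun x v h => ⟨(v, x.2 + s s(x.1, v)), ⟨⟨h, rfl⟩, rfl⟩, ?_⟩⟩
  rintro ⟨y, j⟩ ⟨⟨_, h2⟩, rfl⟩
  exact Prod.ext rfl h2

lemma IsCovering.ncard_neighborSet {H : SimpleGraph W} {G : SimpleGraph V} {π : W → V}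
    (hπ : IsCovering H G π) (x : W) : (H.neighborSet x).ncard = (G.neighborSet (π x)).ncard := by
  have h1 : G.neighborSet (π x) = π '' H.neighborSet x := by
    ext v
    constructor
    · intro hv
      obtain ⟨y, ⟨hy, rfl⟩, _⟩ := hπ.2 x v hv
      exact ⟨y, hy, rfl⟩
    · rintro ⟨y, hy, rfl⟩
      exact hπ.1 _ _ hy
  have h2 : Set.InjOn π (H.neighborSet x) := fun y hy z hz h =>
    (hπ.2 x _ (hπ.1 _ _ hy)).unique ⟨hy, rfl⟩ ⟨hz, h.symm⟩
  rw [h1, h2.ncard_image]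

lemma IsCovering.isNonBacktracking {H : SimpleGraph W} {G : SimpleGraph V} {π : W → V}
    (hπ : IsCovering H G π) {f : ℕ → W} {n : ℕ} (hf : IsNonBacktracking H f n) :
    IsNonBacktracking G (π ∘ f) n := by
  refine ⟨fun i hi => hπ.1 _ _ (hf.1 i hi), fun i hi h => hf.2 i hi ?_⟩
  have h1 := hf.1 i (by omega)
  have h2 := hf.1 (i + 1) (by omega)
  exact (hπ.2 (f (i + 1)) _ (hπ.1 _ _ h1.symm)).unique ⟨h1.symm, rfl⟩ ⟨h2, h.symm⟩

lemma IsCovering.isBiregularBipartite {H : SimpleGraph W} {G : SimpleGraph V} {π : W → V}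
    (hπ : IsCovering H G π) {a b : ℕ} (hG : IsBiregularBipartite G a b) :
    IsBiregularBipartite H a b := by
  obtain ⟨A, B, hAB, hu, hA, hB⟩ := hG
  refine ⟨π ⁻¹' A, π ⁻¹' B, ⟨hAB.disjoint.preimage π, fun {x y} h => ?_⟩, ?_, ?_, ?_⟩
  · exact hAB.mem_of_adj (hπ.1 _ _ h)
  · rw [← Set.preimage_union, hu, Set.preimage_univ]
  · intro x hx
    rw [hπ.ncard_neighborSet]; exact hA _ hx
  · intro x hx
    rw [hπ.ncard_neighborSet]; exact hB _ hx

lemma IsBiregularBipartite.exists_isBipartition {G : SimpleGraph V} {a b : ℕ}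
    (hG : IsBiregularBipartite G a b) : ∃ A, IsBipartition G A := by
  obtain ⟨A, B, hAB, -, -, -⟩ := hG
  refine ⟨A, fun u v huv => ?_⟩
  have hd := Set.disjoint_left.1 hAB.disjoint
  rcases hAB.mem_of_adj huv with ⟨h1, h2⟩ | ⟨h1, h2⟩
  · exact ⟨fun _ h => hd h h2, fun _ => h1⟩
  · exact ⟨fun h => absurd h1 (hd h), fun h => absurd h2 h⟩

lemma pressure_twoLift_le [Fintype V] [Nonempty V] {G : SimpleGraph V} {A : Set V}
    (hA : IsBipartition G A) (s : Sym2 V → ZMod 2) {t : ℝ} (ht : 0 ≤ t) :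
    pressure (twoLift G s) t ≤ pressure G t := by
  have hV : (0 : ℝ) < Fintype.card V := by exact_mod_cast Fintype.card_pos
  have h := Real.log_le_log (matchingGen_pos _ ht) (matchingGen_twoLift_le hA s ht)
  rw [Real.log_pow] at h
  unfold pressure
  rw [Fintype.card_prod, ZMod.card, div_le_div_iff₀ (by positivity) hV]
  push_cast at h ⊢
  nlinarith

/-- Iterating two-fold covers, one for each edge in `E`: there is a cover of `G`, of pressure at
most that of `G`, whose closed walks project to walks using each edge in `E` an even number of
times. -/
lemma exists_cover_even {V : Type} [Fintype V] [Nonempty V] {G : SimpleGraph V} {A : Set V}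
    (hA : IsBipartition G A) (E : Finset (Sym2 V)) :
    ∃ (H : FiniteGraph) (π : H.V → V), IsCovering H.graph G π ∧
      (∀ t, 0 ≤ t → pressure H.graph t ≤ pressure G t) ∧
      ∀ e ∈ E, ∀ (f : ℕ → H.V) (n : ℕ), (∀ i < n, H.graph.Adj (f i) (f (i + 1))) → f 0 = f n →
        ∑ i ∈ Finset.range n, (if s(π (f i), π (f (i + 1))) = e then (1 : ZMod 2) else 0) = 0 := by
  induction E using Finset.induction_on with
  | empty => exact ⟨⟨V, G⟩, id, IsCovering.id G, fun _ _ => le_rfl, by simp⟩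
  | insert e E _ ih =>
    obtain ⟨H, π, hπ, hp, hE⟩ := ih
    set s : Sym2 H.V → ZMod 2 := fun x => if x.map π = e then 1 else 0 with hs
    have hcov := isCovering_twoLift H.graph s
    have hbip : IsBipartition H.graph (π ⁻¹' A) := fun x y h => hA _ _ (hπ.1 _ _ h)
    refine ⟨⟨H.V × ZMod 2, twoLift H.graph s⟩, π ∘ Prod.fst, hπ.comp hcov,
      fun t ht => (pressure_twoLift_le hbip s ht).trans (hp t ht), ?_⟩
    intro e' he' f n hf h0
    rcases Finset.mem_insert.1 he' with rfl | he'
    · have hsheet : ∀ m ≤ n, (f m).2 = (f 0).2 + ∑ i ∈ Finset.range m,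
          (if s(π (f i).1, π (f (i + 1)).1) = e' then (1 : ZMod 2) else 0) := by
        intro m
        induction m with
        | zero => simp
        | succ m ihm =>
          intro hm
          rw [(hf m hm).2, ihm (by omega), Finset.sum_range_succ, add_assoc]
          simp only [hs, Sym2.map_mk]
          congr
      have := hsheet n le_rfl
      rw [← h0] at this
      exact (left_eq_add.1 this)
    · exact hE e' he' (fun i => (f i).1) n (fun i hi => hcov.1 _ _ (hf i hi))
        (congrArg Prod.fst h0)

/-- Such a cover, for all edges of `G`, has larger girth: a closed walk along a shortest cycle uses
its first edge only once. -/
lemma exists_cover_noShortCycles_succ {V : Type} [Fintype V] [Nonempty V] {G : SimpleGraph V}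
    {A : Set V} (hA : IsBipartition G A) {g : ℕ} (hg : NoShortCycles G g) :
    ∃ (H : FiniteGraph) (π : H.V → V), IsCovering H.graph G π ∧
      (∀ t, 0 ≤ t → pressure H.graph t ≤ pressure G t) ∧ NoShortCycles H.graph (g + 1) := by
  obtain ⟨H, π, hπ, hp, hE⟩ := exists_cover_even hA Finset.univ
  refine ⟨H, π, hπ, hp, fun f n hn hng hf h0 => ?_⟩
  have hnb := hπ.isNonBacktracking hf
  rcases hng.eq_or_lt with rfl | hlt
  swap
  · exact hg _ n hn (by omega) hnb (congrArg π h0)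
  have hsum := hE s(π (f 0), π (f 1)) (Finset.mem_univ _) f (g + 1) hf.1 h0
  rw [Finset.sum_eq_single_of_mem 0 (by simp)] at hsum
  · simp at hsum
  · intro i hi hi0
    rw [Finset.mem_range] at hi
    refine if_neg fun h => ?_
    rcases Sym2.eq_iff.1 h with ⟨h1, _⟩ | ⟨h1, h2⟩
    · exact hg.ne hnb (Nat.pos_of_ne_zero hi0) hi.le (by omega) h1.symm
    · by_cases hi1 : i = 1
      · subst hi1
        exact hnb.2 0 (by omega) h2.symm
      · exact hg.ne hnb (by omega : 1 < i) hi.le (by omega) h1.symm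

/-- Every finite bipartite graph has covers of arbitrarily large girth whose pressure is at most
that of the graph. -/
theorem exists_cover_noShortCycles {V : Type} [Fintype V] [Nonempty V] {G : SimpleGraph V}
    {A : Set V} (hA : IsBipartition G A) (g : ℕ) :
    ∃ (H : FiniteGraph) (π : H.V → V), IsCovering H.graph G π ∧
      (∀ t, 0 ≤ t → pressure H.graph t ≤ pressure G t) ∧ NoShortCycles H.graph g := by
  induction g with
  | zero =>
    exact ⟨⟨V, G⟩, id, IsCovering.id G, fun _ _ => le_rfl, fun f n h0 hn => by omega⟩
  | succ g ih =>
    obtain ⟨H, π, hπ, hp, hH⟩ := ih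
    have hbip : IsBipartition H.graph (π ⁻¹' A) := fun x y h => hA _ _ (hπ.1 _ _ h)
    obtain ⟨K, ρ, hρ, hp', hK⟩ := exists_cover_noShortCycles_succ hbip hH
    exact ⟨K, π ∘ ρ, hπ.comp hρ, fun t ht => (hp' t ht).trans (hp t ht), hK⟩

end Girth

/-! ### Biregular graphs of large girth -/

section Biregular

variable {V : Type u} [Fintype V]

/-- `G` is `(a,b)`-biregular with respect to the finite vertex classes `A` and `B`. -/
structure IsBiregularWith (G : SimpleGraph V) (A B : Finset V) (a b : ℕ) : Prop where
  disjoint : Disjoint A B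
  mem_or : ∀ v, v ∈ A ∨ v ∈ B
  adj_left : ∀ v ∈ A, ∀ u, G.Adj v u → u ∈ B
  adj_right : ∀ v ∈ B, ∀ u, G.Adj v u → u ∈ A
  card_left : ∀ v ∈ A, (Finset.univ.filter (G.Adj v)).card = a
  card_right : ∀ v ∈ B, (Finset.univ.filter (G.Adj v)).card = b

variable {G : SimpleGraph V} {A B : Finset V} {a b : ℕ}

lemma IsBiregularWith.symm (h : IsBiregularWith G A B a b) : IsBiregularWith G B A b a :=
  ⟨h.disjoint.symm, fun v => (h.mem_or v).symm, h.adj_right, h.adj_left, h.card_right, h.card_left⟩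

lemma IsBiregularBipartite.exists_with (h : IsBiregularBipartite G a b) :
    ∃ A B : Finset V, IsBiregularWith G A B a b := by
  obtain ⟨A, B, hAB, hu, hA, hB⟩ := h
  have hd := Set.disjoint_left.1 hAB.disjoint
  have hcard : ∀ v, (Finset.univ.filter (G.Adj v)).card = (G.neighborSet v).ncard := by
    intro v
    rw [← Set.ncard_coe_finset]
    congr 1; ext u; simp
  refine ⟨A.toFinset, B.toFinset, ?_, ?_, ?_, ?_, ?_, ?_⟩
  · rw [Set.disjoint_toFinset]; exact hAB.disjoint
  · intro v
    have : v ∈ A ∪ B := hu ▸ Set.mem_univ v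
    simpa using this
  · intro v hv u huv
    rw [Set.mem_toFinset] at hv ⊢
    rcases hAB.mem_of_adj huv with h | h
    · exact h.2
    · exact absurd h.1 (hd hv)
  · intro v hv u huv
    rw [Set.mem_toFinset] at hv ⊢
    rcases hAB.mem_of_adj huv with h | h
    · exact absurd hv (hd h.1)
    · exact h.2
  · intro v hv
    rw [hcard]; exact hA v (Set.mem_toFinset.1 hv)
  · intro v hv
    rw [hcard]; exact hB v (Set.mem_toFinset.1 hv)

lemma IsBiregularWith.card_add (h : IsBiregularWith G A B a b) :
    A.card + B.card = Fintype.card V := by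
  rw [← Finset.card_union_of_disjoint h.disjoint, ← Finset.card_univ]
  congr 1
  ext v
  simpa using h.mem_or v

lemma IsBiregularWith.card_mul (h : IsBiregularWith G A B a b) : A.card * a = B.card * b := by
  refine Finset.card_mul_eq_card_mul G.Adj (fun v hv => ?_) fun v hv => ?_
  · rw [← h.card_left v hv]
    congr 1
    ext u
    simp only [Finset.mem_bipartiteAbove, Finset.mem_filter, Finset.mem_univ, true_and]
    exact ⟨fun h' => h'.2, fun h' => ⟨h.adj_left v hv u h', h'⟩⟩
  · rw [← h.card_right v hv]
    congr 1
    ext u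
    simp only [Finset.mem_bipartiteBelow, Finset.mem_filter, Finset.mem_univ, true_and]
    exact ⟨fun h' => h'.2.symm, fun h' => ⟨h.adj_right v hv u h', h'.symm⟩⟩

lemma IsBiregularWith.card_left_div [Nonempty V] (h : IsBiregularWith G A B a b) (ha : 0 < a) :
    (A.card : ℝ) / Fintype.card V = b / (a + b) := by
  have hV : (0 : ℝ) < Fintype.card V := by exact_mod_cast Fintype.card_pos
  have ha' : (0 : ℝ) < a := by exact_mod_cast ha
  have h1 : (A.card : ℝ) + B.card = Fintype.card V := by exact_mod_cast h.card_add
  have h2 : (A.card : ℝ) * a = B.card * b := by exact_mod_cast h.card_mul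
  rw [div_eq_div_iff hV.ne' (by positivity), ← h1]
  linarith

/-- By Hall's theorem there is a matching covering the smaller class. -/
lemma IsBiregularWith.card_le_matchingNumber (h : IsBiregularWith G A B a b) (hba : b ≤ a)
    (ha : 0 < a) : A.card ≤ matchingNumber G := by
  obtain ⟨f, hf, hf'⟩ := (Finset.all_card_le_biUnion_card_iff_exists_injective
    (fun x : A => Finset.univ.filter (G.Adj x.1))).1 (by
      intro s
      have := Finset.card_mul_le_card_mul (s := s)
        (t := s.biUnion fun x => Finset.univ.filter (G.Adj x.1)) (m := a) (n := b)
        (fun x y => G.Adj x.1 y) (fun x hx => ?_) (fun y hy => ?_)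
      · exact Nat.le_of_mul_le_mul_right (this.trans (Nat.mul_le_mul_left _ hba)) ha
      · rw [← h.card_left x.1 x.2]
        refine Finset.card_le_card fun u hu => ?_
        rw [Finset.mem_bipartiteAbove, Finset.mem_biUnion]
        exact ⟨⟨x, hx, hu⟩, (Finset.mem_filter.1 hu).2⟩
      · obtain ⟨x, hx, hxy⟩ := Finset.mem_biUnion.1 hy
        have hyB : y ∈ B := h.adj_left x.1 x.2 y (Finset.mem_filter.1 hxy).2
        rw [← h.card_right y hyB, ← Finset.card_map (Function.Embedding.subtype _)]
        refine Finset.card_le_card fun u hu => ?_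
        obtain ⟨z, hz, rfl⟩ := Finset.mem_map.1 hu
        rw [Finset.mem_bipartiteBelow] at hz
        simpa using hz.2.symm)
  have hadj : ∀ x : A, G.Adj x.1 (f x) := fun x => (Finset.mem_filter.1 (hf' x)).2
  have hne : ∀ x y : A, x.1 ≠ f y := fun x y hxy =>
    Finset.disjoint_left.1 h.disjoint x.2 (hxy ▸ h.adj_left _ y.2 _ (hadj y))
  have hinj : Function.Injective fun x : A => s(x.1, f x) := by
    intro x y hxy
    rcases Sym2.eq_iff.1 hxy with h' | h'
    · exact Subtype.ext h'.1
    · exact (hne _ _ h'.1).elim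
  have hM : IsEdgeMatching G (Finset.univ.image fun x : A => s(x.1, f x)) := by
    constructor
    · intro e he
      obtain ⟨x, _, rfl⟩ := Finset.mem_image.1 he
      exact hadj x
    · intro e he e' he' hee v hv
      obtain ⟨x, _, rfl⟩ := Finset.mem_image.1 he
      obtain ⟨y, _, rfl⟩ := Finset.mem_image.1 he'
      have hxy : x ≠ y := by rintro rfl; exact hee rfl
      rcases Sym2.mem_iff.1 hv.1 with h1 | h1 <;> rcases Sym2.mem_iff.1 hv.2 with h2 | h2
      · exact hxy (Subtype.ext (h1.symm.trans h2))
      · exact hne x y (h1.symm.trans h2)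
      · exact hne y x (h2.symm.trans h1)
      · exact hxy (hf (h1.symm.trans h2))
  have := MonomerDimer.card_le_matchingNumber G hM
  rwa [Finset.card_image_of_injective _ hinj, Finset.card_univ, Fintype.card_coe] at this

lemma biregularEnd_le_pStar [Nonempty V] (ha : 0 < a) (hb : 0 < b)
    (hG : IsBiregularBipartite G a b) : biregularEnd a b ≤ pStar G := by
  have hV : (0 : ℝ) < Fintype.card V := by exact_mod_cast Fintype.card_pos
  obtain ⟨A, B, h⟩ := hG.exists_with
  unfold biregularEnd pStar
  rcases le_total b a with hba | hab
  · refine (min_le_right _ _).trans ?_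
    have h1 : (A.card : ℝ) ≤ matchingNumber G := by
      exact_mod_cast h.card_le_matchingNumber hba ha
    rw [mul_div_assoc, ← h.card_left_div ha, mul_div_assoc]
    gcongr
  · refine (min_le_left _ _).trans ?_
    have h1 : (B.card : ℝ) ≤ matchingNumber G := by
      exact_mod_cast h.symm.card_le_matchingNumber hab hb
    rw [mul_div_assoc, add_comm, ← h.symm.card_left_div hb, mul_div_assoc]
    gcongr

end Biregular

/-! ### Balls of biregular graphs of large girth -/

section Unfold

variable {V : Type u} [Fintype V]

/-- The vertex of `G` reached by following a word of the biregular tree from `v`, together with the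
set of its predecessor: the letter `c` leads to the `c`-th neighbour that is not the predecessor.
The default value of `getD` plays no role for tree words. -/
def unfoldTree (G : SimpleGraph V) (v : V) : List ℕ → V × Finset V
  | [] => (v, ∅)
  | c :: l => ((Finset.univ.filter (G.Adj (unfoldTree G v l).1)
      \ (unfoldTree G v l).2).toList.getD c v, {(unfoldTree G v l).1})

/-- The neighbours of the end of the walk `l`, except for the predecessor. -/
def unfoldChildren (G : SimpleGraph V) (v : V) (l : List ℕ) : Finset V :=
  Finset.univ.filter (G.Adj (unfoldTree G v l).1) \ (unfoldTree G v l).2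

variable {G : SimpleGraph V} {A B : Finset V} {a b : ℕ} {v : V}

lemma unfoldTree_cons_mem {l : List ℕ} {c : ℕ} (hc : c < (unfoldChildren G v l).card) :
    (unfoldTree G v (c :: l)).1 ∈ unfoldChildren G v l := by
  have hc' : c < (unfoldChildren G v l).toList.length := by rwa [Finset.length_toList]
  change (unfoldChildren G v l).toList.getD c v ∈ _
  rw [List.getD_eq_getElem _ _ hc', ← Finset.mem_toList]
  exact List.getElem_mem hc'

lemma unfoldTree_cons_inj {l : List ℕ} {c c' : ℕ} (hc : c < (unfoldChildren G v l).card)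
    (hc' : c' < (unfoldChildren G v l).card)
    (h : (unfoldTree G v (c :: l)).1 = (unfoldTree G v (c' :: l)).1) : c = c' := by
  rw [← Finset.length_toList] at hc hc'
  change (unfoldChildren G v l).toList.getD c v = (unfoldChildren G v l).toList.getD c' v at h
  rw [List.getD_eq_getElem _ _ hc, List.getD_eq_getElem _ _ hc'] at h
  exact (Finset.nodup_toList _).getElem_inj_iff.1 h

lemma exists_of_mem_unfoldChildren {l : List ℕ} {u : V} (hu : u ∈ unfoldChildren G v l) :
    ∃ c < (unfoldChildren G v l).card, u = (unfoldTree G v (c :: l)).1 := by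
  obtain ⟨c, hc, rfl⟩ := List.mem_iff_getElem.1 (Finset.mem_toList.2 hu)
  refine ⟨c, by rwa [Finset.length_toList] at hc, ?_⟩
  exact (List.getD_eq_getElem _ v hc).symm

/-- The unfolding alternates between the classes, and has the branching numbers of the tree. -/
lemma unfoldTree_spec (h : IsBiregularWith G A B a b) (hv : v ∈ A) {l : List ℕ}
    (hl : IsTreeWord a b l) :
    (Even l.length → (unfoldTree G v l).1 ∈ A) ∧ (¬ Even l.length → (unfoldTree G v l).1 ∈ B) ∧
      (∀ w ∈ (unfoldTree G v l).2, G.Adj (unfoldTree G v l).1 w) ∧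
      (unfoldChildren G v l).card = numChildren a b l.length := by
  induction l with
  | nil =>
    refine ⟨fun _ => hv, fun h => absurd (by simp) h, by simp [unfoldTree], ?_⟩
    simp only [unfoldChildren, unfoldTree, numChildren, List.length_nil, if_true,
      Finset.sdiff_empty]
    exact h.card_left v hv
  | cons c l ih =>
    obtain ⟨ihA, ihB, -, ihc⟩ := ih hl.2
    have hmem := unfoldTree_cons_mem (G := G) (v := v) (ihc.symm ▸ hl.1)
    have hadj : G.Adj (unfoldTree G v l).1 (unfoldTree G v (c :: l)).1 :=
      (Finset.mem_filter.1 (Finset.mem_sdiff.1 hmem).1).2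
    have hA : Even (c :: l).length → (unfoldTree G v (c :: l)).1 ∈ A := by
      intro he
      rw [List.length_cons, Nat.even_add_one] at he
      exact h.adj_right _ (ihB he) _ hadj
    have hB : ¬ Even (c :: l).length → (unfoldTree G v (c :: l)).1 ∈ B := by
      intro he
      rw [List.length_cons, Nat.even_add_one, not_not] at he
      exact h.adj_left _ (ihA he) _ hadj
    have hexcl : (unfoldTree G v (c :: l)).2 = {(unfoldTree G v l).1} := rfl
    refine ⟨hA, hB, ?_, ?_⟩
    · intro w hw
      rw [hexcl, Finset.mem_singleton] at hw
      exact hw ▸ hadj.symm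
    · rw [unfoldChildren, hexcl, Finset.card_sdiff_of_subset, Finset.card_singleton, numChildren,
        if_neg (by simp)]
      · split_ifs with he
        · rw [h.card_left _ (hA he)]
        · rw [h.card_right _ (hB he)]
      · simpa using hadj.symm

lemma unfoldTree_adj_iff (h : IsBiregularWith G A B a b) (hv : v ∈ A) {l : List ℕ}
    (hl : IsTreeWord a b l) (u : V) : G.Adj (unfoldTree G v l).1 u ↔
      (∃ c < numChildren a b l.length, u = (unfoldTree G v (c :: l)).1) ∨
        ∃ c l', l = c :: l' ∧ u = (unfoldTree G v l').1 := by
  obtain ⟨-, -, hexcl, hcard⟩ := unfoldTree_spec h hv hl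
  constructor
  · intro hu
    by_cases hmem : u ∈ (unfoldTree G v l).2
    · right
      rcases l with _ | ⟨c, l⟩
      · simp [unfoldTree] at hmem
      · exact ⟨c, l, rfl, by simpa [unfoldTree] using hmem⟩
    · left
      rw [← hcard]
      exact exists_of_mem_unfoldChildren
        (Finset.mem_sdiff.2 ⟨Finset.mem_filter.2 ⟨Finset.mem_univ _, hu⟩, hmem⟩)
  · rintro (⟨c, hc, rfl⟩ | ⟨c, l', rfl, rfl⟩)
    · rw [← hcard] at hc
      exact (Finset.mem_filter.1 (Finset.mem_sdiff.1 (unfoldTree_cons_mem hc)).1).2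
    · exact hexcl _ (by simp [unfoldTree])

/-- A tree word is followed along a non-backtracking walk. -/
lemma unfoldTree_isNonBacktracking (h : IsBiregularWith G A B a b) (hv : v ∈ A) {l : List ℕ}
    (hl : IsTreeWord a b l) :
    IsNonBacktracking G (fun k => (unfoldTree G v (l.drop (l.length - k))).1) l.length := by
  have hsuf : ∀ k, IsTreeWord a b (l.drop k) := fun k => hl.of_suffix (List.drop_suffix _ _)
  constructor
  · intro i hi
    have h1 : l.length - (i + 1) < l.length := by omega
    have h2 := List.drop_eq_getElem_cons h1
    rw [show l.length - (i + 1) + 1 = l.length - i by omega] at h2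
    exact (unfoldTree_adj_iff h hv (hsuf _) _).2 (.inl ⟨_, (h2 ▸ hsuf _ :
      IsTreeWord a b (l[l.length - (i + 1)] :: l.drop (l.length - i))).1, by simp only [h2]⟩)
  · intro i hi heq
    have h1 : l.length - (i + 2) < l.length := by omega
    have h2 := List.drop_eq_getElem_cons h1
    rw [show l.length - (i + 2) + 1 = l.length - (i + 1) by omega] at h2
    have h3 : l.length - (i + 1) < l.length := by omega
    have h4 := List.drop_eq_getElem_cons h3
    rw [show l.length - (i + 1) + 1 = l.length - i by omega] at h4
    have h5 := hsuf (l.length - (i + 2))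
    rw [h2] at h5
    have h6 := (unfoldTree_spec h hv h5.2).2.2.2
    have h7 := unfoldTree_cons_mem (G := G) (v := v) (h6.symm ▸ h5.1)
    refine (Finset.mem_sdiff.1 h7).2 ?_
    simp only at heq
    rw [← h2, ← heq, h4]
    exact Finset.mem_singleton_self _

lemma eq_of_unfoldTree_drop_eq (h : IsBiregularWith G A B a b) (hv : v ∈ A) :
    ∀ {l l' : List ℕ}, IsTreeWord a b l → IsTreeWord a b l' → l.length = l'.length →
      (∀ k, (unfoldTree G v (l.drop k)).1 = (unfoldTree G v (l'.drop k)).1) → l = l' := by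
  intro l
  induction l with
  | nil => intro l' _ _ hlen _; exact (List.length_eq_zero_iff.1 hlen.symm).symm
  | cons c l ih =>
    rintro (_ | ⟨c', l'⟩) hl hl' hlen hk
    · simp at hlen
    · obtain rfl := ih hl.2 hl'.2 (by simpa using hlen) fun k => hk (k + 1)
      have hcard := (unfoldTree_spec h hv hl.2).2.2.2
      rw [unfoldTree_cons_inj (hcard.symm ▸ hl.1) (hcard.symm ▸ hl'.1) (hk 0)]

/-- In a biregular graph without short cycles, the unfolding is a local tree. -/
lemma isLocalTree_unfoldTree (h : IsBiregularWith G A B a b) (hv : v ∈ A) {r : ℕ}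
    (hg : NoShortCycles G (2 * r)) : IsLocalTree G a b r fun l => (unfoldTree G v l).1 := by
  refine ⟨fun l l' hl hr hl' hr' heq => ?_, fun l hl _ u => unfoldTree_adj_iff h hv hl u⟩
  obtain ⟨hlen, hk⟩ := hg.walk_unique (by simp) (unfoldTree_isNonBacktracking h hv hl)
    (unfoldTree_isNonBacktracking h hv hl') (by simpa using heq) (by omega)
  refine eq_of_unfoldTree_drop_eq h hv hl hl' hlen fun k => ?_
  rcases Nat.lt_or_ge l.length k with hlt | hge
  · rw [List.drop_eq_nil_of_le hlt.le, List.drop_eq_nil_of_le (by omega)]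
  · have := hk (l.length - k) (by omega)
    simpa only [← hlen, Nat.sub_sub_self hge] using this

end Unfold

/-- A local tree of radius `r + 1` makes the `r`-ball isomorphic to that of the tree. -/
lemma IsLocalTree.ball_isIso {V : Type} {G : SimpleGraph V} {a b r : ℕ} {φ : List ℕ → V}
    (hφ : IsLocalTree G a b (r + 1) φ) :
    ((rootedBiregularTree a b).ball r).IsIso ((RootedGraph.mk V G (φ [])).ball r) := by
  have hdist : ∀ l, IsTreeWord a b l → l.length ≤ r → G.edist (φ []) (φ l) ≤ l.length := by
    intro l
    induction l with
    | nil => intro _ _; simp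
    | cons c l ih =>
      intro hl hr
      rw [List.length_cons] at hr
      rw [List.length_cons, edist_le_succ_iff]
      exact .inr ⟨φ l, ih hl.2 (by omega), (hφ.adj_iff l hl.2 (by omega) _).2
        (.inl ⟨c, hl.1, rfl⟩)⟩
  have hsurj : ∀ n ≤ r, ∀ w, G.edist (φ []) w ≤ n →
      ∃ l, IsTreeWord a b l ∧ l.length ≤ n ∧ φ l = w := by
    intro n
    induction n with
    | zero =>
      intro _ w hw
      exact ⟨[], trivial, le_rfl, edist_le_zero_iff.1 hw⟩
    | succ n ih =>
      intro hn w hw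
      rcases edist_le_succ_iff.1 hw with hw | ⟨w', hw', hadj⟩
      · obtain ⟨l, hl, hln, rfl⟩ := ih (by omega) w hw
        exact ⟨l, hl, by omega, rfl⟩
      · obtain ⟨l, hl, hln, rfl⟩ := ih (by omega) w' hw'
        rcases (hφ.adj_iff l hl (by omega) w).1 hadj with ⟨c, hc, rfl⟩ | ⟨c, l', rfl, rfl⟩
        · exact ⟨c :: l, ⟨hc, hl⟩, by simpa using hln, rfl⟩
        · exact ⟨l', hl.2, by simp at hln; omega, rfl⟩
  have hlen : ∀ x : ((rootedBiregularTree a b).ball r).V, x.1.1.length ≤ r := fun x =>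
    (edist_tree_le_iff x.1).1 x.2
  let ψ : ((rootedBiregularTree a b).ball r).V → ((RootedGraph.mk V G (φ [])).ball r).V := fun x =>
    ⟨φ x.1.1, (hdist x.1.1 x.1.2 (hlen x)).trans (by exact_mod_cast hlen x)⟩
  have hψ : Function.Bijective ψ := by
    constructor
    · intro x y hxy
      exact Subtype.ext (Subtype.ext (hφ.inj _ _ x.1.2 ((hlen x).trans (Nat.le_succ r)) y.1.2
        ((hlen y).trans (Nat.le_succ r)) (congrArg (fun z => z.1) hxy)))
    · rintro ⟨w, hw⟩
      obtain ⟨l, hl, hlr, rfl⟩ := hsurj r le_rfl w hw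
      exact ⟨⟨⟨l, hl⟩, (edist_tree_le_iff _).2 hlr⟩, rfl⟩
  refine ⟨⟨Equiv.ofBijective ψ hψ, ?_⟩, rfl⟩
  intro x y
  change G.Adj (φ x.1.1) (φ y.1.1) ↔ (biregularTreeGraph a b).Adj x.1 y.1
  have hx := hlen x
  have hy := hlen y
  refine (hφ.adj_iff _ x.1.2 (by omega) _).trans (Iff.trans ?_ biregularTreeGraph_adj.symm)
  constructor
  · rintro (⟨c, hc, h⟩ | ⟨c, l', h, h'⟩)
    · exact .inl ⟨c, hφ.inj _ _ y.1.2 (by omega) ⟨hc, x.1.2⟩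
        (by rw [List.length_cons]; omega) h⟩
    · have hl' : IsTreeWord a b l' := (h ▸ x.1.2 : IsTreeWord a b (c :: l')).2
      have hlen' : l'.length ≤ r := by rw [h, List.length_cons] at hx; omega
      have := hφ.inj _ _ y.1.2 (by omega) hl' (by omega) h'
      exact .inr ⟨c, by rw [h, this]⟩
  · rintro (⟨c, h⟩ | ⟨c, h⟩)
    · exact .inl ⟨c, (h ▸ y.1.2 : IsTreeWord a b (c :: x.1.1)).1, by rw [h]⟩
    · exact .inr ⟨c, _, h, rfl⟩

/-- In a biregular graph of large girth the local statistics are those of the biregular tree. -/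
lemma ballProb_eq {G : FiniteGraph} {a b r : ℕ} (ha : 0 < a) (hb : 0 < b)
    (hG : IsBiregularBipartite G.graph a b) (hg : NoShortCycles G.graph (2 * (r + 1)))
    (α : RootedGraph) : G.ballProb α r = (biregularTree a b).ballProb α r := by
  obtain ⟨A, B, h⟩ := hG.exists_with
  have hA : ∀ v ∈ A, ((rootedBiregularTree a b).ball r).IsIso
      ((RootedGraph.mk G.V G.graph v).ball r) := fun v hv =>
    (isLocalTree_unfoldTree h hv hg).ball_isIso
  have hB : ∀ v ∈ B, ((rootedBiregularTree b a).ball r).IsIso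
      ((RootedGraph.mk G.V G.graph v).ball r) := fun v hv =>
    (isLocalTree_unfoldTree h.symm hv hg).ball_isIso
  have hset : {v : G.V | ((RootedGraph.mk G.V G.graph v).ball r).IsIso α}
      = ↑((if ((rootedBiregularTree b a).ball r).IsIso α then B else ∅) ∪
        if ((rootedBiregularTree a b).ball r).IsIso α then A else ∅) := by
    ext v
    have hd := Finset.disjoint_left.1 h.disjoint
    simp only [Set.mem_ofPred_eq, Finset.coe_union, Set.mem_union, Finset.mem_coe]
    rcases h.mem_or v with hv | hv
    · have h1 : ((RootedGraph.mk G.V G.graph v).ball r).IsIso α ↔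
          ((rootedBiregularTree a b).ball r).IsIso α :=
        ⟨fun h' => (hA v hv).trans h', fun h' => (hA v hv).symm.trans h'⟩
      rw [h1]
      split_ifs <;> simp_all
    · have hvA : v ∉ A := fun hv' => hd hv' hv
      have h1 : ((RootedGraph.mk G.V G.graph v).ball r).IsIso α ↔
          ((rootedBiregularTree b a).ball r).IsIso α :=
        ⟨fun h' => (hB v hv).trans h', fun h' => (hB v hv).symm.trans h'⟩
      rw [h1]
      split_ifs <;> simp_all
  rw [biregularTree_ballProb a b ha, FiniteGraph.ballProb, hset, Set.ncard_coe_finset,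
    Finset.card_union_of_disjoint]
  · push_cast
    rw [add_div, ← h.card_left_div ha, add_comm (a : ℝ), ← h.symm.card_left_div hb]
    split_ifs <;> simp
  · split_ifs <;> simp [h.disjoint.symm]

lemma IsBiregularBipartite.boundedDegree {V : Type u} {G : SimpleGraph V} {a b : ℕ}
    (hG : IsBiregularBipartite G a b) (v : V) : (G.neighborSet v).ncard ≤ a + b := by
  obtain ⟨A, B, -, hu, hA, hB⟩ := hG
  have : v ∈ A ∪ B := hu ▸ Set.mem_univ v
  rcases this with hv | hv
  · rw [hA v hv]; omega
  · rw [hB v hv]; omega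

/-- Biregular graphs of growing girth approximate the biregular tree. -/
lemma approximates_of_noShortCycles {G : ℕ → FiniteGraph} {a b : ℕ} (ha : 0 < a) (hb : 0 < b)
    (hG : ∀ i, IsBiregularBipartite (G i).graph a b) (hg : ∀ i, NoShortCycles (G i).graph i) :
    Approximates G (biregularTree a b) (biregularEnd a b) := by
  refine ⟨⟨a + b, fun i v => (hG i).boundedDegree v⟩, fun α r _ _ => ?_,
    fun i => biregularEnd_le_pStar ha hb (hG i)⟩
  refine tendsto_const_nhds.congr' ?_
  filter_upwards [eventually_ge_atTop (2 * (r + 1))] with i hi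
  exact (ballProb_eq ha hb (hG i) ((hg i).mono hi) α).symm

/-- Every biregular graph is covered by a sequence of graphs that approximates the biregular tree,
of pressures at most that of the graph. -/
lemma exists_approximates_pressure_le {V : Type} [Fintype V] [Nonempty V] {G : SimpleGraph V}
    {a b : ℕ} (ha : 0 < a) (hb : 0 < b) (hG : IsBiregularBipartite G a b) :
    ∃ H : ℕ → FiniteGraph, Approximates H (biregularTree a b) (biregularEnd a b) ∧
      ∀ i t, 0 ≤ t → pressure (H i).graph t ≤ pressure G t := by
  obtain ⟨A, hA⟩ := hG.exists_isBipartition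
  choose H π hπ hp hH using fun g => exists_cover_noShortCycles hA g
  exact ⟨H, approximates_of_noShortCycles ha hb (fun i => (hπ i).isBiregularBipartite hG) hH, hp⟩

lemma isBiregularBipartite_completeBipartiteGraph (a b : ℕ) :
    IsBiregularBipartite (completeBipartiteGraph (Fin b) (Fin a)) a b := by
  refine ⟨Set.range Sum.inl, Set.range Sum.inr, ⟨?_, ?_⟩, Set.range_inl_union_range_inr, ?_, ?_⟩
  · exact Set.isCompl_range_inl_range_inr.disjoint
  · rintro (x | x) (y | y) h <;> simp_all
  · rintro _ ⟨x, rfl⟩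
    have : (completeBipartiteGraph (Fin b) (Fin a)).neighborSet (Sum.inl x)
        = Set.range Sum.inr := by
      ext (y | y) <;> simp
    rw [this, ← Set.image_univ, Set.ncard_image_of_injective _ Sum.inr_injective]
    simp
  · rintro _ ⟨x, rfl⟩
    have : (completeBipartiteGraph (Fin b) (Fin a)).neighborSet (Sum.inr x)
        = Set.range Sum.inl := by
      ext (y | y) <;> simp
    rw [this, ← Set.image_univ, Set.ncard_image_of_injective _ Sum.inl_injective]
    simp

/-! ### The lower bound for biregular graphs -/

section LowerBound

/-- A finite graph, transported to the vertex set `Fin n`. -/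
lemma exists_model {V : Type u} [Fintype V] [Nonempty V] (G : SimpleGraph V) :
    ∃ (W : FiniteGraph) (π : W.V → V), IsCovering W.graph G π ∧
      ∀ t, 0 ≤ t → pressure W.graph t ≤ pressure G t := by
  have hne : Nonempty (Fin (Fintype.card V)) := ⟨⟨0, Fintype.card_pos⟩⟩
  set π : Fin (Fintype.card V) ≃ V := (Fintype.equivFin V).symm with hπ
  refine ⟨⟨Fin (Fintype.card V), G.comap π⟩, π, ⟨fun x y h => h, fun x v h => ?_⟩, fun t ht => ?_⟩
  · refine ⟨π.symm v, ⟨?_, π.apply_symm_apply v⟩, ?_⟩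
    · simpa using h
    · rintro y ⟨_, rfl⟩
      simp
  · have hinj : Function.Injective (Sym2.map π) := Sym2.map.injective π.injective
    have hcount : ∀ k, matchingCount (G.comap π) k ≤ matchingCount G k := by
      intro k
      refine Set.ncard_le_ncard_of_injOn (fun M => M.image (Sym2.map π)) ?_
        (fun M _ N _ h => Finset.image_injective hinj h)
      rintro M ⟨hk, hE, hM⟩
      refine ⟨by rw [Finset.card_image_of_injective _ hinj, hk], ?_, ?_⟩
      · intro e he
        obtain ⟨e₀, he₀, rfl⟩ := Finset.mem_image.1 he
        have := hE e₀ he₀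
        induction e₀ using Sym2.ind with
        | _ x y => exact this
      · intro e he f hf hne v hv
        obtain ⟨e₀, he₀, rfl⟩ := Finset.mem_image.1 he
        obtain ⟨f₀, hf₀, rfl⟩ := Finset.mem_image.1 hf
        obtain ⟨x, hx, rfl⟩ := Sym2.mem_map.1 hv.1
        obtain ⟨y, hy, hxy⟩ := Sym2.mem_map.1 hv.2
        rw [π.injective hxy] at hy
        exact hM e₀ he₀ f₀ hf₀ (fun h => hne (by rw [h])) x ⟨hx, hy⟩
    change Real.log (matchingGen (G.comap π) t) / Fintype.card (Fin (Fintype.card V))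
      ≤ Real.log (matchingGen G t) / Fintype.card V
    rw [Fintype.card_fin]
    refine div_le_div_of_nonneg_right (Real.log_le_log (matchingGen_pos _ ht) ?_) (by positivity)
    unfold matchingGen
    rw [Fintype.card_fin]
    gcongr with k _
    exact_mod_cast hcount k

variable {V : Type u} [Fintype V] [Nonempty V] {G : SimpleGraph V} {a b : ℕ}

lemma biregularEnd_pos (ha : 0 < a) (hb : 0 < b) : 0 < biregularEnd a b := by
  unfold biregularEnd
  have ha' : (0 : ℝ) < a := by exact_mod_cast ha
  have hb' : (0 : ℝ) < b := by exact_mod_cast hb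
  exact lt_min (by positivity) (by positivity)

/-- The covers of `G` of large girth have at most the entropy of `G`, and their entropies converge
to that of the tree. -/
lemma biregularG_le_freeEntropy (ha : 0 < a) (hb : 0 < b) (hG : IsBiregularBipartite G a b)
    {p : ℝ} (hp : 0 < p) (hp' : p < biregularEnd a b) :
    biregularG a b p ≤ freeEntropy G (activity G p) := by
  obtain ⟨W, π, hπ, hW⟩ := exists_model G
  obtain ⟨H, hH, hle⟩ := exists_approximates_pressure_le ha hb (hπ.isBiregularBipartite hG)
  have hpG := hp'.trans_le (biregularEnd_le_pStar ha hb hG)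
  refine le_of_tendsto' (tendsto_entropy_biregularG ha hb hH hp.le hp') fun i => ?_
  have hpH := hp'.trans_le (hH.le_pStar i)
  have ht := activity_pos G hp hpG
  rw [entropy_of_lt _ hpH, freeEntropy_activity G hp.le hpG]
  refine (freeEntropy_activity_le (H i).graph hp hpH ht).trans ?_
  have := (hle i _ ht.le).trans (hW _ ht.le)
  linarith

/-- Since the entropy is the infimum of affine functions, and bounded below, it has a limit at the
right end of its domain. -/
lemma exists_tendsto_freeEntropy (ha : 0 < a) (hb : 0 < b) (hG : IsBiregularBipartite G a b)
    (hend : biregularEnd a b = pStar G) :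
    ∃ L, Tendsto (fun q => freeEntropy G (activity G q)) (𝓝[<] (biregularEnd a b)) (𝓝 L) := by
  set p₀ := biregularEnd a b with hp₀
  have hpos : 0 < p₀ := biregularEnd_pos ha hb
  have h0 : 0 < p₀ / 2 := by positivity
  obtain ⟨_, ht₀⟩ := activity_spec G h0.le (by rw [← hend]; linarith : p₀ / 2 < pStar G)
  set t₀ := activity G (p₀ / 2)
  have ht₀pos : 0 < t₀ := activity_pos G h0 (by rw [← hend]; linarith)
  -- the slopes `-ln t / 2` of the affine functions are bounded above by that at `p₀ / 2`
  have hanti : ∀ q q', p₀ / 2 < q → q ≤ q' → q' < p₀ →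
      freeEntropy G (activity G q') + q' / 2 * Real.log t₀
        ≤ freeEntropy G (activity G q) + q / 2 * Real.log t₀ := by
    intro q q' hq hqq' hq'
    have hqG : q < pStar G := by rw [← hend]; linarith
    have hqpos := activity_pos G (h0.trans hq) hqG
    have hle : t₀ ≤ activity G q := by
      by_contra! hlt
      have := density_mono G hqpos.le hlt.le
      rw [ht₀, (activity_spec G (h0.trans hq).le hqG).2] at this
      linarith
    have h1 := freeEntropy_activity_le G (by linarith : 0 < q') (by rw [← hend]; exact hq') hqpos
    have h2 := freeEntropy_activity G (h0.trans hq).le hqG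
    have h3 := Real.log_le_log ht₀pos hle
    nlinarith
  set g : ℝ → ℝ := fun q => freeEntropy G (activity G (max q (3 / 4 * p₀)))
    + max q (3 / 4 * p₀) / 2 * Real.log t₀ with hg
  have hganti : AntitoneOn g (Set.Iio p₀) := by
    intro q hq q' hq' hqq'
    exact hanti _ _ (lt_max_of_lt_right (by linarith)) (max_le_max_right _ hqq')
      (max_lt hq' (by linarith))
  obtain ⟨c, hc⟩ : ∃ c, ∀ q ∈ Set.Icc 0 p₀, c ≤ biregularG a b q + q / 2 * Real.log t₀ := by
    have hcont : ContinuousOn (fun q => biregularG a b q + q / 2 * Real.log t₀)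
        (Set.Icc 0 p₀) := by
      have := continuous_biregularG a b
      fun_prop
    obtain ⟨c, hc⟩ := (isCompact_Icc.image_of_continuousOn hcont).bddBelow
    exact ⟨c, fun q hq => hc ⟨q, hq, rfl⟩⟩
  have hbdd : BddAbove ((fun q => -g q) '' Set.Iio p₀) := by
    refine ⟨-c, ?_⟩
    rintro _ ⟨q, hq, rfl⟩
    have h1 : 0 < max q (3 / 4 * p₀) := lt_max_of_lt_right (by linarith)
    have h2 : max q (3 / 4 * p₀) < p₀ := max_lt hq (by linarith)
    have := biregularG_le_freeEntropy ha hb hG h1 h2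
    have := hc _ ⟨h1.le, h2.le⟩
    simp only [hg]
    linarith
  have hlim := hganti.neg.tendsto_nhdsLT hbdd
  have hlim' := (hlim.neg).sub
    ((continuous_id.div_const 2).mul_const (Real.log t₀)).continuousWithinAt.tendsto
  refine ⟨_, hlim'.congr' ?_⟩
  filter_upwards [Ioo_mem_nhdsLT (by linarith : 3 / 4 * p₀ < p₀)] with q hq
  simp [hg, max_eq_left hq.1.le]

/-- The entropy of a biregular bipartite graph is at least that of the biregular tree. -/
theorem biregularG_le_entropy (ha : 0 < a) (hb : 0 < b) (hG : IsBiregularBipartite G a b) {p : ℝ}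
    (hp : 0 ≤ p) (hp' : p ≤ biregularEnd a b) : biregularG a b p ≤ entropy G p := by
  have hend := biregularEnd_le_pStar ha hb hG
  rcases hp.eq_or_lt with rfl | hp
  · rw [entropy_zero G ((biregularEnd_pos ha hb).trans_le hend)]
    simp [biregularG]
  rcases hp'.lt_or_eq with hlt | rfl
  · rw [entropy_of_lt G (hlt.trans_le hend)]
    exact biregularG_le_freeEntropy ha hb hG hp hlt
  have hbd : ∀ᶠ q in 𝓝[<] (biregularEnd a b),
      biregularG a b q ≤ freeEntropy G (activity G q) := by
    filter_upwards [Ioo_mem_nhdsLT hp] with q hq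
    exact biregularG_le_freeEntropy ha hb hG hq.1 hq.2
  have hcont : Tendsto (biregularG a b) (𝓝[<] (biregularEnd a b))
      (𝓝 (biregularG a b (biregularEnd a b))) :=
    (continuous_biregularG a b).continuousWithinAt
  rcases hend.lt_or_eq with hlt | heq
  · rw [entropy_of_lt G hlt, freeEntropy_activity G hp.le hlt]
    have ht := activity_pos G hp hlt
    set t := activity G (biregularEnd a b)
    have hlin : Tendsto (fun q => pressure G t - 1 / 2 * q * Real.log t)
        (𝓝[<] (biregularEnd a b))
        (𝓝 (pressure G t - 1 / 2 * biregularEnd a b * Real.log t)) :=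
      ContinuousWithinAt.tendsto (f := fun q => pressure G t - 1 / 2 * q * Real.log t)
        (Continuous.continuousWithinAt (by fun_prop))
    refine le_of_tendsto_of_tendsto hcont hlin ?_
    filter_upwards [hbd, Ioo_mem_nhdsLT hp] with q hq hq'
    exact hq.trans (freeEntropy_activity_le G hq'.1 (hq'.2.trans hlt) ht)
  · obtain ⟨L, hL⟩ := exists_tendsto_freeEntropy ha hb hG heq
    rw [entropy, if_neg heq.not_lt, if_pos heq, hL.limUnder_eq]
    exact le_of_tendsto_of_tendsto hcont hL hbd

/-- The entropy function of the biregular tree. -/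
theorem isEntropyFunction_biregularG (ha : 0 < a) (hb : 0 < b) :
    IsEntropyFunction (biregularTree a b) (biregularEnd a b) (biregularG a b) := by
  have hne : Nonempty (Fin b ⊕ Fin a) := ⟨.inl ⟨0, hb⟩⟩
  obtain ⟨H, hH, -⟩ := exists_approximates_pressure_le ha hb
    (isBiregularBipartite_completeBipartiteGraph a b)
  exact ⟨⟨H, hH⟩, fun G hG p hp hp' => tendsto_entropy_biregularG ha hb hG hp hp',
    (continuous_biregularG a b).continuousWithinAt⟩

end LowerBound

end

end MonomerDimer

theorem mainTheorem5 (a b : ℕ) (ha : 0 < a) (hb : 0 < b) :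
    (∀ (V : Type*) [Fintype V] [Nonempty V] (G : SimpleGraph V),
      MonomerDimer.IsBiregularBipartite G a b →
      ∀ p : ℝ, 0 ≤ p → p ≤ MonomerDimer.biregularEnd a b →
        MonomerDimer.biregularG a b p ≤ MonomerDimer.entropy G p) ∧
    MonomerDimer.IsEntropyFunction (MonomerDimer.biregularTree a b)
      (MonomerDimer.biregularEnd a b) (MonomerDimer.biregularG a b) :=
  ⟨fun _ _ _ _ hG _ hp hp' => MonomerDimer.biregularG_le_entropy ha hb hG hp hp',
    MonomerDimer.isEntropyFunction_biregularG ha hb⟩
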